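/- **Algorithm.** For texts $T,u$ let $\mathrm{occ}_T(u)$ be the number of (possibly overlapping) occurrences of $u$ in $T$. A *maximal repeat* of $T$ is a string $u$ with $|u|>1$ and $\mathrm{occ}_T(u)\ge 2$ such that every longer substring of $T$ of the form $wu$ or $uw$ occurs strictly fewer times in $T$ than $u$. RL-MR-RePair constructs from a text $T$ over an alphabet of terminals a run-length context-free grammar $G=(\Sigma,V,s,R)$, where $\Sigma$ is the set of terminals that occur in $T$, as follows. First every $a\in\Sigma$ is replaced in $T$ by a new variable $v_a$, with a rule $v_a\to a$. As long as the current text has a maximal repeat, a most frequent one, $r$, is chosen (ties are broken arbitrarily). If $r=x^2$ for a variable $x$, then every maximal run $x^k$ ($k\ge 2$) in the text is replaced by a new variable $v_k$ (the same one for runs of the same length, different ones for different lengths), with rules $v_k\to x^k$. Otherwise, the last symbol of $r$ is dropped if $|r|>2$ and the first and the last symbol of $r$ agree, and every occurrence of the resulting string $r$ is replaced, from left to right, by a new variable $v$, with a rule $v\to r$. When the text has no maximal repeat any more, a rule $s\to(\text{current text})$ is added, where $s$ is a new variable, the start symbol. **Theorem.** RL-MR-RePair can be carried out in $\mathcal O(n)$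 expected time on a randomized unit-cost word RAM, where $n$ is the length of the input text. Precisely: there are a randomized word-RAM program $P$ and constants $C,c\in\mathbb N$ such that for every $\sigma$, every text $T$ of length $n\ge 0$ with symbols in $\{0,\dots,\sigma-1\}$ and every word length $w$ with $2^w\ge (n+\sigma+2)^c$ the following holds. Whenever $P$ halts on $T$ (given as an array of $n$ words of $w$ bits, together with $n$), for whatever random words it draws, its output is a list of the start symbol and the rules of a grammar that RL-MR-RePair constructs from $T$; and the expected number of steps until $P$ halts, over independent uniformly distributed random words, is at most $C\,(n+1)$. (In particular, $P$ halts almost surely.) -/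

import Mathlib

namespace RLMRRePair

/-! ### Texts, frequencies, maximal repeats, runs -/

/-- The frequency of `u` in the text `T`: the number of positions of `T` at which `u` occurs
(occurrences may overlap). -/
def occ (T u : List ℕ) : ℕ := T.tails.countP fun t => u.isPrefixOf t

/-- `u` is left maximal in `T`: all its left extensions (substrings `w u` of `T` with `w`
nonempty) occur strictly fewer times than `u`. This includes the case without extensions. -/
def LeftMaximal (T u : List ℕ) : Prop :=
  ∀ w : List ℕ, w ≠ [] → w ++ u <:+: T → occ T (w ++ u) < occ T u

/-- `u` is right maximal in `T`. -/
def RightMaximal (T u : List ℕ) : Prop :=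
  ∀ w : List ℕ, w ≠ [] → u ++ w <:+: T → occ T (u ++ w) < occ T u

/-- `u` is a maximal repeat of `T`; only strings of length greater than `1` are considered. -/
def IsMaximalRepeat (T u : List ℕ) : Prop :=
  1 < u.length ∧ 2 ≤ occ T u ∧ LeftMaximal T u ∧ RightMaximal T u

/-- `r` is a most frequent maximal repeat of `T`. -/
def IsMostFrequentMaximalRepeat (T r : List ℕ) : Prop :=
  IsMaximalRepeat T r ∧ ∀ u, IsMaximalRepeat T u → occ T u ≤ occ T r

/-- `x ^ k` occurs in `T` as a run, that is, at some place where it cannot be prolonged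
to the left or to the right by a further `x`. -/
def IsRun (T : List ℕ) (x k : ℕ) : Prop :=
  ∃ u t : List ℕ, T = u ++ List.replicate k x ++ t ∧ u.getLast? ≠ some x ∧ t.head? ≠ some x

/-! ### Run-length context free grammars -/

/-- Terminals and variables are represented by natural numbers. They never get mixed up:
each place of a rule holds either a terminal or variables. -/
abbrev Terminal := ℕ

abbrev Var := ℕ

/-- Right-hand sides of rules: a terminal, a sequence of variables, or a run `x ^ k`. -/
inductive Rhs where
  | term (a : Terminal)
  | seq (l : List Var)
  | run (x : Var) (k : ℕ)
  deriving DecidableEq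

/-- A production rule `v → α`. -/
abbrev Rule := Var × Rhs

structure Grammar where
  terminals : Finset Terminal
  vars : Finset Var
  start : Var
  rules : Finset Rule

/-! ### The algorithm -/

/-- `ReplaceAll r v T T'`: the text `T'` results from `T` by replacing each `r` by `v`,
scanning from left to right. -/
inductive ReplaceAll (r : List Var) (v : Var) : List Var → List Var → Prop
  | nil : ReplaceAll r v [] []
  | hit {T T' : List Var} : ReplaceAll r v T T' → ReplaceAll r v (r ++ T) (v :: T')
  | miss {a : Var} {T T' : List Var} : ¬ r <+: a :: T → ReplaceAll r v T T' →
      ReplaceAll r v (a :: T) (a :: T')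

/-- `ReplaceRuns x v T T'`: the text `T'` results from `T` by replacing each (maximal) run
`x ^ k` with `k ≥ 2` by the variable `v k`. -/
inductive ReplaceRuns (x : Var) (v : ℕ → Var) : List Var → List Var → Prop
  | nil : ReplaceRuns x v [] []
  | other {a : Var} {T T' : List Var} : a ≠ x → ReplaceRuns x v T T' →
      ReplaceRuns x v (a :: T) (a :: T')
  | single {T T' : List Var} : T.head? ≠ some x → ReplaceRuns x v T T' →
      ReplaceRuns x v (x :: T) (x :: T')
  | run {k : ℕ} {T T' : List Var} : 2 ≤ k → T.head? ≠ some x → ReplaceRuns x v T T' →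
      ReplaceRuns x v (List.replicate k x ++ T) (v k :: T')

/-- Drop the last symbol of a string of length greater than `2` whose first and last
symbols agree. -/
def trim (r : List Var) : List Var :=
  if 2 < r.length ∧ r.head? = r.getLast? then r.dropLast else r

/-- The data maintained by the algorithm: current text, variables, rules. -/
structure AlgState where
  text : List Var
  vars : Finset Var
  rules : Finset Rule

/-- One round of the main loop. Ties between most frequent maximal repeats and the names of
the new variables are left open. -/
inductive Round : AlgState → AlgState → Prop
  /-- The chosen most frequent maximal repeat is `x ^ 2`: replace every run of `x`;
  `K` is the set of the lengths of these runs, `v k` the new variable for `x ^ k`. -/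
  | runs {S : AlgState} {text' : List Var} (x : Var) (v : ℕ → Var) (K : Finset ℕ) :
      IsMostFrequentMaximalRepeat S.text [x, x] →
      (∀ k, k ∈ K ↔ 2 ≤ k ∧ IsRun S.text x k) →
      Set.InjOn v K → (∀ k ∈ K, v k ∉ S.vars) →
      ReplaceRuns x v S.text text' →
      Round S ⟨text', S.vars ∪ K.image v, S.rules ∪ K.image fun k => (v k, Rhs.run x k)⟩
  /-- The chosen most frequent maximal repeat is not a square of a variable. -/
  | plain {S : AlgState} {text' : List Var} (r : List Var) (v : Var) :
      IsMostFrequentMaximalRepeat S.text r → (∀ x, r ≠ [x, x]) →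
      v ∉ S.vars →
      ReplaceAll (trim r) v S.text text' →
      Round S ⟨text', insert v S.vars, insert (v, Rhs.seq (trim r)) S.rules⟩

/-- The state after replacing each terminal `a` of `T` by the variable `ν a`. -/
def initState (T : List Terminal) (ν : Terminal → Var) : AlgState where
  text := T.map ν
  vars := T.toFinset.image ν
  rules := T.toFinset.image fun a => (ν a, Rhs.term a)

/-- `G` is a grammar constructed by the algorithm RL-MR-RePair from the text `T`. -/
def Constructs (T : List Terminal) (G : Grammar) : Prop :=
  ∃ (ν : Terminal → Var) (S : AlgState) (s : Var),
    Set.InjOn ν {a | a ∈ T} ∧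
    Relation.ReflTransGen Round (initState T ν) S ∧
    (¬ ∃ r, IsMaximalRepeat S.text r) ∧
    s ∉ S.vars ∧
    G = ⟨T.toFinset, insert s S.vars, s, insert (s, Rhs.seq S.text) S.rules⟩

/-- A rule as a sequence of numbers. -/
def encodeRule : Rule → List ℕ
  | (v, Rhs.term a) => [v, 0, a]
  | (v, Rhs.seq l) => v :: 1 :: l.length :: l
  | (v, Rhs.run x k) => [v, 2, x, k]

/-- `out` represents `G`: it lists the start symbol and then the rules, each rule once, in some
order. (Every variable has a rule, and the terminals are those in the rules `v → a`.) -/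
def Represents (out : List ℕ) (G : Grammar) : Prop :=
  ∃ L : List Rule, L.Nodup ∧ L.toFinset = G.rules ∧ out = G.start :: L.flatMap encodeRule

/-! ### A randomized word RAM with words of `w` bits

Registers and memory cells hold numbers less than `2 ^ w`. -/

inductive BinOp where
  | add | sub | mul | div | mod | land | lor | xor | shl | shr | lt | eq

/-- Operations on words, modulo `2 ^ w`; comparisons yield `1` or `0`. -/
def BinOp.eval (w : ℕ) (o : BinOp) (x y : ℕ) : ℕ :=
  (match o with
    | .add => x + y
    | .sub => x + 2 ^ w - y
    | .mul => x * y
    | .div => x / y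
    | .mod => x % y
    | .land => x &&& y
    | .lor => x ||| y
    | .xor => x ^^^ y
    | .shl => x <<< y
    | .shr => x >>> y
    | .lt => if x < y then 1 else 0
    | .eq => if x = y then 1 else 0) % 2 ^ w

/-- Programs. The natural numbers `r a b` are names of registers; a program mentions only
finitely many of them. -/
inductive Prog where
  /-- do nothing -/
  | nop
  /-- register `r` gets the constant `c` -/
  | const (r c : ℕ)
  /-- register `r` gets the result of the operation `o` on the registers `a` and `b` -/
  | op (o : BinOp) (r a b : ℕ)
  /-- register `r` gets the content of the memory cell whose address is in register `a` -/
  | load (r a : ℕ)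
  /-- the memory cell whose address is in register `a` gets the content of register `b` -/
  | store (a b : ℕ)
  /-- register `r` gets a fresh uniformly random word -/
  | rand (r : ℕ)
  /-- `p`, then `q` -/
  | seq (p q : Prog)
  /-- `p` if register `r` is nonzero, else `q` -/
  | ite (r : ℕ) (p q : Prog)
  /-- repeat `p` while register `r` is nonzero -/
  | loop (r : ℕ) (p : Prog)

/-- Registers, memory, and the number of random words consumed so far. -/
structure Store where
  reg : ℕ → ℕ
  mem : ℕ → ℕ
  used : ℕ

def Store.setReg (s : Store) (r x : ℕ) : Store := { s with reg := Function.update s.reg r x }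

/-- A stack of programs still to be executed, and a store. -/
abbrev Config := List Prog × Store

/-- One step of computation, with the supply `ω` of random words. -/
def step (w : ℕ) (ω : ℕ → Fin (2 ^ w)) : Config → Config
  | ([], s) => ([], s)
  | (.nop :: K, s) => (K, s)
  | (.const r c :: K, s) => (K, s.setReg r (c % 2 ^ w))
  | (.op o r a b :: K, s) => (K, s.setReg r (o.eval w (s.reg a) (s.reg b)))
  | (.load r a :: K, s) => (K, s.setReg r (s.mem (s.reg a)))
  | (.store a b :: K, s) => (K, { s with mem := Function.update s.mem (s.reg a) (s.reg b) })
  | (.rand r :: K, s) => (K, { s.setReg r (ω s.used) with used := s.used + 1 })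
  | (.seq p q :: K, s) => (p :: q :: K, s)
  | (.ite r p q :: K, s) => ((if s.reg r ≠ 0 then p else q) :: K, s)
  | (.loop r p :: K, s) => if s.reg r ≠ 0 then (p :: .loop r p :: K, s) else (K, s)

/-- The input: register `0` holds the length of `T`, the memory cells `0, 1, 2, …` hold the
symbols of `T`, everything else is `0`. -/
def inputStore (T : List ℕ) : Store where
  reg := fun r => if r = 0 then T.length else 0
  mem := fun i => T.getD i 0
  used := 0

/-- The configuration after `t` steps of the program `P` on the input `T`. -/
def runFor (P : Prog) (w : ℕ) (T : List ℕ) (ω : ℕ → Fin (2 ^ w)) (t : ℕ) : Config :=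
  (step w ω)^[t] ([P], inputStore T)

/-- `P` halts on `T` with the store `s`. -/
def HaltsWith (P : Prog) (w : ℕ) (T : List ℕ) (ω : ℕ → Fin (2 ^ w)) (s : Store) : Prop :=
  ∃ t, runFor P w T ω t = ([], s)

/-- The output: register `0` holds its address and register `1` its length. -/
def Store.output (s : Store) : List ℕ :=
  (List.range (s.reg 1)).map fun i => s.mem (s.reg 0 + i)

open scoped ENNReal

/-- The number of steps of `P` on `T` until it halts (`∞` if it does not). -/
noncomputable def time (P : Prog) (w : ℕ) (T : List ℕ) (ω : ℕ → Fin (2 ^ w)) : ℝ≥0∞ :=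
  ⨅ (t : ℕ) (_ : (runFor P w T ω t).1 = []), (t : ℝ≥0∞)

/-- The law of a sequence of independent, uniformly distributed words. -/
noncomputable def randomWords (w : ℕ) : MeasureTheory.Measure (ℕ → Fin (2 ^ w)) :=
  MeasureTheory.Measure.infinitePi fun _ => (PMF.uniformOfFintype (Fin (2 ^ w))).toMeasure

/-- The expected number of steps of `P` on `T`. -/
noncomputable def expectedTime (P : Prog) (w : ℕ) (T : List ℕ) : ℝ≥0∞ :=
  ∫⁻ ω, time P w T ω ∂randomWords w

end RLMRRePair

namespace RLMRRePair

/-! ### An intermediate language with named registers and three-dimensional arrays -/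

/-! The program is deterministic. Memory is zero at the start and a word can address a large power
of `n + σ + 2` cells, so every table that would otherwise be a hash table is a directly addressed
array that never needs clearing. Linear time then holds in the worst case, and the bound on the
expectation is the integral of a constant.

Combinatorics. A string of length at least two occurs at most as often as its first pair. Let `f ≥
2` be the largest frequency of a pair. If all occurrences of a pair of frequency `f` are extended to
the right and then to the left as long as the adjacent symbols agree, the result `r` still occurs
`f` times and has no equally frequent extension; it is a most frequent maximal repeat
(`mostFrequent_of_not_extendable`). So statistics of pairs suffice. Every pair inside `r` occurs
exactly `f` times, and pairs at different offsets differ, for otherwise two different translates of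
one finite set of positions would coincide (`At.pair_inj`). Hence occurrences of `r` share at most
one symbol (`At.sep`), become disjoint after `trim` (`At.trim_sep`), and satisfy `f * (|r| - 1) ≤
|text|` (`mul_length_le`).

Time. Extending costs `O(f * |r|)`. Replacing `trim r` removes `f * (|trim r| - 1)` symbols, at
least half of `f * (|r| - 1)`; replacing the runs of a square removes exactly `f` symbols
(`ReplaceRuns.length_eq`). So the rounds are paid for by the symbols they remove. The largest pair
frequency never grows, because a new variable occurs at most `f` times (`ReplaceAll.occ_pair_le_of`,
`ReplaceRuns.occ_pair_le_of`); one downward scan over the frequencies finds all rounds.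

Data. The text is a doubly linked list between two sentinels. Pair frequencies are exact, while the
stacks of occurrences and the buckets of pairs of equal frequency are lazy (`Bag`): outdated entries
stay until they are popped and fail a constant-time test. A round empties the stack of its pair,
which is harmless since that pair no longer occurs afterwards (`ReplaceAll.occ_pair_add_count_le`,
`ReplaceRuns.occ_self`). Pops are paid for by pushes: the number `T` of stack entries is part of the
potential in `wp_mainC`.

Implementation. The program is written in a small language whose semantics spends time credits; it
is verified by weakest preconditions and compiled to the word RAM by a simulation that bounds time
and size of values by the credits spent (`Ev.sim`). -/

inductive Reg where
  | rn | rolen | rf | rnv | ra | rb | ri | rj | rx | ry | rp | rq | rr | rm | rm2 | rgo | rc | rlen | rst | rl | rw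
  deriving DecidableEq

/-- `tok` holds the symbols of the nodes, `nb 0` and `nb 1` the links to the next and the previous
node, `cnt` the pair frequencies, `slen`, `st1`, `st2` the stacks. `E 0` and `E 1` are the last and
the first nodes of the occurrences of the current repeat, `F` lists blocks to be replaced, `mark`
holds round stamps of collected nodes, `sv` and `rv` the variables of terminals and of runs. -/
inductive Arr where
  | inp | out | tok | nb | cnt | slen | st1 | st2 | E | mark | sv | rv | F
  deriving DecidableEq

/-- A named register lives in the RAM register of twice its index, so `rn` finds the text length in
register `0`, and odd registers are free for scratch values. `rf` bounds the pair frequencies, `rnv`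
is the next fresh variable, `ra` and `rb` form the chosen pair, `rm` counts occurrences, `rm2`
blocks to be replaced, and `rlen` is the length of the repeat. -/
def Reg.idx : Reg → ℕ
  | .rn => 0 | .rolen => 1 | .rf => 2 | .rnv => 3 | .ra => 4 | .rb => 5 | .ri => 6 | .rj => 7 | .rx => 8
  | .ry => 9 | .rp => 10 | .rq => 11 | .rr => 12 | .rm => 13 | .rm2 => 14 | .rgo => 15 | .rc => 16
  | .rlen => 17 | .rst => 18 | .rl => 19 | .rw => 20

/-- With index `0` for `inp`, its row `(0, 0)` is the input as it lies in memory; with index `1`,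
`out` starts at the cube of the side length. -/
def Arr.idx : Arr → ℕ
  | .inp => 0 | .out => 1 | .tok => 2 | .nb => 3 | .cnt => 4 | .slen => 5 | .st1 => 6 | .st2 => 7
  | .E => 8 | .mark => 9 | .sv => 10 | .rv => 11 | .F => 12

lemma Reg.idx_injective : Function.Injective Reg.idx := by
  intro a b h
  cases a <;> cases b <;> first | rfl | simp [Reg.idx] at h

lemma Arr.idx_injective : Function.Injective Arr.idx := by
  intro a b h
  cases a <;> cases b <;> first | rfl | simp [Arr.idx] at h

lemma Arr.idx_lt (a : Arr) : a.idx < 16 := by cases a <;> simp [Arr.idx]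

/-! ### Syntax and credit-based semantics. -/

abbrev Arrays := Arr → ℕ → ℕ → ℕ → ℕ

/-- A state: registers, arrays, and the remaining time credits. -/
structure St where
  v : Reg → ℕ
  A : Arrays
  k : ℕ

def Arrays.upd (A : Arrays) (id : Arr) (i j k x : ℕ) : Arrays :=
  fun id' i' j' k' => if id' = id ∧ i' = i ∧ j' = j ∧ k' = k then x else A id' i' j' k'

inductive Exp where
  | lit (c : ℕ)
  | var (x : Reg)
  | inc (e : Exp)
  | pred (e : Exp)
  | eq (a b : Exp)
  | lt (a b : Exp)
  | get (id : Arr) (i j k : Exp)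

def Exp.eval (s : St) : Exp → ℕ
  | .lit c => c
  | .var x => s.v x
  | .inc e => e.eval s + 1
  | .pred e => e.eval s - 1
  | .eq a b => if a.eval s = b.eval s then 1 else 0
  | .lt a b => if a.eval s < b.eval s then 1 else 0
  | .get id i j k => s.A id (i.eval s) (j.eval s) (k.eval s)

inductive Cmd where
  | skip
  | set (x : Reg) (e : Exp)
  | put (id : Arr) (i j k e : Exp)
  | seq (c d : Cmd)
  | ite (e : Exp) (c d : Cmd)
  | loop (e : Exp) (c : Cmd)

def St.tick (s : St) : St := ⟨s.v, s.A, s.k - 1⟩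
def St.setv (s : St) (x : Reg) (a : ℕ) : St := ⟨Function.update s.v x a, s.A, s.k - 1⟩
def St.putA (s : St) (id : Arr) (i j k x : ℕ) : St := ⟨s.v, s.A.upd id i j k x, s.k - 1⟩

/-- Big-step semantics; each elementary command and each test costs one credit. -/
inductive Ev : Cmd → St → St → Prop
  | skip {s} : 1 ≤ s.k → Ev .skip s s.tick
  | set {s x e} : 1 ≤ s.k → Ev (.set x e) s (s.setv x (e.eval s))
  | put {s id i j k e} : 1 ≤ s.k →
      Ev (.put id i j k e) s (s.putA id (i.eval s) (j.eval s) (k.eval s) (e.eval s))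
  | seq {c d s s' s''} : Ev c s s' → Ev d s' s'' → Ev (.seq c d) s s''
  | iteT {e c d s s'} : 1 ≤ s.k → e.eval s ≠ 0 → Ev c s.tick s' → Ev (.ite e c d) s s'
  | iteF {e c d s s'} : 1 ≤ s.k → e.eval s = 0 → Ev d s.tick s' → Ev (.ite e c d) s s'
  | loopF {e c s} : 1 ≤ s.k → e.eval s = 0 → Ev (.loop e c) s s.tick
  | loopT {e c s s' s''} : 1 ≤ s.k → e.eval s ≠ 0 → Ev c s.tick s' → Ev (.loop e c) s' s'' →
      Ev (.loop e c) s s''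

/-- As every command consumes a credit, the credits are a termination measure for all loops. -/
lemma Ev.k_lt {c s s'} (h : Ev c s s') : s'.k + 1 ≤ s.k := by
  induction h <;> simp_all [St.tick, St.setv, St.putA] <;> omega

/-! ### Weakest preconditions -/

/-- Total correctness: the credits of `s` must suffice for the whole run. -/
def wp (c : Cmd) (Q : St → Prop) (s : St) : Prop := ∃ s', Ev c s s' ∧ Q s'

lemma wp.mono {c : Cmd} {Q Q' : St → Prop} {s : St} (h : wp c Q s) (hQ : ∀ s', Q s' → Q' s') :
    wp c Q' s := let ⟨s', h1, h2⟩ := h; ⟨s', h1, hQ _ h2⟩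

lemma wp_skip {Q : St → Prop} {s : St} : wp .skip Q s ↔ 1 ≤ s.k ∧ Q s.tick := by
  constructor
  · rintro ⟨s', h, hQ⟩; cases h; exact ⟨by assumption, hQ⟩
  · rintro ⟨h, hQ⟩; exact ⟨_, .skip h, hQ⟩

lemma wp_set {Q : St → Prop} {s : St} {x : Reg} {e : Exp} :
    wp (.set x e) Q s ↔ 1 ≤ s.k ∧ Q (s.setv x (e.eval s)) := by
  constructor
  · rintro ⟨s', h, hQ⟩; cases h; exact ⟨by assumption, hQ⟩
  · rintro ⟨h, hQ⟩; exact ⟨_, .set h, hQ⟩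

lemma wp_put {Q : St → Prop} {s : St} {id : Arr} {i j k e : Exp} :
    wp (.put id i j k e) Q s ↔
      1 ≤ s.k ∧ Q (s.putA id (i.eval s) (j.eval s) (k.eval s) (e.eval s)) := by
  constructor
  · rintro ⟨s', h, hQ⟩; cases h; exact ⟨by assumption, hQ⟩
  · rintro ⟨h, hQ⟩; exact ⟨_, .put h, hQ⟩

lemma wp_seq {Q : St → Prop} {s : St} {c d : Cmd} : wp (.seq c d) Q s ↔ wp c (wp d Q) s := by
  constructor
  · rintro ⟨s', h, hQ⟩; cases h with | seq h1 h2 => exact ⟨_, h1, _, h2, hQ⟩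
  · rintro ⟨s', h1, s'', h2, hQ⟩; exact ⟨_, .seq h1 h2, hQ⟩

lemma wp_seq_eq {Q : St → Prop} {c d : Cmd} : wp (.seq c d) Q = wp c (wp d Q) :=
  funext fun _ => propext wp_seq

lemma wp_ite {Q : St → Prop} {s : St} {e : Exp} {c d : Cmd} :
    wp (.ite e c d) Q s ↔
      1 ≤ s.k ∧ (e.eval s ≠ 0 → wp c Q s.tick) ∧ (e.eval s = 0 → wp d Q s.tick) := by
  constructor
  · rintro ⟨s', h, hQ⟩
    cases h with
    | iteT h1 h2 h3 => exact ⟨h1, fun _ => ⟨_, h3, hQ⟩, fun h => absurd h h2⟩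
    | iteF h1 h2 h3 => exact ⟨h1, fun h => absurd h2 h, fun _ => ⟨_, h3, hQ⟩⟩
  · rintro ⟨h, h1, h2⟩
    by_cases he : e.eval s = 0
    · obtain ⟨s', h3, hQ⟩ := h2 he; exact ⟨s', .iteF h he h3, hQ⟩
    · obtain ⟨s', h3, hQ⟩ := h1 he; exact ⟨s', .iteT h he h3, hQ⟩

/-- The registers a command may change. -/
def Cmd.wv : Cmd → Reg → Bool
  | .skip, _ => false
  | .set x _, y => decide (y = x)
  | .put .., _ => false
  | .seq c d, y => c.wv y || d.wv y
  | .ite _ c d, y => c.wv y || d.wv y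
  | .loop _ c, y => c.wv y

/-- The arrays a command may change. -/
def Cmd.wa : Cmd → Arr → Bool
  | .skip, _ => false
  | .set .., _ => false
  | .put id .., y => decide (y = id)
  | .seq c d, y => c.wa y || d.wa y
  | .ite _ c d, y => c.wa y || d.wa y
  | .loop _ c, y => c.wa y

/-- `s'` results from `s` by changing only what `c` may change. -/
structure Fr (c : Cmd) (s s' : St) : Prop where
  v : ∀ x, c.wv x = false → s'.v x = s.v x
  A : ∀ id, c.wa id = false → s'.A id = s.A id
  k : s'.k ≤ s.k

lemma Fr.refl (c : Cmd) (s : St) : Fr c s s := ⟨fun _ _ => rfl, fun _ _ => rfl, le_rfl⟩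

lemma Fr.trans {c : Cmd} {s s' s'' : St} (h : Fr c s s') (h' : Fr c s' s'') : Fr c s s'' :=
  ⟨fun x hx => (h'.v x hx).trans (h.v x hx), fun x hx => (h'.A x hx).trans (h.A x hx),
    h'.k.trans h.k⟩

lemma Fr.mono {c d : Cmd} {s s' : St} (h : Fr c s s') (hv : ∀ x, d.wv x = false → c.wv x = false)
    (ha : ∀ x, d.wa x = false → c.wa x = false) : Fr d s s' :=
  ⟨fun x hx => h.v x (hv x hx), fun x hx => h.A x (ha x hx), h.k⟩

lemma Fr.tick {c : Cmd} {s s' : St} (h : Fr c s.tick s') : Fr c s s' :=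
  ⟨h.v, h.A, h.k.trans (Nat.sub_le _ _)⟩

/-- The write sets are computed syntactically, so that later a register or array is seen to be
unchanged by `rfl`. -/
lemma Ev.fr {c s s'} (h : Ev c s s') : Fr c s s' := by
  induction h with
  | skip => exact ⟨fun _ _ => rfl, fun _ _ => rfl, Nat.sub_le _ _⟩
  | set =>
    refine ⟨fun y hy => ?_, fun _ _ => rfl, Nat.sub_le _ _⟩
    simp only [Cmd.wv, decide_eq_false_iff_not] at hy
    simp [St.setv, Function.update_of_ne hy]
  | put =>
    refine ⟨fun _ _ => rfl, fun y hy => ?_, Nat.sub_le _ _⟩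
    simp only [Cmd.wa, decide_eq_false_iff_not] at hy
    funext i j k
    simp [St.putA, Arrays.upd, hy]
  | seq _ _ h1 h2 =>
    exact (h1.mono (by simp +contextual [Cmd.wv]) (by simp +contextual [Cmd.wa])).trans
      (h2.mono (by simp +contextual [Cmd.wv]) (by simp +contextual [Cmd.wa]))
  | iteT _ _ _ h => exact h.tick.mono (by simp +contextual [Cmd.wv]) (by simp +contextual [Cmd.wa])
  | iteF _ _ _ h => exact h.tick.mono (by simp +contextual [Cmd.wv]) (by simp +contextual [Cmd.wa])
  | loopF => exact ⟨fun _ _ => rfl, fun _ _ => rfl, Nat.sub_le _ _⟩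
  | loopT _ _ _ _ h1 h2 =>
    exact (h1.tick.mono (by simp [Cmd.wv]) (by simp [Cmd.wa])).trans h2

lemma wp.fr {c : Cmd} {Q : St → Prop} {s : St} (h : wp c Q s) :
    wp c (fun s' => Q s' ∧ Fr c s s') s := let ⟨s', h1, h2⟩ := h; ⟨s', h1, h2, h1.fr⟩

/-- No variant is needed: the credits decrease, and the invariant only has to guarantee that one is
left. The frame condition relative to the entry state comes for free. -/
lemma wp_while {e : Exp} {c : Cmd} {Q : St → Prop} {s₀ : St} (I : St → Prop) (h0 : I s₀)
    (hk : ∀ s, I s → Fr c s₀ s → 1 ≤ s.k)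
    (hstep : ∀ s, I s → Fr c s₀ s → e.eval s ≠ 0 → wp c I s.tick)
    (hend : ∀ s, I s → Fr c s₀ s → e.eval s = 0 → Q s.tick) : wp (.loop e c) Q s₀ := by
  have key : ∀ (N : ℕ) (s : St), s.k ≤ N → I s → Fr c s₀ s → wp (.loop e c) Q s := by
    intro N
    induction N with
    | zero => intro s h1 h2 h3; have := hk s h2 h3; omega
    | succ N ih =>
      intro s h1 h2 h3
      by_cases he : e.eval s = 0
      · exact ⟨_, .loopF (hk s h2 h3) he, hend s h2 h3 he⟩
      · obtain ⟨s', h4, h5⟩ := hstep s h2 h3 he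
        obtain ⟨s'', h6, h7⟩ := ih s' (by have := h4.k_lt; simp [St.tick] at this; omega) h5
          (h3.trans h4.fr.tick)
        exact ⟨s'', .loopT (hk s h2 h3) he h4 h6, h7⟩
  exact key _ s₀ le_rfl h0 (Fr.refl _ _)

/-! ### Execution of programs on the word RAM -/

/-- `p` leads from `σ` to `σ'` in `t` steps. -/
def Steps (w : ℕ) (ω : ℕ → Fin (2 ^ w)) (p : Prog) (σ : Store) (t : ℕ) (σ' : Store) : Prop :=
  ∀ K, (step w ω)^[t] (p :: K, σ) = (K, σ')

section
variable {w : ℕ} {ω : ℕ → Fin (2 ^ w)}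

lemma Steps.one {p : Prog} {σ σ' : Store} (h : ∀ K, step w ω (p :: K, σ) = (K, σ')) :
    Steps w ω p σ 1 σ' := fun K => by simpa using h K

lemma Steps.seq {p q : Prog} {σ σ' σ'' : Store} {t t' : ℕ} (h : Steps w ω p σ t σ')
    (h' : Steps w ω q σ' t' σ'') : Steps w ω (.seq p q) σ (1 + t + t') σ'' := fun K => by
  rw [show 1 + t + t' = t' + (t + 1) by omega, Function.iterate_add_apply,
    Function.iterate_succ_apply]
  simp only [step]
  rw [h, h']

lemma Steps.ite {p q : Prog} {r : ℕ} {σ σ' : Store} {t : ℕ}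
    (h : Steps w ω (if σ.reg r ≠ 0 then p else q) σ t σ') :
    Steps w ω (.ite r p q) σ (1 + t) σ' := fun K => by
  rw [show 1 + t = t + 1 by omega, Function.iterate_succ_apply]
  simp only [step]
  rw [h]

lemma Steps.loop_zero {p : Prog} {r : ℕ} {σ : Store} (h : σ.reg r = 0) :
    Steps w ω (.loop r p) σ 1 σ := .one fun K => by simp [step, h]

lemma Steps.loop_succ {p : Prog} {r : ℕ} {σ σ' σ'' : Store} {t t' : ℕ} (h : σ.reg r ≠ 0)
    (h1 : Steps w ω p σ t σ') (h2 : Steps w ω (.loop r p) σ' t' σ'') :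
    Steps w ω (.loop r p) σ (1 + t + t') σ'' := fun K => by
  rw [show 1 + t + t' = t' + (t + 1) by omega, Function.iterate_add_apply,
    Function.iterate_succ_apply]
  simp only [step, h, ne_eq, not_false_eq_true, if_true]
  rw [h1, h2]

/-- The effect of an operation whose result fits into a word. -/
lemma Steps.op {o : BinOp} {r a b x : ℕ} {σ : Store}
    (h : o.eval w (σ.reg a) (σ.reg b) = x) : Steps w ω (.op o r a b) σ 1 (σ.setReg r x) :=
  .one fun K => by simp [step, h]

lemma Steps.const {r c : ℕ} {σ : Store} (h : c < 2 ^ w) :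
    Steps w ω (.const r c) σ 1 (σ.setReg r c) :=
  .one fun K => by simp [step, Nat.mod_eq_of_lt h]

lemma Steps.load {r a : ℕ} {σ : Store} :
    Steps w ω (.load r a) σ 1 (σ.setReg r (σ.mem (σ.reg a))) :=
  .one fun K => by simp [step]

end

/-! ### Compilation -/

/-- From `i`, `j`, `k` in registers `2 d + 1`, `2 d + 3`, `2 d + 5`, the address of the array cell
goes to register `2 d + 7`; register `1` holds the side length of the arrays. -/
def addrProg (d : ℕ) (id : Arr) : Prog :=
  .seq (.const (2 * d + 7) id.idx) <|
  .seq (.op .mul (2 * d + 7) (2 * d + 7) 1) <|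
  .seq (.op .add (2 * d + 7) (2 * d + 7) (2 * d + 1)) <|
  .seq (.op .mul (2 * d + 7) (2 * d + 7) 1) <|
  .seq (.op .add (2 * d + 7) (2 * d + 7) (2 * d + 3)) <|
  .seq (.op .mul (2 * d + 7) (2 * d + 7) 1) <|
  .op .add (2 * d + 7) (2 * d + 7) (2 * d + 5)

/-- At depth `d` the result goes to register `2 d + 1`, and only odd registers from there on are
used. Depths start at `1`, since register `1` keeps the side length. The truncated predecessor
subtracts the bit `0 < e`, and a register is copied by a disjunction with itself. -/
def Exp.compile : Exp → ℕ → Prog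
  | .lit c, d => .const (2 * d + 1) c
  | .var x, d => .op .lor (2 * d + 1) (2 * x.idx) (2 * x.idx)
  | .inc e, d => .seq (e.compile d) <| .seq (.const (2 * d + 3) 1) <|
      .op .add (2 * d + 1) (2 * d + 1) (2 * d + 3)
  | .pred e, d => .seq (e.compile d) <| .seq (.const (2 * d + 3) 0) <|
      .seq (.op .lt (2 * d + 3) (2 * d + 3) (2 * d + 1)) <|
      .op .sub (2 * d + 1) (2 * d + 1) (2 * d + 3)
  | .eq a b, d => .seq (a.compile d) <| .seq (b.compile (d + 1)) <|
      .op .eq (2 * d + 1) (2 * d + 1) (2 * d + 3)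
  | .lt a b, d => .seq (a.compile d) <| .seq (b.compile (d + 1)) <|
      .op .lt (2 * d + 1) (2 * d + 1) (2 * d + 3)
  | .get id i j k, d => .seq (i.compile d) <| .seq (j.compile (d + 1)) <|
      .seq (k.compile (d + 2)) <| .seq (addrProg d id) <| .load (2 * d + 1) (2 * d + 7)

/-- In `put` the indices go to registers `3`, `5`, `7` and the address to `9`, so the value is
computed at depth `5`, in register `11`. A loop evaluates its test before entry and again at the end
of the body. -/
def Cmd.compile : Cmd → Prog
  | .skip => .nop
  | .set x e => .seq (e.compile 1) (.op .lor (2 * x.idx) 3 3)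
  | .put id i j k e => .seq (i.compile 1) <| .seq (j.compile 2) <| .seq (k.compile 3) <|
      .seq (e.compile 5) <| .seq (addrProg 1 id) (.store 9 11)
  | .seq c d => .seq c.compile d.compile
  | .ite e c d => .seq (e.compile 1) (.ite 3 c.compile d.compile)
  | .loop e c => .seq (e.compile 1) (.loop 3 (.seq c.compile (e.compile 1)))

/-- Bounds the time of an expression, its constants, and the growth of values. -/
def Exp.size : Exp → ℕ
  | .lit c => c + 1
  | .var _ => 1
  | .inc e => e.size + 4
  | .pred e => e.size + 6
  | .eq a b => a.size + b.size + 3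
  | .lt a b => a.size + b.size + 3
  | .get _ i j k => i.size + j.size + k.size + 18

def Cmd.size : Cmd → ℕ
  | .skip => 2
  | .set _ e => e.size + 3
  | .put _ i j k e => i.size + j.size + k.size + e.size + 20
  | .seq c d => c.size + d.size
  | .ite e c d => e.size + c.size + d.size + 4
  | .loop e c => e.size + c.size + 4

/-! ### Simulation of states and expressions. -/

def addr (S : ℕ) (id : Arr) (i j k : ℕ) : ℕ := ((id.idx * S + i) * S + j) * S + k

/-- Only cells with indices below the side length are represented; `Bd` is what keeps all indices in
that range. -/
structure Sim (S : ℕ) (s : St) (σ : Store) : Prop where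
  reg : ∀ x : Reg, σ.reg (2 * x.idx) = s.v x
  side : σ.reg 1 = S
  mem : ∀ id i j k, i < S → j < S → k < S → σ.mem (addr S id i j k) = s.A id i j k

structure Bd (s : St) (V : ℕ) : Prop where
  v : ∀ x, s.v x ≤ V
  A : ∀ id i j k, s.A id i j k ≤ V

/-- `σ'` agrees with `σ` except for the scratch registers from `2 d + 1` on. -/
structure Scratch (d : ℕ) (σ σ' : Store) : Prop where
  reg : ∀ x, (x % 2 = 0 ∨ x < 2 * d + 1) → σ'.reg x = σ.reg x
  mem : σ'.mem = σ.mem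

lemma Scratch.mono {d d' : ℕ} {σ σ' : Store} (h : Scratch d' σ σ') (hd : d ≤ d') : Scratch d σ σ' :=
  ⟨fun x hx => h.reg x (by omega), h.mem⟩

lemma Scratch.trans {d : ℕ} {σ σ' σ'' : Store} (h : Scratch d σ σ') (h' : Scratch d σ' σ'') :
    Scratch d σ σ'' :=
  ⟨fun x hx => (h'.reg x hx).trans (h.reg x hx), h'.mem.trans h.mem⟩

lemma Scratch.setReg {d r x : ℕ} {σ : Store} (h : r % 2 = 1) (h' : 2 * d + 1 ≤ r) :
    Scratch d σ (σ.setReg r x) :=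
  ⟨fun y hy => by
    have : y ≠ r := by omega
    simp [Store.setReg, Function.update_of_ne this], rfl⟩

lemma Sim.scratch {S d : ℕ} {s : St} {σ σ' : Store} (h : Sim S s σ) (hd : 1 ≤ d)
    (h' : Scratch d σ σ') : Sim S s σ' :=
  ⟨fun x => (h'.reg _ (by omega)).trans (h.reg x), (h'.reg _ (by omega)).trans h.side,
    by rw [h'.mem]; exact h.mem⟩

/-- An address is a numeral in base `S` whose leading digit, the index of the array, is
unrestricted. -/
lemma addr_inj {S : ℕ} {id id' : Arr} {i j k i' j' k' : ℕ} (hi : i < S) (hj : j < S) (hk : k < S)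
    (hi' : i' < S) (hj' : j' < S) (hk' : k' < S) (h : addr S id i j k = addr S id' i' j' k') :
    id = id' ∧ i = i' ∧ j = j' ∧ k = k' := by
  have key : ∀ {a b x y : ℕ}, x < S → y < S → a * S + x = b * S + y → a = b ∧ x = y := by
    intro a b x y hx hy h
    have h1 : (a * S + x) / S = (b * S + y) / S := by rw [h]
    have hS : 0 < S := by omega
    rw [mul_comm a, mul_comm b, Nat.mul_add_div hS, Nat.mul_add_div hS, Nat.div_eq_of_lt hx,
      Nat.div_eq_of_lt hy] at h1
    have : a = b := by simpa using h1
    subst this; exact ⟨rfl, by omega⟩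
  obtain ⟨h1, rfl⟩ := key hk hk' h
  obtain ⟨h2, rfl⟩ := key hj hj' h1
  obtain ⟨h3, rfl⟩ := key hi hi' h2
  exact ⟨Arr.idx_injective h3, rfl, rfl, rfl⟩

lemma Exp.eval_le (e : Exp) {s : St} {V : ℕ} (h : Bd s V) : e.eval s ≤ V + e.size := by
  induction e with
  | lit c => simp [Exp.eval, Exp.size]; omega
  | var x => have := h.v x; simp [Exp.eval, Exp.size]; omega
  | inc e ih => simp [Exp.eval, Exp.size]; omega
  | pred e ih => simp [Exp.eval, Exp.size]; omega
  | eq a b => simp only [Exp.eval, Exp.size]; split <;> omega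
  | lt a b => simp only [Exp.eval, Exp.size]; split <;> omega
  | get id i j k => have := h.A id (i.eval s) (j.eval s) (k.eval s); simp [Exp.eval, Exp.size]; omega

lemma BinOp.add_eval {w x y : ℕ} (h : x + y < 2 ^ w) : BinOp.add.eval w x y = x + y :=
  Nat.mod_eq_of_lt h
lemma BinOp.mul_eval {w x y : ℕ} (h : x * y < 2 ^ w) : BinOp.mul.eval w x y = x * y :=
  Nat.mod_eq_of_lt h
lemma BinOp.lor_eval {w x : ℕ} (h : x < 2 ^ w) : BinOp.lor.eval w x x = x := by
  simp [BinOp.eval, Nat.mod_eq_of_lt h]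
lemma BinOp.sub_eval {w x y : ℕ} (h : x < 2 ^ w) (h' : y ≤ x) : BinOp.sub.eval w x y = x - y := by
  simp only [BinOp.eval]
  rw [show x + 2 ^ w - y = x - y + 2 ^ w by omega, Nat.add_mod_right, Nat.mod_eq_of_lt (by omega)]
lemma BinOp.lt_eval {w x y : ℕ} (h : 1 < 2 ^ w) : BinOp.lt.eval w x y = if x < y then 1 else 0 := by
  simp only [BinOp.eval]; split <;> exact Nat.mod_eq_of_lt (by omega)
lemma BinOp.eq_eval {w x y : ℕ} (h : 1 < 2 ^ w) : BinOp.eq.eval w x y = if x = y then 1 else 0 := by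
  simp only [BinOp.eval]; split <;> exact Nat.mod_eq_of_lt (by omega)

section
variable {w : ℕ} {ω : ℕ → Fin (2 ^ w)} {S : ℕ}

/-- The array index is below `16 ≤ S`, so all intermediate values stay below `S ^ 4` and no
operation wraps around. -/
lemma addrProg_steps (hS : 16 ≤ S) (hw : S ^ 4 ≤ 2 ^ w) {σ : Store} (hσ : σ.reg 1 = S) {d : ℕ}
    (hd : 1 ≤ d) (id : Arr) {i j k : ℕ} (hi : i < S) (hj : j < S) (hk : k < S)
    (h1 : σ.reg (2 * d + 1) = i) (h2 : σ.reg (2 * d + 3) = j) (h3 : σ.reg (2 * d + 5) = k) :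
    ∃ σ', Steps w ω (addrProg d id) σ 13 σ' ∧ σ'.reg (2 * d + 7) = addr S id i j k ∧
      (∀ x, x ≠ 2 * d + 7 → σ'.reg x = σ.reg x) ∧ σ'.mem = σ.mem := by
  have h0 := id.idx_lt
  have hS4 : S * S * S * S = S ^ 4 := by ring
  have e1 : id.idx * S + i + 1 ≤ S * S := by nlinarith
  have e2 : (id.idx * S + i) * S + j + 1 ≤ S * S * S := by nlinarith
  have e3 : ((id.idx * S + i) * S + j) * S + k + 1 ≤ S * S * S * S := by nlinarith
  have e4 : S * S ≤ S * S * S * S := by nlinarith [Nat.mul_le_mul hS hS]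
  have e5 : S * S * S ≤ S * S * S * S := by nlinarith
  have n1 : 2 * d + 7 ≠ 1 := by omega
  have s1 : (1:ℕ) ≠ 2 * d + 7 := by omega
  have s2 : 2 * d + 1 ≠ 2 * d + 7 := by omega
  have s3 : 2 * d + 3 ≠ 2 * d + 7 := by omega
  have s5 : 2 * d + 5 ≠ 2 * d + 7 := by omega
  refine ⟨σ.setReg (2 * d + 7) (addr S id i j k), ?_, by simp [Store.setReg],
    fun x hx => by simp [Store.setReg, Function.update_of_ne hx], rfl⟩
  have hset : ∀ x y, (σ.setReg (2 * d + 7) x).setReg (2 * d + 7) y = σ.setReg (2 * d + 7) y := by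
    intro x y; simp [Store.setReg]
  have step : ∀ (o : BinOp) (x y r : ℕ), r ≠ 2 * d + 7 → o.eval w x (σ.reg r) = y →
      Steps w ω (.op o (2 * d + 7) (2 * d + 7) r) (σ.setReg (2 * d + 7) x) 1
        (σ.setReg (2 * d + 7) y) := by
    intro o x y r hr h
    have := Steps.op (w := w) (ω := ω) (o := o) (r := 2 * d + 7) (a := 2 * d + 7) (b := r) (x := y)
      (σ := σ.setReg (2 * d + 7) x) (by simpa [Store.setReg, Function.update_of_ne hr] using h)
    rwa [hset] at this
  have b0 : id.idx < 2 ^ w := by nlinarith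
  have b1 : id.idx * S < 2 ^ w := by omega
  have b2 : id.idx * S + i < 2 ^ w := by omega
  have b3 : (id.idx * S + i) * S < 2 ^ w := by omega
  have b4 : (id.idx * S + i) * S + j < 2 ^ w := by omega
  have b5 : ((id.idx * S + i) * S + j) * S < 2 ^ w := by omega
  have b6 : ((id.idx * S + i) * S + j) * S + k < 2 ^ w := by omega
  refine Steps.seq (Steps.const b0) (t' := 11) ?_
  refine Steps.seq (step .mul _ (id.idx * S) _ s1 (by rw [hσ]; exact BinOp.mul_eval b1)) (t' := 9) ?_
  refine Steps.seq (step .add _ (id.idx * S + i) _ s2 (by rw [h1]; exact BinOp.add_eval b2)) (t' := 7) ?_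
  refine Steps.seq (step .mul _ ((id.idx * S + i) * S) _ s1 (by rw [hσ]; exact BinOp.mul_eval b3)) (t' := 5) ?_
  refine Steps.seq (step .add _ ((id.idx * S + i) * S + j) _ s3 (by rw [h2]; exact BinOp.add_eval b4)) (t' := 3) ?_
  refine Steps.seq (step .mul _ (((id.idx * S + i) * S + j) * S) _ s1 (by rw [hσ]; exact BinOp.mul_eval b5)) (t' := 1) ?_
  exact step .add _ (addr S id i j k) _ s5 (by rw [h3]; exact BinOp.add_eval b6)

lemma Exp.compile_steps (hS : 16 ≤ S) (hw : S ^ 4 ≤ 2 ^ w) {s : St} {V : ℕ} (hB : Bd s V)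
    (e : Exp) : ∀ (d : ℕ) (σ : Store), 1 ≤ d → V + e.size < S → Sim S s σ →
      ∃ t σ', t ≤ e.size ∧ Steps w ω (e.compile d) σ t σ' ∧ Scratch d σ σ' ∧
        σ'.reg (2 * d + 1) = e.eval s := by
  have hS2 : S ≤ S ^ 4 := Nat.le_self_pow (by norm_num) S
  induction e with
  | lit c =>
    intro d σ hd hV h
    simp only [Exp.size] at hV
    exact ⟨1, _, by simp [Exp.size], Steps.const (by omega), .setReg (by omega) le_rfl,
      by simp [Store.setReg, Exp.eval]⟩
  | var x =>
    intro d σ hd hV h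
    have := hB.v x
    exact ⟨1, _, le_rfl, Steps.op (BinOp.lor_eval (by rw [h.reg]; omega)),
      .setReg (by omega) le_rfl, by simp [Store.setReg, Exp.eval, h.reg]⟩
  | inc e ih =>
    intro d σ hd hV h
    simp only [Exp.size] at hV
    obtain ⟨t, σ', ht, h1, h2, h3⟩ := ih d σ hd (by omega) h
    have := e.eval_le hB
    refine ⟨_, _, ?_, h1.seq (Steps.seq (Steps.const (by omega)) (Steps.op rfl)),
      h2.trans ((Scratch.setReg (by omega) (by omega)).trans (.setReg (by omega) le_rfl)), ?_⟩
    · simp only [Exp.size]; omega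
    · simp [Store.setReg, Exp.eval, h3]
      rw [BinOp.add_eval (by omega)]
  | pred e ih =>
    intro d σ hd hV h
    simp only [Exp.size] at hV
    obtain ⟨t, σ', ht, h1, h2, h3⟩ := ih d σ hd (by omega) h
    have := e.eval_le hB
    refine ⟨_, _, ?_, h1.seq (Steps.seq (Steps.const (by omega))
        (Steps.seq (Steps.op rfl) (Steps.op rfl))),
      h2.trans ((Scratch.setReg (by omega) (by omega)).trans
        ((Scratch.setReg (by omega) (by omega)).trans (.setReg (by omega) le_rfl))), ?_⟩
    · simp only [Exp.size]; omega
    · simp [Store.setReg, Exp.eval, h3]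
      rw [BinOp.lt_eval (by omega), BinOp.sub_eval (by omega) (by split <;> omega)]
      split <;> omega
  | eq a b iha ihb =>
    intro d σ hd hV h
    simp only [Exp.size] at hV
    obtain ⟨t, σ', ht, h1, h2, h3⟩ := iha d σ hd (by omega) h
    obtain ⟨t', σ'', ht', h1', h2', h3'⟩ := ihb (d + 1) σ' (by omega) (by omega) (h.scratch hd h2)
    refine ⟨_, _, ?_, h1.seq (h1'.seq (Steps.op rfl)),
      h2.trans ((h2'.mono (by omega)).trans (.setReg (by omega) le_rfl)), ?_⟩
    · simp only [Exp.size]; omega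
    · rw [show 2 * (d + 1) + 1 = 2 * d + 3 by ring] at h3'
      simp [Store.setReg, Exp.eval, h3', h2'.reg (2 * d + 1) (by omega), h3]
      rw [BinOp.eq_eval (by omega)]
  | lt a b iha ihb =>
    intro d σ hd hV h
    simp only [Exp.size] at hV
    obtain ⟨t, σ', ht, h1, h2, h3⟩ := iha d σ hd (by omega) h
    obtain ⟨t', σ'', ht', h1', h2', h3'⟩ := ihb (d + 1) σ' (by omega) (by omega) (h.scratch hd h2)
    refine ⟨_, _, ?_, h1.seq (h1'.seq (Steps.op rfl)),
      h2.trans ((h2'.mono (by omega)).trans (.setReg (by omega) le_rfl)), ?_⟩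
    · simp only [Exp.size]; omega
    · rw [show 2 * (d + 1) + 1 = 2 * d + 3 by ring] at h3'
      simp [Store.setReg, Exp.eval, h3', h2'.reg (2 * d + 1) (by omega), h3]
      rw [BinOp.lt_eval (by omega)]
  | get id i j k ihi ihj ihk =>
    intro d σ hd hV h
    simp only [Exp.size] at hV
    obtain ⟨t1, σ1, ht1, h1, h1', h1''⟩ := ihi d σ hd (by omega) h
    have g1 := h.scratch hd h1'
    obtain ⟨t2, σ2, ht2, h2, h2', h2''⟩ := ihj (d + 1) σ1 (by omega) (by omega) g1
    have g2 := g1.scratch (by omega) h2'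
    obtain ⟨t3, σ3, ht3, h3, h3', h3''⟩ := ihk (d + 2) σ2 (by omega) (by omega) g2
    have g3 := g2.scratch (by omega) h3'
    have := i.eval_le hB
    have := j.eval_le hB
    have := k.eval_le hB
    obtain ⟨σ4, h4, h4', h4'', h4m⟩ := addrProg_steps (ω := ω) hS hw g3.side hd id
      (i := i.eval s) (j := j.eval s) (k := k.eval s) (by omega) (by omega) (by omega)
      (by rw [h3'.reg _ (by omega), h2'.reg _ (by omega), h1''])
      (by rw [h3'.reg _ (by omega)]; exact h2'') h3''
    refine ⟨_, _, ?_, h1.seq (h2.seq (h3.seq (h4.seq Steps.load))), ?_, ?_⟩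
    · simp only [Exp.size]; omega
    · refine h1'.trans ((h2'.mono (by omega)).trans ((h3'.mono (by omega)).trans
        (Scratch.trans ⟨fun x hx => h4'' x (by omega), h4m⟩ (.setReg (by omega) le_rfl))))
    · simp only [Store.setReg, Function.update_self, h4', h4m, Exp.eval]
      exact g3.mem _ _ _ _ (by omega) (by omega) (by omega)

end

/-! ### Simulation of commands. -/

section
variable {w : ℕ} {ω : ℕ → Fin (2 ^ w)}

/-- The test at the end of the body plays the part of the test in front of the next iteration. The
unfolding step of that `seq` is saved, but unfolding the body costs one more; `t' = 0` is excluded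
because the stacks would have different heights. -/
lemma Steps.loop_test {c e : Prog} {r : ℕ} {σ σ' σ'' : Store} {t t' : ℕ} (h : σ.reg r ≠ 0)
    (h1 : Steps w ω c σ t σ') (h2 : Steps w ω (.seq e (.loop r (.seq c e))) σ' t' σ'') :
    Steps w ω (.loop r (.seq c e)) σ (1 + t + t') σ'' := fun K => by
  obtain - | t' := t'
  · have := h2 K
    simp only [Function.iterate_zero, id_eq, Prod.mk.injEq] at this
    simpa using congrArg List.length this.1
  · rw [show 1 + t + (t' + 1) = t' + (t + (1 + 1)) by omega, Function.iterate_add_apply,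
      Function.iterate_add_apply, Function.iterate_add_apply]
    simp only [Function.iterate_one, step, h, ne_eq, not_false_eq_true, if_true]
    rw [h1]
    have := h2 K
    rwa [Function.iterate_succ_apply] at this

variable {S : ℕ}

lemma Bd.mono {s : St} {V V' : ℕ} (h : Bd s V) (hV : V ≤ V') : Bd s V' :=
  ⟨fun x => (h.v x).trans hV, fun id i j k => (h.A id i j k).trans hV⟩

lemma Bd.tick {s : St} {V : ℕ} (h : Bd s V) : Bd s.tick V := ⟨h.v, h.A⟩
lemma Sim.tick {s : St} {σ : Store} (h : Sim S s σ) : Sim S s.tick σ := ⟨h.reg, h.side, h.mem⟩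

lemma Bd.setv {s : St} {V a : ℕ} {x : Reg} (h : Bd s V) (ha : a ≤ V) : Bd (s.setv x a) V :=
  ⟨fun y => by
    simp only [St.setv, Function.update_apply]; split
    exacts [ha, h.v y], h.A⟩

lemma Bd.putA {s : St} {V x i j k : ℕ} {id : Arr} (h : Bd s V) (hx : x ≤ V) :
    Bd (s.putA id i j k x) V :=
  ⟨h.v, fun id' i' j' k' => by
    simp only [St.putA, Arrays.upd]; split
    exacts [hx, h.A _ _ _ _]⟩

lemma Sim.setv {s : St} {σ : Store} {a : ℕ} {x : Reg} (h : Sim S s σ) :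
    Sim S (s.setv x a) (σ.setReg (2 * x.idx) a) := by
  refine ⟨fun y => ?_, ?_, h.mem⟩
  · simp only [Store.setReg, St.setv, Function.update_apply]
    have : 2 * y.idx = 2 * x.idx ↔ y = x :=
      ⟨fun e => Reg.idx_injective (by omega), fun e => by rw [e]⟩
    simp [this, h.reg]
  · have : 1 ≠ 2 * x.idx := by omega
    simp [Store.setReg, Function.update_of_ne this, h.side]

lemma Sim.putA {s : St} {σ : Store} {x i j k : ℕ} {id : Arr} (h : Sim S s σ) (hi : i < S)
    (hj : j < S) (hk : k < S) : Sim S (s.putA id i j k x)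
      { σ with mem := Function.update σ.mem (addr S id i j k) x } := by
  refine ⟨h.reg, h.side, fun id' i' j' k' hi' hj' hk' => ?_⟩
  simp only [St.putA, Arrays.upd, Function.update_apply]
  by_cases e : id' = id ∧ i' = i ∧ j' = j ∧ k' = k
  · obtain ⟨rfl, rfl, rfl, rfl⟩ := e; simp
  · rw [if_neg e, if_neg (fun e' => e (addr_inj hi' hj' hk' hi hj hk e')), h.mem _ _ _ _ hi' hj' hk']

/-- One credit corresponds to at most `W` machine steps and lets the largest value grow by at most
`W`. So a single inequality for the credits spent excludes overflow during the whole run. The spare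
step in `t + 1` pays for the `seq` instruction that joins two commands. -/
lemma Ev.sim (hS : 16 ≤ S) (hw : S ^ 4 ≤ 2 ^ w) {c : Cmd} {s s' : St} (h : Ev c s s') {W : ℕ} :
    c.size ≤ W → ∀ (V : ℕ) (σ : Store), Bd s V → V + W * (s.k - s'.k) < S → Sim S s σ →
      ∃ t σ', t + 1 ≤ W * (s.k - s'.k) ∧ Steps w ω c.compile σ t σ' ∧ Sim S s' σ' ∧
        Bd s' (V + W * (s.k - s'.k)) := by
  have hS2 : S ≤ S ^ 4 := Nat.le_self_pow (by norm_num) S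
  have one : ∀ {k : ℕ}, 1 ≤ k → W * (k - (k - 1)) = W := fun {k} h => by
    rw [show k - (k - 1) = 1 by omega, mul_one]
  induction h with
  | @skip s hk =>
    intro hW V σ hB hV h
    simp only [St.tick, one hk, Cmd.size] at *
    exact ⟨1, σ, by omega, .one fun K => rfl, h.tick, hB.tick.mono (by omega)⟩
  | @set s x e hk =>
    intro hW V σ hB hV h
    simp only [St.setv, one hk, Cmd.size] at hV hW ⊢
    obtain ⟨t, σ', ht, h1, h2, h3⟩ := e.compile_steps (ω := ω) hS hw hB 1 σ le_rfl (by omega) h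
    have := e.eval_le hB
    refine ⟨_, _, ?_, h1.seq (Steps.op (by rw [h3]; exact BinOp.lor_eval (by omega))),
      (h.scratch le_rfl h2).setv, (hB.mono (by omega)).setv (by omega)⟩
    omega
  | @put s id i j k e hk =>
    intro hW V σ hB hV h
    simp only [St.putA, one hk, Cmd.size] at hV hW ⊢
    have := i.eval_le hB
    have := j.eval_le hB
    have := k.eval_le hB
    have := e.eval_le hB
    obtain ⟨t1, σ1, ht1, h1, h1', h1''⟩ := i.compile_steps (ω := ω) hS hw hB 1 σ le_rfl (by omega) h
    have g1 := h.scratch le_rfl h1'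
    obtain ⟨t2, σ2, ht2, h2, h2', h2''⟩ :=
      j.compile_steps (ω := ω) hS hw hB 2 σ1 (by omega) (by omega) g1
    have g2 := g1.scratch (by omega) h2'
    obtain ⟨t3, σ3, ht3, h3, h3', h3''⟩ :=
      k.compile_steps (ω := ω) hS hw hB 3 σ2 (by omega) (by omega) g2
    have g3 := g2.scratch (by omega) h3'
    obtain ⟨t4, σ4, ht4, h4, h4', h4''⟩ :=
      e.compile_steps (ω := ω) hS hw hB 5 σ3 (by omega) (by omega) g3
    have g4 := g3.scratch (by omega) h4'
    obtain ⟨σ5, h5, h5', h5'', h5m⟩ := addrProg_steps (ω := ω) hS hw g4.side le_rfl id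
      (i := i.eval s) (j := j.eval s) (k := k.eval s) (by omega) (by omega) (by omega)
      (by rw [h4'.reg _ (by omega), h3'.reg _ (by omega), h2'.reg _ (by omega), h1''])
      (by rw [h4'.reg _ (by omega), h3'.reg _ (by omega)]; exact h2'')
      (by rw [h4'.reg _ (by omega)]; exact h3'')
    have g5 : Sim S s σ5 := g4.scratch le_rfl ⟨fun x hx => h5'' x (by omega), h5m⟩
    have g6 := g5.putA (x := e.eval s) (id := id) (i := i.eval s) (j := j.eval s) (k := k.eval s)
      (by omega) (by omega) (by omega)
    refine ⟨_, _, ?_, h1.seq (h2.seq (h3.seq (h4.seq (h5.seq (.one fun K => ?_))))), g6,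
      (hB.mono (by omega)).putA (by omega)⟩
    · omega
    · have e1 : σ5.reg 9 = addr S id (i.eval s) (j.eval s) (k.eval s) := h5'
      have e2 : σ5.reg 11 = e.eval s := (h5'' 11 (by omega)).trans h4''
      simp [step, e1, e2]
  | @seq c d s s1 s2 h1 h2 ih1 ih2 =>
    intro hW V σ hB hV h
    simp only [Cmd.size] at hW
    have k1 := h1.k_lt
    have k2 := h2.k_lt
    have hD : W * (s.k - s2.k) = W * (s.k - s1.k) + W * (s1.k - s2.k) := by
      rw [← mul_add]; congr 1; omega
    obtain ⟨t1, σ1, ht1, g1, g1', g1''⟩ := ih1 (by omega) V σ hB (by omega) h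
    obtain ⟨t2, σ2, ht2, g2, g2', g2''⟩ := ih2 (by omega) _ σ1 g1'' (by omega) g1'
    exact ⟨_, _, by omega, g1.seq g2, g2', g2''.mono (by omega)⟩
  | @iteT e c d s s' hk he h1 ih =>
    intro hW V σ hB hV h
    simp only [Cmd.size] at hW
    have k1 := h1.k_lt
    simp only [St.tick] at k1
    have hD : W * (s.k - s'.k) = W + W * (s.tick.k - s'.k) := by
      simp only [St.tick]
      rw [show s.k - s'.k = 1 + (s.k - 1 - s'.k) by omega, mul_add, mul_one]
    obtain ⟨t, σ1, ht, h2, h3, h4⟩ := e.compile_steps (ω := ω) hS hw hB 1 σ le_rfl (by omega) h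
    obtain ⟨t1, σ2, ht1, g1, g2, g3⟩ :=
      ih (by omega) V σ1 hB.tick (by omega) (h.scratch le_rfl h3).tick
    exact ⟨_, _, by omega, h2.seq (Steps.ite (t := t1) (by
      have h4' : σ1.reg 3 = e.eval s := h4
      rwa [if_pos (by rwa [h4'])])), g2, g3.mono (by omega)⟩
  | @iteF e c d s s' hk he h1 ih =>
    intro hW V σ hB hV h
    simp only [Cmd.size] at hW
    have k1 := h1.k_lt
    simp only [St.tick] at k1
    have hD : W * (s.k - s'.k) = W + W * (s.tick.k - s'.k) := by
      simp only [St.tick]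
      rw [show s.k - s'.k = 1 + (s.k - 1 - s'.k) by omega, mul_add, mul_one]
    obtain ⟨t, σ1, ht, h2, h3, h4⟩ := e.compile_steps (ω := ω) hS hw hB 1 σ le_rfl (by omega) h
    obtain ⟨t1, σ2, ht1, g1, g2, g3⟩ :=
      ih (by omega) V σ1 hB.tick (by omega) (h.scratch le_rfl h3).tick
    exact ⟨_, _, by omega, h2.seq (Steps.ite (t := t1) (by
      have h4' : σ1.reg 3 = e.eval s := h4
      rwa [if_neg (by rw [h4']; simpa using he)])), g2, g3.mono (by omega)⟩
  | @loopF e c s hk he =>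
    intro hW V σ hB hV h
    simp only [Cmd.size, St.tick, one hk] at hW hV ⊢
    obtain ⟨t, σ1, ht, h2, h3, h4⟩ := e.compile_steps (ω := ω) hS hw hB 1 σ le_rfl (by omega) h
    refine ⟨_, _, ?_, h2.seq (Steps.loop_zero (h4.trans he)), (h.scratch le_rfl h3).tick,
      hB.tick.mono (by omega)⟩
    omega
  | @loopT e c s s1 s2 hk he h1 h2 ih1 ih2 =>
    intro hW V σ hB hV h
    have hW' := hW
    simp only [Cmd.size] at hW
    have k1 := h1.k_lt
    have k2 := h2.k_lt
    simp only [St.tick] at k1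
    have hD : W * (s.k - s2.k) = W + W * (s.tick.k - s1.k) + W * (s1.k - s2.k) := by
      simp only [St.tick]
      rw [show s.k - s2.k = 1 + (s.k - 1 - s1.k) + (s1.k - s2.k) by omega, mul_add, mul_add, mul_one]
    obtain ⟨t, σ1, ht, g1, g2, g3⟩ := e.compile_steps (ω := ω) hS hw hB 1 σ le_rfl (by omega) h
    obtain ⟨t1, σ2, ht1, f1, f2, f3⟩ :=
      ih1 (by omega) V σ1 hB.tick (by omega) (h.scratch le_rfl g2).tick
    obtain ⟨t2, σ3, ht2, f4, f5, f6⟩ := ih2 hW' _ σ2 f3 (by omega) f2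
    exact ⟨_, _, by omega, g1.seq (Steps.loop_test (by rw [show σ1.reg 3 = _ from g3]; exact he)
      f1 f4), f5, f6.mono (by omega)⟩

/-! ### Whole programs -/

/-- The bound `σ` is not part of the input; the sum of the symbols serves as a bound on each of
them. Only odd registers are written, and the sum starts at `2` so that powers of the result grow.
-/
def sumProg : Prog :=
  .seq (.const 7 1) <| .seq (.const 3 0) <| .seq (.const 5 2) <| .seq (.op .lt 9 3 0) <|
  .loop 9 (.seq (.load 11 3) <| .seq (.op .add 5 5 11) <| .seq (.op .add 3 3 7) <| .op .lt 9 3 0)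

/-- Computes the side length of the arrays, a large power of the length of the text plus the sum of
its symbols plus `2`, into register `1`. -/
def sideProg : Prog :=
  .seq sumProg <| .seq (.op .add 5 5 0) <| .seq (.op .mul 1 5 5) <| .seq (.op .mul 1 1 1) <|
  .seq (.op .mul 1 1 1) <| .seq (.op .mul 1 1 1) <| .seq (.op .mul 1 1 1) <|
  .seq (.op .mul 1 1 1) <| .op .mul 1 1 1

/-- Sets registers `0` and `1` to the address and the length of the output array. -/
def postlude : Prog :=
  .seq (.op .mul 3 1 1) <| .seq (.op .mul 3 3 1) <| .seq (.op .lor 0 3 3) <| .op .lor 1 2 2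

def initSt (T : List ℕ) (k : ℕ) : St where
  v := fun x => if x = .rn then T.length else 0
  A := fun id i j k => if id = .inp ∧ i = 0 ∧ j = 0 then T.getD k 0 else 0
  k := k

lemma sumProg_steps (T : List ℕ) (hw : T.length + T.sum + 3 ≤ 2 ^ w) :
    ∃ t σ, t ≤ 8 * T.length + 9 ∧ Steps w ω sumProg (inputStore T) t σ ∧ σ.mem = (inputStore T).mem ∧
      σ.reg 5 = 2 + T.sum ∧ (∀ x, x % 2 = 0 → σ.reg x = (inputStore T).reg x) := by
  have loop : ∀ (d i : ℕ) (σ : Store), i + d = T.length → σ.mem = (inputStore T).mem →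
      σ.reg 7 = 1 → σ.reg 3 = i → σ.reg 5 = 2 + (T.take i).sum → σ.reg 0 = T.length →
      σ.reg 9 = (if i < T.length then 1 else 0) →
      ∃ t σ', t ≤ 8 * d + 1 ∧ Steps w ω (.loop 9 (.seq (.load 11 3) <| .seq (.op .add 5 5 11) <|
        .seq (.op .add 3 3 7) <| .op .lt 9 3 0)) σ t σ' ∧ σ'.mem = (inputStore T).mem ∧
        σ'.reg 5 = 2 + T.sum ∧ (∀ x, x % 2 = 0 → σ'.reg x = σ.reg x) := by
    intro d
    induction d with
    | zero =>
      intro i σ hi h1 h2 h3 h4 h5 h6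
      have : i = T.length := by omega
      subst this
      exact ⟨1, σ, by omega, Steps.loop_zero (by simp [h6]), h1, by simpa using h4, fun _ _ => rfl⟩
    | succ d ih =>
      intro i σ hi h1 h2 h3 h4 h5 h6
      have hiT : i < T.length := by omega
      have hsum : (T.take (i + 1)).sum = (T.take i).sum + T[i] := by
        rw [List.sum_take_succ _ _ hiT]
      have hle : (T.take (i + 1)).sum ≤ T.sum := by
        conv_rhs => rw [← List.take_append_drop (i + 1) T, List.sum_append]
        omega
      have hmem : σ.mem i = T[i] := by
        rw [h1]; simp [inputStore, hiT]
      have e1 : BinOp.add.eval w (2 + (T.take i).sum) T[i] = 2 + (T.take (i + 1)).sum := by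
        rw [BinOp.add_eval (by omega), hsum, add_assoc]
      have e2 : BinOp.add.eval w i 1 = i + 1 := BinOp.add_eval (by omega)
      have e3 : BinOp.lt.eval w (i + 1) T.length = if i + 1 < T.length then 1 else 0 :=
        BinOp.lt_eval (by omega)
      obtain ⟨t, σ', ht, g1, g2, g3, g4⟩ := ih (i + 1)
        ((((σ.setReg 11 T[i]).setReg 5 (2 + (T.take (i + 1)).sum)).setReg 3 (i + 1)).setReg 9
          (if i + 1 < T.length then 1 else 0)) (by omega) h1
          (by simp [Store.setReg, h2])
          (by simp [Store.setReg])
          (by simp [Store.setReg])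
          (by simp [Store.setReg, h5])
          (by simp [Store.setReg])
      refine ⟨_, σ', ?_, Steps.loop_succ (by simp [h6, hiT]) (Steps.seq (Steps.load (w := w))
        (Steps.seq (Steps.op rfl) (Steps.seq (Steps.op rfl) (Steps.op rfl)))) (t' := t) ?_, g2, g3, ?_⟩
      · omega
      · convert g1 using 1
        simp [Store.setReg, h2, h3, h4, h5, hmem, e1, e2, e3]
      · intro x hx
        rw [g4 x hx]
        have : x ≠ 11 ∧ x ≠ 5 ∧ x ≠ 3 ∧ x ≠ 9 := by omega
        simp [Store.setReg, this]
  have e : BinOp.lt.eval w 0 T.length = if 0 < T.length then 1 else 0 := BinOp.lt_eval (by omega)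
  obtain ⟨t, σ', ht, g1, g2, g3, g4⟩ := loop T.length 0
    (((((inputStore T).setReg 7 1).setReg 3 0).setReg 5 2).setReg 9
      (if 0 < T.length then 1 else 0)) (by omega) rfl
      (by simp [Store.setReg]) (by simp [Store.setReg])
      (by simp [Store.setReg])
      (by simp [Store.setReg, inputStore])
      (by simp [Store.setReg])
  refine ⟨_, σ', ?_, Steps.seq (Steps.const (by omega)) (Steps.seq (Steps.const (by omega))
    (Steps.seq (Steps.const (by omega)) (Steps.seq (Steps.op ?_) g1))), g2, g3, ?_⟩
  · omega
  · simpa [Store.setReg, inputStore] using e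
  · intro x hx
    rw [g4 x hx]
    have : x ≠ 7 ∧ x ≠ 5 ∧ x ≠ 3 ∧ x ≠ 9 := by omega
    simp [Store.setReg, this]

end

/-- Seven squarings give the exponent `128`; the word length has room even for the fourth power of
the result. -/
lemma sideProg_steps {w : ℕ} {ω : ℕ → Fin (2 ^ w)} (T : List ℕ) {M : ℕ}
    (hM : M = T.length + T.sum + 2) (hw : (M ^ 128) ^ 4 ≤ 2 ^ w) :
    ∃ t σ, t ≤ 8 * T.length + 25 ∧ Steps w ω sideProg (inputStore T) t σ ∧
      σ.mem = (inputStore T).mem ∧ σ.reg 1 = M ^ 128 ∧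
      (∀ x, x % 2 = 0 → σ.reg x = (inputStore T).reg x) := by
  have hM1 : 1 < M := by omega
  have hlt : ∀ e ≤ 511, M ^ e < 2 ^ w := fun e he =>
    lt_of_lt_of_le (Nat.pow_lt_pow_right hM1 (show e < 128 * 4 by omega)) (by rw [pow_mul]; exact hw)
  have h2 := hlt 2 (by norm_num)
  have h22 : M * M = M ^ 2 := by ring
  obtain ⟨t, σ, ht, h1, hm, h5, hr⟩ := sumProg_steps (w := w) (ω := ω) T (by nlinarith)
  have m1 := hlt 1 (by norm_num)
  have m2 := hlt 2 (by norm_num)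
  have m4 := hlt 4 (by norm_num)
  have m8 := hlt 8 (by norm_num)
  have m16 := hlt 16 (by norm_num)
  have m32 := hlt 32 (by norm_num)
  have m64 := hlt 64 (by norm_num)
  have m128 := hlt 128 (by norm_num)
  have r0 : σ.reg 0 = T.length := hr 0 rfl
  have hset : ∀ x y, (σ.setReg 1 x).setReg 1 y = σ.setReg 1 y := by intro x y; simp [Store.setReg]
  have sq : ∀ (σ : Store) (x y : ℕ), x * x = y → y < 2 ^ w →
      Steps w ω (.op .mul 1 1 1) (σ.setReg 1 x) 1 (σ.setReg 1 y) := by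
    intro σ x y hxy hy
    have := Steps.op (w := w) (ω := ω) (o := .mul) (r := 1) (a := 1) (b := 1) (x := y)
      (σ := σ.setReg 1 x) (by simp only [Store.setReg, Function.update_self]
                              rw [BinOp.mul_eval (by omega), hxy])
    simpa [Store.setReg] using this
  have a1 : Steps w ω (.op .add 5 5 0) σ 1 (σ.setReg 5 M) := Steps.op (by
    rw [h5, r0, BinOp.add_eval (by rw [pow_one] at m1; omega)]; omega)
  have a2 : Steps w ω (.op .mul 1 5 5) (σ.setReg 5 M) 1 ((σ.setReg 5 M).setReg 1 (M ^ 2)) :=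
    Steps.op (by simp only [Store.setReg, Function.update_self]
                 rw [BinOp.mul_eval (by omega), h22])
  refine ⟨_, (σ.setReg 5 M).setReg 1 (M ^ 128), ?_, h1.seq (a1.seq (a2.seq
    ((sq _ _ (M ^ 4) (by ring) m4).seq ((sq _ _ (M ^ 8) (by ring) m8).seq
    ((sq _ _ (M ^ 16) (by ring) m16).seq ((sq _ _ (M ^ 32) (by ring) m32).seq
    ((sq _ _ (M ^ 64) (by ring) m64).seq (sq _ _ (M ^ 128) (by ring) m128)))))))), hm, ?_, ?_⟩
  · omega
  · simp [Store.setReg]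
  · intro x hx
    have : x ≠ 1 ∧ x ≠ 5 := by omega
    simp [Store.setReg, this, hr x hx]

lemma postlude_steps {w : ℕ} {ω : ℕ → Fin (2 ^ w)} {S : ℕ} (hS : 16 ≤ S) (hw : S ^ 4 ≤ 2 ^ w)
    {s : St} {σ : Store} (h : Sim S s σ) (ho : s.v .rolen < S) :
    ∃ t σ', t ≤ 7 ∧ Steps w ω postlude σ t σ' ∧
      σ'.output = (List.range (s.v .rolen)).map (s.A .out 0 0) := by
  have h4 : S ^ 4 = S * S * S * S := by ring
  have h2 : S * S ≤ S * S * S * S := by nlinarith [Nat.mul_le_mul hS hS]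
  have h3 : S * S * S < S * S * S * S := by nlinarith [Nat.mul_le_mul hS hS]
  have h1 : S ≤ S * S := by nlinarith
  have h5 : S * S < S * S * S := by nlinarith
  have r2 : σ.reg 2 = s.v .rolen := h.reg .rolen
  have e1 : BinOp.mul.eval w (σ.reg 1) (σ.reg 1) = S * S := by
    rw [h.side, BinOp.mul_eval (by omega)]
  have e2 : BinOp.mul.eval w (S * S) (σ.reg 1) = S * S * S := by
    rw [h.side, BinOp.mul_eval (by omega)]
  have e3 : BinOp.lor.eval w (S * S * S) (S * S * S) = S * S * S := BinOp.lor_eval (by omega)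
  have e4 : BinOp.lor.eval w (σ.reg 2) (σ.reg 2) = s.v .rolen := by
    rw [r2, BinOp.lor_eval (by omega)]
  refine ⟨_, ((((σ.setReg 3 (S * S)).setReg 3 (S * S * S)).setReg 0 (S * S * S)).setReg 1
    (s.v .rolen)), ?_, (Steps.op e1).seq ((Steps.op ?_).seq ((Steps.op ?_).seq (Steps.op ?_))), ?_⟩
  · norm_num
  · simpa [Store.setReg] using e2
  · simpa [Store.setReg] using e3
  · simpa [Store.setReg] using e4
  · simp only [Store.output, Store.setReg]
    refine List.map_congr_left fun i hi => ?_
    simp only [Function.update_self, List.mem_range] at hi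
    have := h.mem .out 0 0 i (by omega) (by omega) (by omega)
    rw [← this]
    simp [addr, Arr.idx]

/-- A halted configuration is a fixed point of `step`. -/
lemma HaltsWith.unique {P : Prog} {w : ℕ} {T : List ℕ} {ω : ℕ → Fin (2 ^ w)} {s s' : Store}
    (h : HaltsWith P w T ω s) (h' : HaltsWith P w T ω s') : s = s' := by
  have fix : ∀ (t d : ℕ) (s : Store), runFor P w T ω t = ([], s) →
      runFor P w T ω (d + t) = ([], s) := by
    intro t d s h
    rw [runFor, Function.iterate_add_apply]
    rw [runFor] at h
    rw [h]
    induction d with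
    | zero => rfl
    | succ d ih => rw [Function.iterate_succ_apply]; exact ih
  obtain ⟨t, h⟩ := h
  obtain ⟨t', h'⟩ := h'
  have := (fix t t' s h).symm.trans ((congrArg _ (add_comm t' t)).trans (fix t' t s' h'))
  simpa using this

instance (w : ℕ) : MeasureTheory.IsProbabilityMeasure (randomWords w) := by
  have : ∀ _ : ℕ, MeasureTheory.IsProbabilityMeasure
    (PMF.uniformOfFintype (Fin (2 ^ w))).toMeasure := fun _ => PMF.toMeasure.isProbabilityMeasure _
  unfold randomWords
  infer_instance

/-- A verified program of the intermediate language yields a RAM program. -/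
theorem exists_prog_of_wp (main : Cmd) (C : ℕ) (hC : main.size * C ≤ 2 ^ 100)
    (h : ∀ T, wp main (fun s => ∃ G, Constructs T G ∧
      Represents ((List.range (s.v .rolen)).map (s.A .out 0 0)) G) (initSt T (C * (T.length + 1)))) :
    ∃ (P : Prog) (C c : ℕ), ∀ (σ : ℕ) (T : List ℕ), (∀ a ∈ T, a < σ) →
        ∀ w : ℕ, (T.length + σ + 2) ^ c ≤ 2 ^ w →
          (∀ (ω : ℕ → Fin (2 ^ w)) (s : Store), HaltsWith P w T ω s →
            ∃ G : Grammar, Constructs T G ∧ Represents s.output G) ∧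
          expectedTime P w T ≤ (C : ENNReal) * (T.length + 1) := by
  refine ⟨.seq sideProg (.seq main.compile postlude), main.size * C + 40, 1024,
    fun σ T hσ w hw => ?_⟩
  obtain ⟨M, hM⟩ : ∃ M, M = T.length + T.sum + 2 := ⟨_, rfl⟩
  have hM2 : 2 ≤ M := by clear hw; omega
  have hsum : T.sum ≤ T.length * σ := by
    have := List.sum_le_card_nsmul T σ (fun a ha => (hσ a ha).le)
    simpa using this
  have hMsq : M ≤ (T.length + σ + 2) ^ 2 := by clear hw; nlinarith
  have hMw : (M ^ 128) ^ 4 ≤ 2 ^ w := by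
    refine le_trans ?_ hw
    -- Exponent `2` bounds `M` by the given parameters, `128` yields the side length, and `4`
    -- accounts for the four digits of an address.
    rw [← pow_mul, show 1024 = 2 * (128 * 4) by norm_num, pow_mul _ 2]
    exact Nat.pow_le_pow_left hMsq _
  -- Initial values are at most `M` and grow by at most `2 ^ 100 * M`, so a side length of `2 ^ 120
  -- * M` is ample; `M ≥ 2` turns spare powers of `M` into this factor.
  obtain ⟨S, hS1, hSw, hside⟩ : ∃ S, 2 ^ 120 * M ≤ S ∧ S ^ 4 ≤ 2 ^ w ∧
      ∀ ω : ℕ → Fin (2 ^ w), ∃ t σ, t ≤ 8 * T.length + 25 ∧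
        Steps w ω sideProg (inputStore T) t σ ∧ σ.mem = (inputStore T).mem ∧ σ.reg 1 = S ∧
        (∀ x, x % 2 = 0 → σ.reg x = (inputStore T).reg x) := by
    refine ⟨M ^ 128, ?_, hMw, fun ω => sideProg_steps T hM hMw⟩
    calc 2 ^ 120 * M ≤ M ^ 120 * M := Nat.mul_le_mul_right _ (Nat.pow_le_pow_left hM2 _)
      _ = M ^ 121 := (pow_succ _ _).symm
      _ ≤ M ^ 128 := Nat.pow_le_pow_right (Nat.zero_lt_of_lt hM2) (by norm_num)
  clear hMw hw
  have hS16 : 16 ≤ S := by omega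
  -- No random word is ever drawn, so the time bound and the correctness hold for every `ω`.
  have main_run : ∀ ω : ℕ → Fin (2 ^ w), ∃ t σ',
      t ≤ (main.size * C + 40) * (T.length + 1) ∧
      runFor (.seq sideProg (.seq main.compile postlude)) w T ω t = ([], σ') ∧
      ∃ G, Constructs T G ∧ Represents σ'.output G := by
    intro ω
    obtain ⟨t1, σ1, ht1, h1, hm, hr1, hr⟩ := hside ω
    obtain ⟨s', hev, hG⟩ := h T
    have hsim : Sim S (initSt T (C * (T.length + 1))) σ1 := by
      refine ⟨fun x => ?_, hr1, fun id i j k hi hj hk => ?_⟩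
      · rw [hr _ (by omega)]
        have : 2 * x.idx = 0 ↔ x = .rn :=
          ⟨fun e => Reg.idx_injective (show x.idx = 0 by omega), fun e => by simp [e, Reg.idx]⟩
        simp [inputStore, initSt, this]
      · rw [hm]
        simp only [inputStore, initSt]
        split_ifs with hc
        · obtain ⟨rfl, rfl, rfl⟩ := hc; simp [addr, Arr.idx]
        -- Cells outside the input row have addresses from `S` on, beyond the text, and are
        -- therefore zero.
        · have hle : S ≤ addr S id i j k := by
            by_contra hcon
            apply hc
            have := @addr_inj S id .inp i j k 0 0 (addr S id i j k) hi hj hk (by omega) (by omega)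
              (by omega) (by simp [addr, Arr.idx])
            exact ⟨this.1, this.2.1, this.2.2.1⟩
          have : T.length ≤ addr S id i j k := by omega
          simp [List.getD_eq_getElem?_getD, this]
    have hBd : Bd (initSt T (C * (T.length + 1))) M := by
      constructor
      · intro x; simp only [initSt]; split <;> omega
      · intro id i j k
        simp only [initSt]
        split_ifs
        · rw [List.getD_eq_getElem?_getD]
          rcases lt_or_ge k T.length with hk | hk
          · have := List.single_le_sum (l := T) (fun _ _ => Nat.zero_le _) T[k] (List.getElem_mem hk)
            simp [hk]; omega
          · simp [hk]
        · omega
    have hk : (initSt T (C * (T.length + 1))).k = C * (T.length + 1) := rfl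
    have hcost : main.size * ((initSt T (C * (T.length + 1))).k - s'.k) ≤
        main.size * C * (T.length + 1) := by
      rw [hk, mul_assoc]; exact Nat.mul_le_mul_left _ (Nat.sub_le _ _)
    have hcost' : main.size * C * (T.length + 1) ≤ 2 ^ 100 * M :=
      Nat.mul_le_mul hC (by omega)
    obtain ⟨t2, σ2, ht2, h2, hsim2, hBd2⟩ := hev.sim (ω := ω) hS16 hSw le_rfl M σ1
      hBd (by omega) hsim
    obtain ⟨t3, σ3, ht3, h3, hout⟩ := postlude_steps (ω := ω) hS16 hSw hsim2
      (lt_of_le_of_lt (hBd2.v _) (by omega))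
    refine ⟨_, σ3, ?_, (h1.seq (h2.seq h3)) [], by rw [hout]; exact hG⟩
    have : (main.size * C + 40) * (T.length + 1) =
      main.size * C * (T.length + 1) + 40 * T.length + 40 := by ring
    omega
  constructor
  · intro ω s hs
    obtain ⟨t, σ', _, h1, h2⟩ := main_run ω
    rwa [hs.unique ⟨t, h1⟩]
  · have hle : ∀ ω, time (.seq sideProg (.seq main.compile postlude)) w T ω ≤
        (((main.size * C + 40) * (T.length + 1) : ℕ) : ENNReal) := by
      intro ω
      obtain ⟨t, σ', ht, h1, _⟩ := main_run ω
      exact (iInf₂_le t (by rw [h1])).trans (by exact_mod_cast ht)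
    calc expectedTime _ w T ≤ ∫⁻ _, (((main.size * C + 40) * (T.length + 1) : ℕ) : ENNReal)
          ∂randomWords w := MeasureTheory.lintegral_mono hle
      _ = (((main.size * C + 40) * (T.length + 1) : ℕ) : ENNReal) := by
        rw [MeasureTheory.lintegral_const, MeasureTheory.measure_univ, mul_one]
      _ ≤ _ := by push_cast; rfl

/-! ### Occurrences -/

/-- `u` occurs in `X` at position `p`. -/
def At (X u : List ℕ) (p : ℕ) : Prop := ∀ o < u.length, X[p + o]? = u[o]?

lemma prefix_drop_iff {X u : List ℕ} {p : ℕ} : u <+: X.drop p ↔ At X u p := by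
  rw [List.prefix_iff_getElem?]
  refine forall_congr' fun o => forall_congr' fun ho => ?_
  rw [List.getElem?_drop, List.getElem?_eq_getElem ho]

lemma prefix_iff_at {X u : List ℕ} : u <+: X ↔ At X u 0 := by
  rw [← prefix_drop_iff, List.drop_zero]

instance (X u : List ℕ) (p : ℕ) : Decidable (At X u p) := by unfold At; infer_instance

lemma at_cons_succ {X u : List ℕ} {x p : ℕ} : At (x :: X) u (p + 1) ↔ At X u p := by
  unfold At
  refine forall_congr' fun o => forall_congr' fun ho => ?_
  rw [show p + 1 + o = (p + o) + 1 by omega, List.getElem?_cons_succ]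

lemma occ_nil {u : List ℕ} (hu : u ≠ []) : occ [] u = 0 := by
  cases u with
  | nil => exact absurd rfl hu
  | cons => simp [occ]

lemma occ_cons (x : ℕ) (t u : List ℕ) :
    occ (x :: t) u = (if u <+: x :: t then 1 else 0) + occ t u := by
  simp only [occ, List.tails_cons, List.countP_cons, List.isPrefixOf_iff_prefix]
  omega

/-- The positions at which `u` occurs in `X`. -/
def pos (X u : List ℕ) : Finset ℕ := (Finset.range X.length).filter (At X u)

/-- Turns equality of frequencies into equality of sets of positions, once one set is contained in
the other. -/
lemma occ_eq_card {u : List ℕ} (hu : u ≠ []) (X : List ℕ) : occ X u = (pos X u).card := by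
  induction X with
  | nil => simp [occ_nil hu, pos]
  | cons x t ih =>
    rw [occ_cons, ih, pos, pos, Finset.card_filter, Finset.card_filter, List.length_cons,
      Finset.sum_range_succ', add_comm]
    simp only [at_cons_succ, ← prefix_iff_at]

lemma At.lt {X u : List ℕ} {p o : ℕ} (h : At X u p) (ho : o < u.length) : p + o < X.length := by
  have := h o ho
  rw [List.getElem?_eq_getElem ho] at this
  exact (List.getElem?_eq_some_iff.1 this).1

lemma mem_pos {X u : List ℕ} (hu : u ≠ []) {p : ℕ} : p ∈ pos X u ↔ At X u p := by
  simp only [pos, Finset.mem_filter, Finset.mem_range, and_iff_right_iff_imp]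
  intro h
  have := h.lt (o := 0) (List.length_pos_of_ne_nil hu)
  omega

lemma At.of_append_left {X u b : List ℕ} {p : ℕ} (h : At X (u ++ b) p) : At X u p := fun o ho => by
  rw [h o (by simp; omega), List.getElem?_append_left ho]

lemma At.of_append_right {X a u : List ℕ} {p : ℕ} (h : At X (a ++ u) p) : At X u (p + a.length) :=
  fun o ho => by
    rw [add_assoc, h _ (by simp; omega), List.getElem?_append_right (by omega)]
    simp

lemma occ_append_le_left {T u : List ℕ} (hu : u ≠ []) (b : List ℕ) : occ T (u ++ b) ≤ occ T u := by
  rw [occ_eq_card hu, occ_eq_card (by simp [hu])]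
  refine Finset.card_le_card fun p hp => ?_
  rw [mem_pos hu]
  rw [mem_pos (by simp [hu])] at hp
  exact hp.of_append_left

lemma occ_append_le_right {T u : List ℕ} (hu : u ≠ []) (a : List ℕ) : occ T (a ++ u) ≤ occ T u := by
  rw [occ_eq_card hu, occ_eq_card (by simp [hu])]
  refine Finset.card_le_card_of_injOn (· + a.length) (fun p hp => ?_)
    (fun x _ y _ h => Nat.add_right_cancel h)
  rw [Finset.mem_coe, mem_pos (by simp [hu])] at hp
  rw [Finset.mem_coe, mem_pos hu]
  exact hp.of_append_right

/-- The first pair of a string is at least as frequent as the string. -/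
lemma occ_le_occ_pair {X u : List ℕ} (hu : 2 ≤ u.length) : ∃ a b, occ X u ≤ occ X [a, b] := by
  obtain - | ⟨a, - | ⟨b, u⟩⟩ := u
  · simp at hu
  · simp at hu
  · exact ⟨a, b, occ_append_le_left (u := [a, b]) (by simp) u⟩

/-! ### Strings as frequent as the most frequent pair. -/

section frequent
variable {X r : List ℕ} {f : ℕ}

lemma At.pair {p o : ℕ} (h : At X r p) (ho : o + 1 < r.length) : At X [r[o], r[o + 1]] (p + o) := by
  intro i hi
  have : i = 0 ∨ i = 1 := by simp at hi; omega
  obtain rfl | rfl := this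
  · have h1 := h o (by omega)
    rw [List.getElem?_eq_getElem (show o < r.length by omega)] at h1
    simpa using h1
  · have h1 := h (o + 1) ho
    rw [List.getElem?_eq_getElem ho] at h1
    simpa [add_assoc] using h1

/-- The pairs of a most frequent string are distinct, so that its occurrences overlap in at most one
place. -/
lemma At.pair_inj (hX : ∀ a b, occ X [a, b] ≤ f) (hr : 2 ≤ r.length) (hrf : occ X r = f)
    {p q o o' : ℕ} (hp : At X r p) (hq : At X r q) (ho : o + 1 < r.length) (ho' : o' + 1 < r.length)
    (h : p + o = q + o') : o = o' := by
  have hne : r ≠ [] := by rintro rfl; simp at hr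
  have key : ∀ {p q o o' : ℕ}, At X r p → At X r q → o + 1 < r.length → o' + 1 < r.length →
      p + o = q + o' → ¬ o < o' := by
    intro p q o o' hp hq ho ho' h hlt
    have e1 : r[o] = r[o'] := by
      have h1 := hp o (by omega)
      have h2 := hq o' (by omega)
      rw [h, h2] at h1
      simpa [List.getElem?_eq_getElem (show o < r.length by omega),
        List.getElem?_eq_getElem (show o' < r.length by omega)] using h1.symm
    have e2 : r[o + 1] = r[o' + 1] := by
      have h1 := hp (o + 1) ho
      have h2 := hq (o' + 1) ho'
      rw [← add_assoc, h, add_assoc, h2] at h1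
      simpa [List.getElem?_eq_getElem ho, List.getElem?_eq_getElem ho'] using h1.symm
    -- The occurrences of `r`, shifted by an offset of the pair, are `f` occurrences of a pair that
    -- has at most `f`; so they are all of them. Applied to both offsets, this makes the shifts by
    -- `o` and by `o'` the same set.
    have hcard : ∀ d, (∀ x, At X r x → At X [r[o], r[o + 1]] (x + d)) →
        (pos X r).image (· + d) = pos X [r[o], r[o + 1]] := by
      intro d hd
      refine Finset.eq_of_subset_of_card_le (fun x hx => ?_) ?_
      · obtain ⟨y, hy, rfl⟩ := Finset.mem_image.1 hx
        rw [mem_pos hne] at hy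
        rw [mem_pos (by simp)]
        exact hd y hy
      · rw [Finset.card_image_of_injective _ (add_left_injective d), ← occ_eq_card hne, hrf,
          ← occ_eq_card (by simp)]
        exact hX _ _
    have h1 := hcard o fun x hx => hx.pair ho
    have h2 := hcard o' fun x hx => by rw [e1, e2]; exact hx.pair ho'
    have hpos : (pos X r).Nonempty := ⟨p, (mem_pos hne).2 hp⟩
    -- The last occurrence shifted by `o' > o` would be the shift by `o` of a later one.
    obtain ⟨y, hy, hy'⟩ : ∃ y ∈ pos X r, y + o = (pos X r).max' hpos + o' := by
      have : (pos X r).max' hpos + o' ∈ (pos X r).image (· + o) := by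
        rw [h1, ← h2]; exact Finset.mem_image_of_mem _ (Finset.max'_mem _ _)
      simpa using this
    have := Finset.le_max' _ y hy
    omega
  rcases lt_trichotomy o o' with h1 | h1 | h1
  · exact absurd h1 (key hp hq ho ho' h)
  · exact h1
  · exact absurd h1 (key hq hp ho' ho h.symm)

/-- A longer overlap would contain a pair that has offset `q - p` in one occurrence and offset `0`
in the other. -/
lemma At.sep (hX : ∀ a b, occ X [a, b] ≤ f) (hr : 2 ≤ r.length) (hrf : occ X r = f)
    {p q : ℕ} (hp : At X r p) (hq : At X r q) (h : p < q) : p + r.length ≤ q + 1 := by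
  by_contra hc
  have := At.pair_inj hX hr hrf hp hq (o := q - p) (o' := 0) (by omega) (by omega) (by omega)
  omega

/-- The pairs inside the occurrences of `r` start at `f * (|r| - 1)` different positions. This
bounds the cost of extending occurrences. -/
lemma mul_length_le (hX : ∀ a b, occ X [a, b] ≤ f) (hr : 2 ≤ r.length)
    (hrf : occ X r = f) : f * (r.length - 1) ≤ X.length := by
  have hne : r ≠ [] := by rintro rfl; simp at hr
  have := Finset.card_le_card_of_injOn (s := pos X r ×ˢ Finset.range (r.length - 1))
    (t := Finset.range X.length) (fun z => z.1 + z.2) (fun z hz => ?_) (fun z hz z' hz' h => ?_)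
  · rwa [Finset.card_product, Finset.card_range, Finset.card_range, ← occ_eq_card hne, hrf] at this
  · simp only [Finset.coe_product, Set.mem_prod, Finset.mem_coe, mem_pos hne, Finset.mem_range] at hz
    simpa using hz.1.lt (o := z.2) (by omega)
  · simp only [Finset.coe_product, Set.mem_prod, Finset.mem_coe, mem_pos hne, Finset.mem_range]
      at hz hz'
    have h2 := At.pair_inj hX hr hrf hz.1 hz'.1 (o := z.2) (o' := z'.2) (by omega) (by omega) h
    have h' : z.1 + z.2 = z'.1 + z'.2 := h
    exact Prod.ext (by omega) h2

lemma trim_length (hr : 2 ≤ r.length) : 2 ≤ (trim r).length ∧ r.length ≤ (trim r).length + 1 := by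
  unfold trim
  split
  · rename_i h; simp; omega
  · omega

lemma trim_prefix (r : List ℕ) : ∃ b, r = trim r ++ b := by
  unfold trim
  split
  · rename_i h
    have hne : r ≠ [] := by rintro rfl; simp at h
    exact ⟨[r.getLast hne], (List.dropLast_append_getLast hne).symm⟩
  · exact ⟨[], by simp⟩

lemma occ_trim (hX : ∀ a b, occ X [a, b] ≤ f) (hr : 2 ≤ r.length) (hrf : occ X r = f) :
    occ X (trim r) = f := by
  have h2 := (trim_length hr).1
  have hne : trim r ≠ [] := by rintro h; simp [h] at h2
  refine le_antisymm ?_ ?_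
  · obtain ⟨a, b, hab⟩ := occ_le_occ_pair (X := X) h2
    exact hab.trans (hX a b)
  · obtain ⟨b, hb⟩ := trim_prefix r
    conv_lhs => rw [← hrf, hb]
    exact occ_append_le_left hne b

/-- The trimmed string still has frequency `f`, so it gains no occurrences. -/
lemma at_trim (hX : ∀ a b, occ X [a, b] ≤ f) (hr : 2 ≤ r.length) (hrf : occ X r = f) {p : ℕ} :
    At X (trim r) p ↔ At X r p := by
  have h2 := (trim_length hr).1
  have hne : trim r ≠ [] := by rintro h; simp [h] at h2
  have hne' : r ≠ [] := by rintro rfl; simp at hr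
  obtain ⟨b, hb⟩ := trim_prefix r
  have hsub : pos X r ⊆ pos X (trim r) := by
    intro x hx
    rw [mem_pos hne]
    rw [mem_pos hne', hb] at hx
    exact hx.of_append_left
  have := Finset.eq_of_subset_of_card_le hsub (by
    rw [← occ_eq_card hne, ← occ_eq_card hne', occ_trim hX hr hrf, hrf])
  rw [← mem_pos hne, ← mem_pos hne', this]

/-- Overlapping occurrences share one symbol, so the first and the last symbol of `r` agree. Then
`trim` drops the shared symbol, unless `r` has length two and is a square. -/
lemma At.trim_sep (hX : ∀ a b, occ X [a, b] ≤ f) (hr : 2 ≤ r.length)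
    (hrf : occ X r = f) (hsq : ∀ x, r ≠ [x, x]) {p q : ℕ} (hp : At X r p) (hq : At X r q)
    (h : p < q) : p + (trim r).length ≤ q := by
  have h1 := At.sep hX hr hrf hp hq h
  unfold trim
  split
  · simp; omega
  · rename_i hc
    by_contra hlt
    have hq' : q = p + (r.length - 1) := by omega
    have e1 := hp (r.length - 1) (by omega)
    have e2 := hq 0 (by omega)
    rw [add_zero, hq', e1] at e2
    have e3 : r.head? = r.getLast? := by
      rw [List.head?_eq_getElem?, List.getLast?_eq_getElem?, e2]
    have hl : r.length = 2 := by
      by_contra h3; exact hc ⟨by omega, e3⟩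
    obtain ⟨a, b, rfl⟩ := List.length_eq_two.1 hl
    simp at e3
    exact hsq b (by rw [e3])

end frequent

/-! ### The text with sentinels -/

/-- The text between two sentinels. -/
def pad (L : List ℕ) : List ℕ := 0 :: L ++ [0]

lemma occ_append_singleton {L u : List ℕ} {x : ℕ} (hu : u ≠ []) (hx : x ∉ u) :
    occ (L ++ [x]) u = occ L u := by
  rw [occ_eq_card hu, occ_eq_card hu]
  congr 1
  ext p
  rw [mem_pos hu, mem_pos hu]
  constructor
  · intro h o ho
    have hlt := h.lt ho
    have h1 := h o ho
    have : p + o ≠ L.length := by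
      intro e
      rw [e, List.getElem?_concat_length, List.getElem?_eq_getElem ho] at h1
      exact hx (by rw [Option.some_inj.1 h1]; exact List.getElem_mem ho)
    rw [← h1, List.getElem?_append_left (by simp at hlt; omega)]
  · intro h o ho
    rw [List.getElem?_append_left (h.lt ho), h o ho]

lemma occ_pad {L u : List ℕ} (hu : u ≠ []) (h0 : 0 ∉ u) : occ (pad L) u = occ L u := by
  rw [pad, List.cons_append, occ_cons, if_neg, zero_add, occ_append_singleton hu h0]
  intro h
  obtain - | ⟨a, u⟩ := u
  · exact hu rfl
  · rw [List.cons_prefix_cons] at h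
    exact h0 (by simp [h.1])

lemma pad_getElem_eq_zero {L : List ℕ} (hL : 0 ∉ L) {p : ℕ} (h : (pad L)[p]? = some 0) :
    p = 0 ∨ p = L.length + 1 := by
  obtain - | p := p
  · exact .inl rfl
  · right
    rw [pad, List.cons_append, List.getElem?_cons_succ] at h
    rcases lt_trichotomy p L.length with h1 | h1 | h1
    · rw [List.getElem?_append_left h1] at h
      exact absurd (List.mem_of_getElem? h) hL
    · omega
    · rw [List.getElem?_eq_none (by simp; omega)] at h
      simp at h

/-- In two occurrences the same offset would hit both sentinels; hitting the left one forces offset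
`0`, and then nothing follows the right one. -/
lemma zero_notMem_of_two_le_occ {L u : List ℕ} (hL : 0 ∉ L) (hu : 2 ≤ u.length)
    (h : 2 ≤ occ (pad L) u) : 0 ∉ u := by
  intro h0
  have hne : u ≠ [] := by rintro rfl; simp at hu
  obtain ⟨o, ho, ho'⟩ := List.mem_iff_getElem.1 h0
  rw [occ_eq_card hne] at h
  obtain ⟨p, hp, q, hq, hpq⟩ := Finset.one_lt_card.1 h
  rw [mem_pos hne] at hp hq
  have key : ∀ p, At (pad L) u p → p + o = 0 ∨ p + o = L.length + 1 := fun p hp =>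
    pad_getElem_eq_zero hL (by rw [hp o ho, List.getElem?_eq_getElem ho, ho'])
  have hlt : ∀ p, At (pad L) u p → p + 1 < L.length + 2 := fun p hp => by
    simpa [pad] using hp.lt (o := 1) (by omega)
  have := key p hp
  have := key q hq
  have := hlt p hp
  have := hlt q hq
  omega

lemma occ_pair_pad_le {L : List ℕ} (hL : 0 ∉ L) {f : ℕ} (hf : 1 ≤ f)
    (h : ∀ a b, occ L [a, b] ≤ f) (a b : ℕ) : occ (pad L) [a, b] ≤ f := by
  by_contra hc
  have h0 := zero_notMem_of_two_le_occ hL (u := [a, b]) (by simp) (by omega)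
  rw [occ_pad (by simp) h0] at hc
  exact hc (h a b)

lemma occ_eq_zero_of_notMem {L u : List ℕ} {x : ℕ} (hx : x ∈ u) (hL : x ∉ L) : occ L u = 0 := by
  have hu : u ≠ [] := by rintro rfl; simp at hx
  rw [occ_eq_card hu, Finset.card_eq_zero, Finset.eq_empty_iff_forall_notMem]
  intro p hp
  rw [mem_pos hu] at hp
  obtain ⟨o, ho, rfl⟩ := List.mem_iff_getElem.1 hx
  have := hp o ho
  rw [List.getElem?_eq_getElem ho] at this
  exact hL (List.mem_of_getElem? this)

lemma occ_le_occ_pad (L : List ℕ) (hL : 0 ∉ L) {u : List ℕ} (hu : u ≠ []) :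
    occ L u ≤ occ (pad L) u := by
  by_cases h0 : 0 ∈ u
  · rw [occ_eq_zero_of_notMem h0 hL]; exact Nat.zero_le _
  · rw [occ_pad hu h0]

/-- A long extension is at most as frequent as the extension by one symbol that it contains, and any
competitor is at most as frequent as its first pair. Extensions by a sentinel are covered by working
in the padded text. -/
lemma mostFrequent_of_not_extendable {L r : List ℕ} (hL : 0 ∉ L) {f : ℕ} (hf : 2 ≤ f)
    (hX : ∀ a b, occ (pad L) [a, b] ≤ f) (hr : 2 ≤ r.length) (hrf : occ (pad L) r = f)
    (h1 : ∀ c, occ (pad L) (c :: r) ≠ f) (h2 : ∀ c, occ (pad L) (r ++ [c]) ≠ f) :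
    IsMostFrequentMaximalRepeat L r := by
  have hne : r ≠ [] := by rintro rfl; simp at hr
  have h0 := zero_notMem_of_two_le_occ hL hr (by omega)
  have hrL : occ L r = f := by rw [← occ_pad hne h0, hrf]
  refine ⟨⟨by omega, by omega, fun w hw _ => ?_, fun w hw _ => ?_⟩, fun u hu => ?_⟩
  · have hc := List.dropLast_append_getLast hw
    rw [hrL, ← hc, List.append_assoc]
    calc _ ≤ occ L ([w.getLast hw] ++ r) := occ_append_le_right (by simp) _
      _ ≤ occ (pad L) ([w.getLast hw] ++ r) := occ_le_occ_pad L hL (by simp)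
      _ < f := lt_of_le_of_ne (by
        rw [← hrf]; exact occ_append_le_right hne _) (h1 _)
  · obtain - | ⟨c, w⟩ := w
    · exact absurd rfl hw
    rw [hrL, show r ++ c :: w = (r ++ [c]) ++ w by simp]
    calc _ ≤ occ L (r ++ [c]) := occ_append_le_left (by simp) _
      _ ≤ occ (pad L) (r ++ [c]) := occ_le_occ_pad L hL (by simp)
      _ < f := lt_of_le_of_ne (by
        rw [← hrf]; exact occ_append_le_left hne _) (h2 _)
  · obtain ⟨a, b, hab⟩ := occ_le_occ_pair (X := L) hu.1
    rw [hrL]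
    exact hab.trans ((occ_le_occ_pad L hL (by simp)).trans (hX a b))

lemma not_maximalRepeat {L : List ℕ} (hL : 0 ∉ L) (hX : ∀ a b, occ (pad L) [a, b] ≤ 1) :
    ¬ ∃ r, IsMaximalRepeat L r := by
  rintro ⟨u, hu⟩
  obtain ⟨a, b, hab⟩ := occ_le_occ_pair (X := L) hu.1
  have := hab.trans ((occ_le_occ_pad L hL (by simp)).trans (hX a b))
  have := hu.2.1
  omega

/-! ### Frequencies after a replacement -/

lemma occ_pair_cons (x : ℕ) (t : List ℕ) (a b : ℕ) :
    occ (x :: t) [a, b] = (if x = a ∧ t.head? = some b then 1 else 0) + occ t [a, b] := by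
  rw [occ_cons]
  congr 1
  cases t <;> simp [eq_comm]

lemma occ_pair_le_count_left (T : List ℕ) (a b : ℕ) : occ T [a, b] ≤ T.count a := by
  induction T with
  | nil => simp [occ_nil]
  | cons x t ih =>
    rw [occ_pair_cons, List.count_cons]
    by_cases h : x = a
    · simp [h]; split <;> omega
    · simp [h]; omega

lemma occ_pair_le_count_right (T : List ℕ) (a b : ℕ) : occ T [a, b] ≤ T.count b := by
  have : occ T [a, b] ≤ T.tail.count b := by
    induction T with
    | nil => simp [occ_nil]
    | cons x t ih =>
      rw [occ_pair_cons]
      cases t with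
      | nil => simp [occ_nil]
      | cons y t =>
        simp only [List.tail_cons, List.head?_cons, List.count_cons] at ih ⊢
        by_cases h : y = b
        · subst h; simp; split <;> omega
        · simp [h]; omega
  refine this.trans (List.Sublist.count_le _ (List.tail_sublist T))

lemma occ_le_append (A T u : List ℕ) : occ T u ≤ occ (A ++ T) u := by
  induction A with
  | nil => simp
  | cons a A ih => rw [List.cons_append, occ_cons]; omega

/-- Each copy of the new variable stands for its own occurrence of `r`. -/
lemma ReplaceAll.count_le {r : List ℕ} {v : ℕ} {T T' : List ℕ} (hr : r ≠ [])
    (h : ReplaceAll r v T T') (hv : v ∉ T) : T'.count v ≤ occ T r := by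
  induction h with
  | nil => simp
  | @hit T T' _ ih =>
    simp only [List.mem_append, not_or] at hv
    have := ih hv.2
    obtain - | ⟨a, r⟩ := r
    · exact absurd rfl hr
    rw [List.cons_append, occ_cons, if_pos (by simp)]
    have := occ_le_append r T (a :: r)
    simp; omega
  | @miss a T T' _ _ ih =>
    simp only [List.mem_cons, not_or] at hv
    have := ih hv.2
    rw [occ_cons, List.count_cons_of_ne (Ne.symm hv.1)]
    omega

lemma ReplaceAll.occ_pair_le {r : List ℕ} {v : ℕ} {T T' : List ℕ}
    (h : ReplaceAll r v T T') {a b : ℕ} (ha : a ≠ v) (hb : b ≠ v) :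
    occ T' [a, b] ≤ occ T [a, b] := by
  have head : ∀ {T T'}, ReplaceAll r v T T' → T'.head? = some b → T.head? = some b := by
    intro T T' h hb'
    cases h with
    | nil => simp at hb'
    | hit => simp at hb'; exact absurd hb'.symm hb
    | miss => simpa using hb'
  induction h with
  | nil => exact le_rfl
  | @hit T T' _ ih =>
    rw [occ_pair_cons, if_neg (fun h => ha h.1.symm), zero_add]
    exact ih.trans (occ_le_append _ _ _)
  | @miss c T T' _ h ih =>
    rw [occ_pair_cons, occ_pair_cons]
    have : (if c = a ∧ T'.head? = some b then 1 else 0) ≤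
        (if c = a ∧ T.head? = some b then 1 else 0) := by
      split_ifs with h1 h2
      · exact le_rfl
      · exact absurd ⟨h1.1, head h h1.2⟩ h2
      · exact Nat.zero_le _
      · exact le_rfl
    omega

/-- Pairs of old symbols only lose occurrences, and a pair containing the new variable is at most as
frequent as that variable. So the bound `f` on pair frequencies persists. -/
lemma ReplaceAll.occ_pair_le_of {r : List ℕ} {v : ℕ} {T T' : List ℕ} {f : ℕ} (hr : r ≠ [])
    (h : ReplaceAll r v T T') (hv : v ∉ T) (hrf : occ T r ≤ f) (hT : ∀ a b, occ T [a, b] ≤ f)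
    (a b : ℕ) : occ T' [a, b] ≤ f := by
  have hc := (h.count_le hr hv).trans hrf
  by_cases ha : a = v
  · subst ha; exact (occ_pair_le_count_left _ _ _).trans hc
  by_cases hb : b = v
  · subst hb; exact (occ_pair_le_count_right _ _ _).trans hc
  · exact (h.occ_pair_le ha hb).trans (hT a b)

/-! ### Frequencies after the replacement of runs. -/

lemma occ_replicate_append {x k : ℕ} {T : List ℕ} (hT : T.head? ≠ some x) :
    occ (List.replicate (k + 1) x ++ T) [x, x] = k + occ T [x, x] := by
  induction k with
  | zero => simp [occ_pair_cons, hT]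
  | succ k ih =>
    rw [List.replicate_succ, List.cons_append, occ_pair_cons, ih, if_pos]
    · omega
    · simp [List.replicate_succ]

/-- A run of length `k` contains `k - 1` occurrences of the square and shrinks by `k - 1` symbols.
-/
lemma ReplaceRuns.length_eq {x : ℕ} {v : ℕ → ℕ} {T T' : List ℕ} (h : ReplaceRuns x v T T') :
    T.length = T'.length + occ T [x, x] := by
  induction h with
  | nil => simp [occ_nil]
  | other ha _ ih => rw [occ_pair_cons, if_neg (fun h => ha h.1)]; simp [ih]; omega
  | single hT _ ih => rw [occ_pair_cons, if_neg (fun h => hT h.2)]; simp [ih]; omega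
  | @run k T T' hk hT _ ih =>
    obtain ⟨k, rfl⟩ : ∃ j, k = j + 1 := ⟨k - 1, by omega⟩
    rw [occ_replicate_append hT]; simp [ih]; omega

/-- Every run contributes at least one square and at most one copy of `y`, whatever the names `v k`
are. -/
lemma ReplaceRuns.count_le {x : ℕ} {v : ℕ → ℕ} {T T' : List ℕ} (h : ReplaceRuns x v T T') {y : ℕ}
    (hv : y ∉ T) : T'.count y ≤ occ T [x, x] := by
  induction h with
  | nil => simp
  | other ha _ ih =>
    simp only [List.mem_cons, not_or] at hv
    have := ih hv.2
    rw [occ_pair_cons, List.count_cons_of_ne (Ne.symm hv.1)]; omega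
  | single hT _ ih =>
    simp only [List.mem_cons, not_or] at hv
    have := ih hv.2
    rw [occ_pair_cons, List.count_cons_of_ne (Ne.symm hv.1)]; omega
  | @run k T T' hk hT _ ih =>
    simp only [List.mem_append, not_or] at hv
    have := ih hv.2
    obtain ⟨k, rfl⟩ : ∃ j, k = j + 1 := ⟨k - 1, by omega⟩
    rw [occ_replicate_append hT, List.count_cons]
    split <;> omega

lemma ReplaceRuns.occ_pair_le {x : ℕ} {v : ℕ → ℕ} {T T' : List ℕ} (h : ReplaceRuns x v T T')
    {a b : ℕ} (ha : ∀ k, a ≠ v k) (hb : ∀ k, b ≠ v k) : occ T' [a, b] ≤ occ T [a, b] := by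
  have head : ∀ {T T'}, ReplaceRuns x v T T' → T'.head? = some b → T.head? = some b := by
    intro T T' h hb'
    cases h with
    | nil => simp at hb'
    | other => simpa using hb'
    | single => simpa using hb'
    | run => simp at hb'; exact absurd hb'.symm (hb _)
  have step : ∀ {c T T'}, ReplaceRuns x v T T' → occ T' [a, b] ≤ occ T [a, b] →
      occ (c :: T') [a, b] ≤ occ (c :: T) [a, b] := by
    intro c T T' h ih
    rw [occ_pair_cons, occ_pair_cons]
    have : (if c = a ∧ T'.head? = some b then 1 else 0) ≤
        (if c = a ∧ T.head? = some b then 1 else 0) := by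
      split_ifs with h1 h2
      · exact le_rfl
      · exact absurd ⟨h1.1, head h h1.2⟩ h2
      · exact Nat.zero_le _
      · exact le_rfl
    omega
  induction h with
  | nil => exact le_rfl
  | other _ h ih => exact step h ih
  | single _ h ih => exact step h ih
  | run _ _ _ ih =>
    rw [occ_pair_cons, if_neg (fun h => ha _ h.1.symm), zero_add]
    exact ih.trans (occ_le_append _ _ _)

lemma ReplaceRuns.occ_pair_le_of {x : ℕ} {v : ℕ → ℕ} {T T' : List ℕ} {f : ℕ}
    (h : ReplaceRuns x v T T') (hv : ∀ k, v k ∉ T) (hT : ∀ a b, occ T [a, b] ≤ f)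
    (a b : ℕ) : occ T' [a, b] ≤ f := by
  by_cases ha : ∃ k, a = v k
  · obtain ⟨k, rfl⟩ := ha
    exact (occ_pair_le_count_left _ _ _).trans ((h.count_le (hv k)).trans (hT _ _))
  by_cases hb : ∃ k, b = v k
  · obtain ⟨k, rfl⟩ := hb
    exact (occ_pair_le_count_right _ _ _).trans ((h.count_le (hv k)).trans (hT _ _))
  · push Not at ha hb
    exact (h.occ_pair_le ha hb).trans (hT a b)

/-! ### Pairs, their frequencies, and stacks of their occurrences -/

/-- The pairs of a list of nodes `P` with symbols `g`, with the nodes where they start. -/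
def bg (g : ℕ → ℕ) : List ℕ → List (ℕ × ℕ × ℕ)
  | i :: j :: B => (i, g i, g j) :: bg g (j :: B)
  | _ => []

/-- Stack `(x, y)` has the entry `(p, q)`. -/
def Has (A : Arrays) (x y p q : ℕ) : Prop :=
  ∃ j < A .slen x y 0, A .st1 x y j = p ∧ A .st2 x y j = q

/-- The data structure for a collection `M` of occurrences of pairs: exact frequencies, stacks
`(a + 1, b)` of the occurrences of `(a, b) ≠ ex`, `a ≠ 0`, stacks `(0, f)` of the pairs of frequency `f`; the
stacks have at most `T` entries altogether, some of which may be out of date. -/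
structure Bag (M : List (ℕ × ℕ × ℕ)) (ex : ℕ × ℕ) (T : ℕ) (A : Arrays) : Prop where
  cnt : ∀ a b, A .cnt a b 0 = M.countP (fun t => t.2 = (a, b))
  occ : ∀ t ∈ M, t.2.1 ≠ 0 → t.2 ≠ ex → Has A (t.2.1 + 1) t.2.2 t.1 0
  bucket : ∀ a b, 1 ≤ A .cnt a b 0 → Has A 0 (A .cnt a b 0) a b
  tot : ∀ F : Finset (ℕ × ℕ), ∑ p ∈ F, A .slen p.1 p.2 0 ≤ T

lemma Bag.perm {M M' : List (ℕ × ℕ × ℕ)} {ex : ℕ × ℕ} {T : ℕ} {A : Arrays} (h : Bag M ex T A)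
    (hM : M.Perm M') : Bag M' ex T A :=
  ⟨fun a b => by rw [h.cnt, hM.countP_eq], fun t ht => h.occ t (hM.mem_iff.2 ht), h.bucket, h.tot⟩

lemma Bag.congr {M : List (ℕ × ℕ × ℕ)} {ex : ℕ × ℕ} {T : ℕ} {A A' : Arrays} (h : Bag M ex T A)
    (h1 : A' .cnt = A .cnt) (h2 : A' .slen = A .slen) (h3 : A' .st1 = A .st1)
    (h4 : A' .st2 = A .st2) : Bag M ex T A' := by
  have hHas : ∀ {x y p q}, Has A x y p q → Has A' x y p q := by
    rintro x y p q ⟨j, hj⟩; exact ⟨j, by rwa [h2, h3, h4]⟩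
  exact ⟨by rw [h1]; exact h.cnt, fun t ht h0 hx => hHas (h.occ t ht h0 hx),
    fun a b => by rw [h1]; exact fun hc => hHas (h.bucket a b hc), by rw [h2]; exact h.tot⟩

/-- `Has` survives because entries below the old height are untouched. -/
def Arrays.push (A : Arrays) (x y p q : ℕ) : Arrays :=
  ((A.upd .st1 x y (A .slen x y 0) p).upd .st2 x y (A .slen x y 0) q).upd .slen x y 0
    (A .slen x y 0 + 1)

lemma Arrays.push_of_ne {A : Arrays} {x y p q : ℕ} {id : Arr} (h1 : id ≠ .slen) (h2 : id ≠ .st1)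
    (h3 : id ≠ .st2) : A.push x y p q id = A id := by
  funext i j k; simp [Arrays.push, Arrays.upd, h1, h2, h3]

lemma Arrays.upd_of_ne {A : Arrays} {i j k x : ℕ} {id id' : Arr} (h : id' ≠ id) :
    A.upd id i j k x id' = A id' := by
  funext i j k; simp [Arrays.upd, h]

lemma Has.push_self {A : Arrays} {x y p q : ℕ} : Has (A.push x y p q) x y p q :=
  ⟨A .slen x y 0, by simp [Arrays.push, Arrays.upd]⟩

lemma Has.push {A : Arrays} {x y p q x' y' p' q' : ℕ} (h : Has A x' y' p' q') :
    Has (A.push x y p q) x' y' p' q' := by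
  obtain ⟨j, h1, h2, h3⟩ := h
  have hne : ¬ (x' = x ∧ y' = y ∧ j = A .slen x y 0) := by
    rintro ⟨rfl, rfl, rfl⟩; omega
  refine ⟨j, ?_, by simp [Arrays.push, Arrays.upd, hne, h2],
    by simp [Arrays.push, Arrays.upd, hne, h3]⟩
  simp only [Arrays.push, Arrays.upd]
  by_cases e : x' = x ∧ y' = y
  · obtain ⟨rfl, rfl⟩ := e; simp; omega
  · simpa [e] using h1

lemma push_tot {A : Arrays} {x y p q T : ℕ}
    (h : ∀ F : Finset (ℕ × ℕ), ∑ p ∈ F, A .slen p.1 p.2 0 ≤ T) (F : Finset (ℕ × ℕ)) :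
    ∑ z ∈ F, A.push x y p q .slen z.1 z.2 0 ≤ T + 1 := by
  have e : ∀ z : ℕ × ℕ, A.push x y p q .slen z.1 z.2 0 ≤
      A .slen z.1 z.2 0 + if z = (x, y) then 1 else 0 := by
    intro z
    simp only [Arrays.push, Arrays.upd, Prod.ext_iff]
    by_cases hz : z.1 = x ∧ z.2 = y
    · simp [hz]
    · simp [hz]
  calc _ ≤ ∑ z ∈ F, (A .slen z.1 z.2 0 + if z = (x, y) then 1 else 0) :=
        Finset.sum_le_sum fun z _ => e z
    _ ≤ T + 1 := by
        rw [Finset.sum_add_distrib]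
        refine add_le_add (h F) ?_
        rw [Finset.sum_ite_eq']; split <;> simp

/-- Nothing is removed from a stack: the entry of the lost occurrence and the entry in the old
bucket merely become outdated. The one push puts the pair into the bucket of its new frequency. -/
lemma Bag.dec {M : List (ℕ × ℕ × ℕ)} {ex : ℕ × ℕ} {T i a b : ℕ} {A : Arrays}
    (h : Bag ((i, a, b) :: M) ex T A) :
    Bag M ex (T + 1) ((A.upd .cnt a b 0 (A .cnt a b 0 - 1)).push 0 (A .cnt a b 0 - 1) a b) := by
  have hHas : ∀ {x y p q}, Has A x y p q → Has (A.upd .cnt a b 0 (A .cnt a b 0 - 1)) x y p q := id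
  constructor
  · intro a' b'
    rw [Arrays.push_of_ne (by simp) (by simp) (by simp)]
    have := h.cnt a' b'
    have h0 := h.cnt a b
    simp only [List.countP_cons] at this h0
    by_cases e : a' = a ∧ b' = b
    · obtain ⟨rfl, rfl⟩ := e
      simp [Arrays.upd, h0]
    · have e' : ¬ (a = a' ∧ b = b') := fun h => e ⟨h.1.symm, h.2.symm⟩
      simp [Arrays.upd, e, this, e']
  · intro t ht ht0 hx
    exact (hHas (h.occ t (List.mem_cons_of_mem _ ht) ht0 hx)).push
  · intro a' b'
    rw [Arrays.push_of_ne (by simp) (by simp) (by simp)]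
    by_cases e : a' = a ∧ b' = b
    · obtain ⟨rfl, rfl⟩ := e
      intro _
      simpa [Arrays.upd] using Has.push_self
    · simp only [Arrays.upd, true_and, and_true, e, if_false]
      exact fun hc => (hHas (h.bucket a' b' hc)).push
  · exact push_tot h.tot

/-- One push for the bucket, one for the occurrence; the latter stack has first index `a + 1`, as
`0` is reserved for buckets. -/
lemma Bag.inc {M : List (ℕ × ℕ × ℕ)} {ex : ℕ × ℕ} {T i a b : ℕ} {A : Arrays}
    (h : Bag M ex T A) :
    Bag ((i, a, b) :: M) ex (T + 2)
      (((A.upd .cnt a b 0 (A .cnt a b 0 + 1)).push 0 (A .cnt a b 0 + 1) a b).push (a + 1) b i 0) := by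
  have hHas : ∀ {x y p q}, Has A x y p q → Has (A.upd .cnt a b 0 (A .cnt a b 0 + 1)) x y p q := id
  constructor
  · intro a' b'
    rw [Arrays.push_of_ne (by simp) (by simp) (by simp),
      Arrays.push_of_ne (by simp) (by simp) (by simp)]
    have := h.cnt a' b'
    have h0 := h.cnt a b
    simp only [List.countP_cons]
    by_cases e : a' = a ∧ b' = b
    · obtain ⟨rfl, rfl⟩ := e
      simp [Arrays.upd, h0]
    · have e' : ¬ (a = a' ∧ b = b') := fun h => e ⟨h.1.symm, h.2.symm⟩
      simp [Arrays.upd, e, this, e']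
  · intro t ht ht0 hx
    rcases List.mem_cons.1 ht with rfl | ht
    · exact Has.push_self
    · exact (hHas (h.occ t ht ht0 hx)).push.push
  · intro a' b'
    rw [Arrays.push_of_ne (by simp) (by simp) (by simp),
      Arrays.push_of_ne (by simp) (by simp) (by simp)]
    by_cases e : a' = a ∧ b' = b
    · obtain ⟨rfl, rfl⟩ := e
      intro _
      simpa [Arrays.upd] using Has.push_self.push
    · simp only [Arrays.upd, true_and, and_true, e, if_false]
      exact fun hc => (hHas (h.bucket a' b' hc)).push.push
  · exact push_tot (push_tot h.tot)

def pushC (x y p q : Exp) : Cmd :=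
  .seq (.put .st1 x y (.get .slen x y (.lit 0)) p) <|
  .seq (.put .st2 x y (.get .slen x y (.lit 0)) q) <|
  .put .slen x y (.lit 0) (.inc (.get .slen x y (.lit 0)))

/-- The frequency of the pair of the contents of two registers. -/
def cntE (a b : Reg) : Exp := .get .cnt (.var a) (.var b) (.lit 0)

/-- Unregister one occurrence of the pair `(a, b)`. -/
def decC (a b : Reg) : Cmd :=
  .seq (.put .cnt (.var a) (.var b) (.lit 0) (.pred (cntE a b))) <|
  pushC (.lit 0) (cntE a b) (.var a) (.var b)

/-- Register the occurrence of the pair `(a, b)` at node `i`. -/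
def incC (i a b : Reg) : Cmd :=
  .seq (.put .cnt (.var a) (.var b) (.lit 0) (.inc (cntE a b))) <|
  .seq (pushC (.lit 0) (cntE a b) (.var a) (.var b)) <|
  pushC (.inc (.var a)) (.var b) (.var i) (.lit 0)

/-- Only the arrays of the pair statistics changed. -/
def SamePairs (A A' : Arrays) : Prop :=
  ∀ id, id ≠ .cnt → id ≠ .slen → id ≠ .st1 → id ≠ .st2 → A' id = A id

lemma SamePairs.trans {A A' A'' : Arrays} (h : SamePairs A A') (h' : SamePairs A' A'') :
    SamePairs A A'' := fun id h1 h2 h3 h4 => (h' id h1 h2 h3 h4).trans (h id h1 h2 h3 h4)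

lemma wp_decC {a b : Reg} {Q : St → Prop} {s : St} {M : List (ℕ × ℕ × ℕ)} {ex : ℕ × ℕ} {T i : ℕ}
    (h : Bag ((i, s.v a, s.v b) :: M) ex T s.A) (hk : 4 ≤ s.k)
    (hQ : ∀ A', Bag M ex (T + 1) A' → SamePairs s.A A' → Q ⟨s.v, A', s.k - 4⟩) :
    wp (decC a b) Q s := by
  have := hQ _ h.dec (fun id h1 h2 h3 h4 => by
    rw [Arrays.push_of_ne h2 h3 h4, Arrays.upd_of_ne h1])
  simp only [decC, pushC, cntE, wp_seq, wp_put, Exp.eval, St.putA]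
  refine ⟨by omega, by omega, by omega, by omega, ?_⟩
  convert this using 2
  · simp [Arrays.push, Arrays.upd]
  · simp [Nat.sub_sub]

lemma wp_incC {i a b : Reg} {Q : St → Prop} {s : St} {M : List (ℕ × ℕ × ℕ)} {ex : ℕ × ℕ} {T : ℕ}
    (h : Bag M ex T s.A) (hk : 7 ≤ s.k)
    (hQ : ∀ A', Bag ((s.v i, s.v a, s.v b) :: M) ex (T + 2) A' → SamePairs s.A A' →
      Q ⟨s.v, A', s.k - 7⟩) :
    wp (incC i a b) Q s := by
  have := hQ _ h.inc (fun id h1 h2 h3 h4 => by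
    rw [Arrays.push_of_ne h2 h3 h4, Arrays.push_of_ne h2 h3 h4, Arrays.upd_of_ne h1])
  simp only [incC, pushC, cntE, wp_seq, wp_put, Exp.eval, St.putA]
  refine ⟨by omega, by omega, by omega, by omega, by omega, by omega, by omega, ?_⟩
  convert this using 2
  · simp [Arrays.push, Arrays.upd]
  · simp [Nat.sub_sub]

/-! ### The text as a doubly linked list -/

lemma bg_append (g : ℕ → ℕ) (L : List ℕ) (i : ℕ) (R : List ℕ) :
    bg g (L ++ i :: R) = bg g (L ++ [i]) ++ bg g (i :: R) := by
  induction L with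
  | nil => simp [bg]
  | cons x L ih =>
    cases L with
    | nil => simp [bg]
    | cons y L => simpa [bg] using ih

lemma bg_congr {g g' : ℕ → ℕ} {P : List ℕ} (h : ∀ i ∈ P, g i = g' i) : bg g P = bg g' P := by
  induction P with
  | nil => rfl
  | cons x P ih =>
    cases P with
    | nil => rfl
    | cons y P =>
      simp only [bg]
      rw [ih fun i hi => h i (List.mem_cons_of_mem _ hi), h x (by simp), h y (by simp)]

lemma mem_bg {g : ℕ → ℕ} {P : List ℕ} {t : ℕ × ℕ × ℕ} :
    t ∈ bg g P ↔ ∃ (p : ℕ) (i j : ℕ), P[p]? = some i ∧ P[p + 1]? = some j ∧ t = (i, g i, g j) := by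
  induction P with
  | nil => simp [bg]
  | cons x P ih =>
    cases P with
    | nil => simp [bg]
    | cons y P =>
      simp only [bg, List.mem_cons, ih]
      constructor
      · rintro (rfl | ⟨p, i, j, h1, h2, rfl⟩)
        · exact ⟨0, x, y, rfl, rfl, rfl⟩
        · exact ⟨p + 1, i, j, by simpa using h1, by simpa using h2, rfl⟩
      · rintro ⟨p, i, j, h1, h2, rfl⟩
        obtain - | p := p
        · simp at h1 h2; subst h1 h2; exact .inl rfl
        · exact .inr ⟨p, i, j, by simpa using h1, by simpa using h2, rfl⟩

lemma countP_bg (g : ℕ → ℕ) (P : List ℕ) (a b : ℕ) :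
    (bg g P).countP (fun t => t.2 = (a, b)) = occ (P.map g) [a, b] := by
  induction P with
  | nil => simp [bg, occ_nil]
  | cons x P ih =>
    cases P with
    | nil => simp [bg, occ_pair_cons, occ_nil]
    | cons y P =>
      rw [List.map_cons, occ_pair_cons, bg, List.countP_cons, ih, add_comm]
      simp

/-- `P` is the list of the nodes of the doubly linked list in the arrays. -/
structure Lnk (P : List ℕ) (A : Arrays) : Prop where
  -- Deleted and unused nodes carry the sentinel symbol `0`, so outdated references to them fail the
  -- test on symbols.
  nodup : P.Nodup
  chain : P.IsChain (fun i j => A .nb 0 i 0 = j ∧ A .nb 1 j 0 = i)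
  dead : ∀ i ∉ P, A .tok i 0 0 = 0

def tokOf (A : Arrays) (i : ℕ) : ℕ := A .tok i 0 0

structure Full (P : List ℕ) (ex : ℕ × ℕ) (T : ℕ) (A : Arrays) : Prop where
  lnk : Lnk P A
  bag : Bag (bg (tokOf A) P) ex T A

lemma Lnk.next {P : List ℕ} {A : Arrays} (h : Lnk P A) {p i j : ℕ} (hi : P[p]? = some i)
    (hj : P[p + 1]? = some j) : A .nb 0 i 0 = j ∧ A .nb 1 j 0 = i := by
  obtain ⟨h1, rfl⟩ := List.getElem?_eq_some_iff.1 hi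
  obtain ⟨h2, rfl⟩ := List.getElem?_eq_some_iff.1 hj
  exact h.chain.getElem p h2

lemma Lnk.split {L R : List ℕ} {i j : ℕ} {A : Arrays} (h : Lnk (L ++ i :: j :: R) A) :
    A .nb 0 i 0 = j ∧ A .nb 1 j 0 = i := by
  have := h.chain
  rw [List.isChain_append_cons_cons] at this
  exact this.2.1

lemma Full.cnt {P : List ℕ} {ex : ℕ × ℕ} {T : ℕ} {A : Arrays} (h : Full P ex T A) (a b : ℕ) :
    A .cnt a b 0 = occ (P.map (tokOf A)) [a, b] := by rw [h.bag.cnt, countP_bg]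

def nextE (e : Exp) : Exp := .get .nb (.lit 0) e (.lit 0)
def prevE (e : Exp) : Exp := .get .nb (.lit 1) e (.lit 0)
def tokE (e : Exp) : Exp := .get .tok e (.lit 0) (.lit 0)

/-- Delete the node after node `i`. -/
def delC : Cmd :=
  .seq (.set .rx (nextE (.var .ri))) <|
  .seq (.set .ry (nextE (.var .rx))) <|
  .seq (.set .rp (tokE (.var .ri))) <|
  .seq (.set .rq (tokE (.var .rx))) <|
  .seq (.set .rr (tokE (.var .ry))) <|
  .seq (decC .rp .rq) <| .seq (decC .rq .rr) <|
  .seq (.put .nb (.lit 0) (.var .ri) (.lit 0) (.var .ry)) <|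
  .seq (.put .nb (.lit 1) (.var .ry) (.lit 0) (.var .ri)) <|
  .seq (.put .tok (.var .rx) (.lit 0) (.lit 0) (.lit 0)) <|
  incC .ri .rp .rr

/-- Change the symbol of node `i` to `w`. -/
def retokC : Cmd :=
  .seq (.set .rx (prevE (.var .ri))) <|
  .seq (.set .ry (nextE (.var .ri))) <|
  .seq (.set .rp (tokE (.var .rx))) <|
  .seq (.set .rq (tokE (.var .ri))) <|
  .seq (.set .rr (tokE (.var .ry))) <|
  .seq (decC .rp .rq) <| .seq (decC .rq .rr) <|
  .seq (.put .tok (.var .ri) (.lit 0) (.lit 0) (.var .rw)) <|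
  .seq (incC .rx .rp .rw) <| incC .ri .rw .rr

/-- Only the arrays of the text and of the pair statistics changed. -/
def SameRest (A A' : Arrays) : Prop :=
  ∀ id, id ≠ .cnt → id ≠ .slen → id ≠ .st1 → id ≠ .st2 → id ≠ .tok → id ≠ .nb → A' id = A id

lemma Lnk.del {L R : List ℕ} {i x y : ℕ} {A A' : Arrays} (h : Lnk (L ++ i :: x :: y :: R) A)
    (ht : ∀ z, tokOf A' z = if z = x then 0 else tokOf A z)
    (hn : ∀ d z, A' .nb d z 0 = if d = 1 ∧ z = y then i else if d = 0 ∧ z = i then y else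
      A .nb d z 0) : Lnk (L ++ i :: y :: R) A' := by
  have hnd := h.nodup
  have hx : ∀ z ∈ L ++ [i], z ≠ x ∧ z ≠ y := by
    intro z hz
    rw [show L ++ i :: x :: y :: R = (L ++ [i]) ++ x :: y :: R by simp, List.nodup_append] at hnd
    exact ⟨fun e => hnd.2.2 z hz x (by simp) e, fun e => hnd.2.2 z hz y (by simp) e⟩
  have hy : ∀ z ∈ y :: R, z ≠ i ∧ z ≠ x := by
    intro z hz
    rw [List.nodup_append] at hnd
    have := hnd.2.1
    rw [List.nodup_cons, List.nodup_cons] at this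
    exact ⟨fun e => this.1 (by rw [← e]; exact List.mem_cons_of_mem _ hz),
      fun e => this.2.1 (by rwa [← e])⟩
  have hc := h.chain
  rw [List.isChain_append_cons_cons, List.isChain_cons_cons] at hc
  obtain ⟨hc1, ⟨hc2, hc3⟩, ⟨hc4, hc5⟩, hc6⟩ := hc
  refine ⟨hnd.sublist (by simp), ?_, fun z hz => ?_⟩
  · rw [List.isChain_append_cons_cons]
    refine ⟨?_, ⟨by simp [hn], by simp [hn]⟩, ?_⟩
    · refine hc1.imp_of_mem_imp fun a b ha hb hab => ?_
      have e1 : a ≠ i := by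
        rintro rfl
        exact (hx b hb).1 (hab.1.symm.trans hc2)
      simp [hn, e1, (hx b hb).2, hab]
    · refine hc6.imp_of_mem_imp fun a b ha hb hab => ?_
      have e1 : b ≠ y := by
        rintro rfl
        exact (hy a ha).2 (hab.2.symm.trans hc5)
      simp [hn, e1, (hy a ha).1, hab]
  · have := ht z
    by_cases e : z = x
    · simpa [e, tokOf] using this
    · have h0 := h.dead z (by simp at hz ⊢; tauto)
      simpa [e, tokOf, h0] using this

/-- Two pairs disappear and one arises, which gives `1 + 1 + 2` new stack entries. -/
lemma wp_delC {Q : St → Prop} {s : St} {L R : List ℕ} {x y : ℕ} {ex : ℕ × ℕ} {T : ℕ}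
    (h : Full (L ++ s.v .ri :: x :: y :: R) ex T s.A) (hk : 23 ≤ s.k)
    (hQ : ∀ v' A', (∀ z, z ≠ .rx → z ≠ .ry → z ≠ .rp → z ≠ .rq → z ≠ .rr → v' z = s.v z) →
      Full (L ++ s.v .ri :: y :: R) ex (T + 4) A' → SameRest s.A A' →
      (∀ z, tokOf A' z = if z = x then 0 else tokOf s.A z) → Q ⟨v', A', s.k - 23⟩) :
    wp delC Q s := by
  obtain ⟨i, hi⟩ : ∃ i, s.v .ri = i := ⟨_, rfl⟩
  rw [hi] at h
  have hL := h.lnk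
  obtain ⟨n1, -⟩ := hL.split
  obtain ⟨n2, -⟩ := Lnk.split (L := L ++ [i]) (i := x) (j := y) (R := R) (A := s.A) (by simpa using hL)
  have hnd := hL.nodup
  obtain ⟨g, hg⟩ : ∃ g, tokOf s.A = g := ⟨_, rfl⟩
  have hg' : ∀ z, s.A .tok z 0 0 = g z := fun z => by rw [← hg]; rfl
  have hbag := h.bag
  rw [hg] at hbag
  simp only [delC, wp_seq_eq, wp_set, Exp.eval, St.setv, nextE, tokE, Function.update_apply, reduceCtorEq,
    if_false, if_true, n1, n2, hi, hg']
  refine ⟨by omega, by omega, by omega, by omega, by omega, ?_⟩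
  have b0 : Bag ((i, g i, g x) :: (x, g x, g y) :: (bg g (L ++ [i]) ++ bg g (y :: R))) ex T s.A :=
    hbag.perm (by
      rw [bg_append]
      simp only [bg]
      exact List.perm_middle.trans (List.perm_middle.cons _))
  refine wp_decC (M := (x, g x, g y) :: (bg g (L ++ [i]) ++ bg g (y :: R))) (i := i) (T := T)
    (ex := ex) (by simpa using b0) (by simp; omega) ?_
  intro A1 b1 f1
  refine wp_decC (M := bg g (L ++ [i]) ++ bg g (y :: R)) (i := x) (T := T + 1)
    (ex := ex) (by simpa using b1) (by simp; omega) ?_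
  intro A2 b2 f2
  simp only [wp_put, Exp.eval, St.putA]
  refine ⟨by omega, by omega, by omega, ?_⟩
  refine wp_incC (b2.congr (by simp [Arrays.upd_of_ne]) (by simp [Arrays.upd_of_ne])
    (by simp [Arrays.upd_of_ne]) (by simp [Arrays.upd_of_ne])) ?_ ?_
  · simp; omega
  intro A3 b3 f3
  have f : SamePairs s.A A2 := f1.trans f2
  have ht : A3 .tok = (A2.upd .tok x 0 0 0) .tok := by
    rw [f3 .tok (by simp) (by simp) (by simp) (by simp)]
    funext i j k
    simp [Arrays.upd]
  have ht' : ∀ z, tokOf A3 z = if z = x then 0 else g z := by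
    intro z
    rw [tokOf, ht, Arrays.upd, ← hg', f .tok (by simp) (by simp) (by simp) (by simp)]
    simp
  have hn : ∀ d z, A3 .nb d z 0 = if d = 1 ∧ z = y then i else if d = 0 ∧ z = i then y else
      s.A .nb d z 0 := by
    intro d z
    rw [f3 .nb (by simp) (by simp) (by simp) (by simp), ← f .nb (by simp) (by simp) (by simp) (by simp)]
    simp [Arrays.upd, hi]
  have hl := hL.del (A' := A3) (by rw [hg]; exact ht') hn
  dsimp only
  rw [show s.k - 1 - 1 - 1 - 1 - 1 - 4 - 4 - 1 - 1 - 1 - 7 = s.k - 23 by omega]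
  refine hQ _ A3 ?_ ⟨by rwa [hi], ?_⟩ ?_ (by rw [hg]; exact ht')
  · intro z h1 h2 h3 h4 h5
    simp [h1, h2, h3, h4, h5]
  · rw [hi]
    refine b3.perm ?_
    have hndx : ∀ z ∈ L ++ i :: y :: R, z ≠ x := by
      rintro z hz rfl
      have := hL.nodup
      rw [List.nodup_append, List.nodup_cons, List.nodup_cons] at this
      simp only [List.mem_append, List.mem_cons] at hz
      rcases hz with hz | rfl | hz
      · exact this.2.2 z hz z (by simp) rfl
      · exact this.2.1.1 (by simp)
      · exact this.2.1.2.1 (by simpa using hz)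
    rw [bg_congr (g := tokOf A3) (g' := g) fun z hz => by rw [ht' z, if_neg (hndx z hz)],
      bg_append g L i (y :: R)]
    simp only [bg, Function.update_apply, reduceCtorEq, if_false, if_true, hi]
    exact List.perm_middle.symm
  · intro id h1 h2 h3 h4 h5 h6
    rw [f3 id h1 h2 h3 h4, ← f id h1 h2 h3 h4]
    simp [Arrays.upd_of_ne h5, Arrays.upd_of_ne h6]

/-- Two pairs disappear and two arise, which gives `1 + 1 + 2 + 2` new stack entries. -/
lemma wp_retokC {Q : St → Prop} {s : St} {L R : List ℕ} {x y : ℕ} {ex : ℕ × ℕ} {T : ℕ}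
    (h : Full (L ++ x :: s.v .ri :: y :: R) ex T s.A) (hk : 28 ≤ s.k)
    (hQ : ∀ v' A', (∀ z, z ≠ .rx → z ≠ .ry → z ≠ .rp → z ≠ .rq → z ≠ .rr → v' z = s.v z) →
      Full (L ++ x :: s.v .ri :: y :: R) ex (T + 6) A' → SameRest s.A A' →
      (∀ z, tokOf A' z = if z = s.v .ri then s.v .rw else tokOf s.A z) → Q ⟨v', A', s.k - 28⟩) :
    wp retokC Q s := by
  obtain ⟨i, hi⟩ : ∃ i, s.v .ri = i := ⟨_, rfl⟩
  obtain ⟨u, hu⟩ : ∃ u, s.v .rw = u := ⟨_, rfl⟩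
  rw [hi] at h
  have hL := h.lnk
  obtain ⟨-, n1⟩ := hL.split
  obtain ⟨n2, -⟩ := Lnk.split (L := L ++ [x]) (i := i) (j := y) (R := R) (A := s.A) (by simpa using hL)
  have hnd := hL.nodup
  obtain ⟨g, hg⟩ : ∃ g, tokOf s.A = g := ⟨_, rfl⟩
  have hg' : ∀ z, s.A .tok z 0 0 = g z := fun z => by rw [← hg]; rfl
  have hbag := h.bag
  rw [hg] at hbag
  simp only [retokC, wp_seq_eq, wp_set, Exp.eval, St.setv, nextE, prevE, tokE, Function.update_apply,
    reduceCtorEq, if_false, if_true, n1, n2, hi, hg']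
  refine ⟨by omega, by omega, by omega, by omega, by omega, ?_⟩
  have b0 : Bag ((x, g x, g i) :: (i, g i, g y) :: (bg g (L ++ [x]) ++ bg g (y :: R))) ex T s.A :=
    hbag.perm (by
      rw [bg_append]
      simp only [bg]
      exact List.perm_middle.trans (List.perm_middle.cons _))
  refine wp_decC (M := (i, g i, g y) :: (bg g (L ++ [x]) ++ bg g (y :: R))) (i := x) (T := T)
    (ex := ex) (by simpa using b0) (by simp; omega) ?_
  intro A1 b1 f1
  refine wp_decC (M := bg g (L ++ [x]) ++ bg g (y :: R)) (i := i) (T := T + 1)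
    (ex := ex) (by simpa using b1) (by simp; omega) ?_
  intro A2 b2 f2
  simp only [wp_put, Exp.eval, St.putA]
  refine ⟨by omega, ?_⟩
  refine wp_incC (b2.congr (by simp [Arrays.upd_of_ne]) (by simp [Arrays.upd_of_ne])
    (by simp [Arrays.upd_of_ne]) (by simp [Arrays.upd_of_ne])) ?_ ?_
  · simp; omega
  intro A3 b3 f3
  refine wp_incC b3 ?_ ?_
  · simp; omega
  intro A4 b4 f4
  have f : SamePairs s.A A2 := f1.trans f2
  have f' := f3.trans f4
  have ht' : ∀ z, tokOf A4 z = if z = i then u else g z := by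
    intro z
    have e0 : A2 .tok = s.A .tok := f .tok (by simp) (by simp) (by simp) (by simp)
    rw [tokOf, f' .tok (by simp) (by simp) (by simp) (by simp)]
    simp [Arrays.upd, hi, hu, e0, hg']
  have hn : A4 .nb = s.A .nb := by
    rw [f' .nb (by simp) (by simp) (by simp) (by simp), ← f .nb (by simp) (by simp) (by simp) (by simp)]
    simp [Arrays.upd_of_ne]
  dsimp only
  rw [show s.k - 1 - 1 - 1 - 1 - 1 - 4 - 4 - 1 - 7 - 7 = s.k - 28 by omega]
  refine hQ _ A4 ?_ ⟨⟨?_, ?_, ?_⟩, ?_⟩ ?_ (by rw [hg, hi, hu]; exact ht')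
  · intro z h1 h2 h3 h4 h5
    simp [h1, h2, h3, h4, h5]
  · rwa [hi]
  · rw [hi, hn]; exact hL.chain
  · rw [hi]
    intro z hz
    have e : z ≠ i := by rintro rfl; simp at hz
    have := ht' z
    rw [if_neg e, ← hg'] at this
    exact this.trans (hL.dead z hz)
  · rw [hi]
    refine b4.perm ?_
    have hndx : ∀ z, (z ∈ L ++ [x] ∨ z ∈ y :: R) → z ≠ i := by
      rintro z hz rfl
      rw [show L ++ x :: z :: y :: R = (L ++ [x]) ++ z :: y :: R by simp, List.nodup_append,
        List.nodup_cons] at hnd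
      rcases hz with hz | hz
      · exact hnd.2.2 z hz z (by simp) rfl
      · exact hnd.2.1.1 hz
    have e1 : bg (tokOf A4) (L ++ [x]) = bg g (L ++ [x]) :=
      bg_congr fun z hz => by rw [ht' z, if_neg (hndx z (.inl hz))]
    have e2 : bg (tokOf A4) (y :: R) = bg g (y :: R) :=
      bg_congr fun z hz => by rw [ht' z, if_neg (hndx z (.inr hz))]
    rw [bg_append (tokOf A4) L x (i :: y :: R), e1]
    simp only [bg, Function.update_apply, reduceCtorEq, if_false, if_true, hi, hu]
    rw [e2, ht' x, ht' i, ht' y, if_neg (hndx x (by simp)), if_neg (hndx y (by simp)), if_pos rfl]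
    exact (List.perm_middle.trans (List.perm_middle.cons _) |>.trans (.swap _ _ _)).symm
  · intro id h1 h2 h3 h4 h5 h6
    rw [f' id h1 h2 h3 h4, ← f id h1 h2 h3 h4]
    simp [Arrays.upd_of_ne h5]

/-! ### Replacement of disjoint blocks of nodes -/

/-- `Q'` results from `Q` by reducing, for every node `i ∈ D`, the block of `bl i` nodes from `i` on
to the node `i`. -/
inductive Rep (D : Set ℕ) (bl : ℕ → ℕ) : List ℕ → List ℕ → Prop
  | nil : Rep D bl [] []
  | keep {i : ℕ} {A A' : List ℕ} : i ∉ D → Rep D bl A A' → Rep D bl (i :: A) (i :: A')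
  | hit {i : ℕ} {B A A' : List ℕ} : i ∈ D → B.length + 1 = bl i → Rep D bl A A' →
      Rep D bl (i :: (B ++ A)) (i :: A')

/-- The blocks of `bl i` nodes from `i` on, for `i ∈ S`, are disjoint. -/
def Blocks (S : Set ℕ) (bl : ℕ → ℕ) : List ℕ → Prop
  | [] => True
  | i :: R => (i ∈ S → bl i ≤ R.length + 1 ∧ ∀ b ∈ R.take (bl i - 1), b ∉ S) ∧ Blocks S bl R

lemma Blocks.of_append {S : Set ℕ} {bl : ℕ → ℕ} {A B : List ℕ} (h : Blocks S bl (A ++ B)) :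
    Blocks S bl B := by
  induction A with
  | nil => exact h
  | cons a A ih => exact ih h.2

lemma Blocks.intro {S : Set ℕ} {bl : ℕ → ℕ} {Q : List ℕ}
    (h : ∀ A i R, Q = A ++ i :: R → i ∈ S → bl i ≤ R.length + 1 ∧ ∀ b ∈ R.take (bl i - 1), b ∉ S) :
    Blocks S bl Q := by
  induction Q with
  | nil => trivial
  | cons i R ih => exact ⟨h [] i R rfl, ih fun A j R' e => h (i :: A) j R' (by rw [e]; rfl)⟩

lemma Rep.refl (bl : ℕ → ℕ) (Q : List ℕ) : Rep ∅ bl Q Q := by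
  induction Q with
  | nil => exact .nil
  | cons i Q ih => exact .keep (by simp) ih

lemma Rep.append_left {D : Set ℕ} {bl : ℕ → ℕ} {B A Q : List ℕ} (h : Rep D bl (B ++ A) Q)
    (hB : ∀ b ∈ B, b ∉ D) : ∃ A', Q = B ++ A' ∧ Rep D bl A A' := by
  induction B generalizing Q with
  | nil => exact ⟨Q, rfl, h⟩
  | cons b B ih =>
    rw [List.cons_append] at h
    have hb := hB b (by simp)
    generalize hQ : b :: (B ++ A) = Q₀ at h
    cases h with
    | nil => simp at hQ
    | keep _ h =>
      simp only [List.cons.injEq] at hQ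
      obtain ⟨rfl, rfl⟩ := hQ
      obtain ⟨A', rfl, h'⟩ := ih h fun b hb => hB b (List.mem_cons_of_mem _ hb)
      exact ⟨A', rfl, h'⟩
    | hit hi =>
      simp only [List.cons.injEq] at hQ
      exact absurd (hQ.1 ▸ hi) hb

lemma Rep.insert_of_notMem {D : Set ℕ} {bl : ℕ → ℕ} {A A' : List ℕ} {i : ℕ} (h : Rep D bl A A')
    (hi : i ∉ A) : Rep (insert i D) bl A A' := by
  induction h with
  | nil => exact .nil
  | keep hj _ ih =>
    simp only [List.mem_cons, not_or] at hi
    exact .keep (by simp [hj, Ne.symm hi.1]) (ih hi.2)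
  | hit hj hB _ ih =>
    simp only [List.mem_cons, List.mem_append, not_or] at hi
    exact .hit (Set.mem_insert_of_mem _ hj) hB (ih hi.2.2)

/-- Blocks are processed in arbitrary order. As they are disjoint, a block that is still to be
replaced lies intact and contiguous in the current list. -/
lemma Rep.insert {D S : Set ℕ} {bl : ℕ → ℕ} {Q Q' : List ℕ} {i : ℕ} (h : Rep D bl Q Q')
    (hD : D ⊆ S) (hb : Blocks S bl Q) (hnd : Q.Nodup) (hiS : i ∈ S) (hiD : i ∉ D) (hiQ : i ∈ Q)
    (hbl : 1 ≤ bl i) :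
    ∃ A B C, Q' = A ++ i :: (B ++ C) ∧ B.length + 1 = bl i ∧ (∀ b ∈ B, b ∉ S) ∧
      Rep (insert i D) bl Q (A ++ i :: C) := by
  induction h with
  | nil => simp at hiQ
  | @keep j A A' hj h ih =>
    rw [List.nodup_cons] at hnd
    by_cases e : j = i
    · subst e
      obtain ⟨h1, h2⟩ := hb.1 hiS
      have hA := List.take_append_drop (bl j - 1) A
      rw [← hA] at h
      obtain ⟨A1, rfl, h3⟩ := h.append_left fun b hb hbD => h2 b hb (hD hbD)
      refine ⟨[], A.take (bl j - 1), A1, rfl, by simp; omega, h2, ?_⟩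
      have := Rep.hit (D := Insert.insert j D) (Set.mem_insert _ _) (B := A.take (bl j - 1))
        (by simp; omega) (h3.insert_of_notMem (i := j) fun hm => hnd.1 (List.mem_of_mem_drop hm))
      rwa [hA] at this
    · obtain ⟨A1, B, C, rfl, h1, h2, h3⟩ := ih hb.2 hnd.2 (by simpa [Ne.symm e] using hiQ)
      exact ⟨j :: A1, B, C, rfl, h1, h2, .keep (by simp [hj, e]) h3⟩
  | @hit j B A A' hj hB h ih =>
    have hne : i ≠ j := by rintro rfl; exact hiD hj
    have h1 := (hb.1 (hD hj)).2
    rw [show bl j - 1 = B.length by omega, List.take_left'  rfl] at h1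
    have hiA : i ∈ A := by
      simp only [List.mem_cons, List.mem_append, hne, false_or] at hiQ
      exact hiQ.resolve_left fun hm => h1 i hm hiS
    rw [List.nodup_cons, List.nodup_append] at hnd
    obtain ⟨A1, B1, C, rfl, h2, h3, h4⟩ := ih hb.2.of_append hnd.2.2.1 hiA
    exact ⟨j :: A1, B1, C, rfl, h2, h3, .hit (Set.mem_insert_of_mem _ hj) hB h4⟩

lemma Rep.subset {D : Set ℕ} {bl : ℕ → ℕ} {Q Q' : List ℕ} (h : Rep D bl Q Q') : Q' ⊆ Q := by
  induction h with
  | nil => simp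
  | keep _ _ ih => exact List.cons_subset_cons _ ih
  | hit _ _ _ ih =>
    exact List.cons_subset_cons _ (List.Subset.trans ih (List.subset_append_right _ _))

/-! ### The replacement loop -/

/-- For `j < m2`, replace the block of `F 1 j` nodes from `F 0 j` on by a node with symbol
`F 2 j`. -/
def replaceC : Cmd :=
  .seq (.set .rj (.lit 0)) <|
  .loop (.lt (.var .rj) (.var .rm2)) <|
    .seq (.set .ri (.get .F (.lit 0) (.var .rj) (.lit 0))) <|
    .seq (.set .rl (.get .F (.lit 1) (.var .rj) (.lit 0))) <|
    .seq (.set .rw (.get .F (.lit 2) (.var .rj) (.lit 0))) <|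
    .seq (.loop (.lt (.lit 1) (.var .rl)) <| .seq delC (.set .rl (.pred (.var .rl)))) <|
    .seq retokC <| .set .rj (.inc (.var .rj))

lemma ite_one_ne_zero {p : Prop} [Decidable p] : (if p then 1 else 0) ≠ 0 ↔ p := by
  split <;> simp_all

lemma ite_one_eq_zero {p : Prop} [Decidable p] : (if p then 1 else 0) = 0 ↔ ¬ p := by
  split <;> simp_all

lemma wp_delLoop {s : St} {L B R : List ℕ} {y : ℕ} {ex : ℕ × ℕ} {T : ℕ}
    (h : Full (L ++ s.v .ri :: (B ++ y :: R)) ex T s.A) (hl : s.v .rl = B.length + 1)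
    (hk : 25 * B.length + 1 ≤ s.k) :
    wp (.loop (.lt (.lit 1) (.var .rl)) <| .seq delC (.set .rl (.pred (.var .rl))))
      (fun s' => Full (L ++ s.v .ri :: y :: R) ex (T + 4 * B.length) s'.A ∧
        s.k = s'.k + 25 * B.length + 1 ∧ ∀ z ∉ B, tokOf s'.A z = tokOf s.A z) s := by
  refine wp_while (fun s' => ∃ B', B' <:+ B ∧ s'.v .rl = B'.length + 1 ∧
    Full (L ++ s.v .ri :: (B' ++ y :: R)) ex (T + 4 * (B.length - B'.length)) s'.A ∧
    s.k + 25 * B'.length = s'.k + 25 * B.length ∧ ∀ z ∉ B, tokOf s'.A z = tokOf s.A z)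
    ⟨B, List.suffix_refl _, hl, by simpa using h, by omega, fun _ _ => rfl⟩ ?_ ?_ ?_
  · rintro s' ⟨B', hB, h1, h2, h3, h4⟩ _
    omega
  · rintro s' ⟨B', hB, h1, h2, h3, h4⟩ hfr he
    simp only [Exp.eval, ite_one_ne_zero, h1] at he
    have hi : s'.v .ri = s.v .ri := hfr.v _ rfl
    have hlen := hB.length_le
    obtain - | ⟨x, B'⟩ := B'
    · simp at he
    simp only [List.length_cons] at h1 h2 h3 hlen
    rw [wp_seq]
    obtain ⟨y', R', hy⟩ : ∃ y' R', B' ++ y :: R = y' :: R' := by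
      cases B' with
      | nil => exact ⟨_, _, rfl⟩
      | cons a B' => exact ⟨_, _, rfl⟩
    refine wp_delC (L := L) (x := x) (y := y') (R := R') (ex := ex)
      (T := T + 4 * (B.length - (B'.length + 1))) ?_ ?_ ?_
    · simpa [St.tick, hi, ← hy] using h2
    · simp only [St.tick]; omega
    · intro v' A' hv hF hrest htok
      simp only [wp_set, Exp.eval, St.setv, St.tick] at hv hF htok ⊢
      have hx : x ∈ B := hB.subset (by simp)
      refine ⟨by omega, B', (List.suffix_cons _ _).trans hB, ?_, ?_, by omega, ?_⟩
      · rw [Function.update_self, hv .rl (by simp) (by simp) (by simp) (by simp) (by simp), h1]; omega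
      · rw [hi, ← hy] at hF
        convert hF using 1
        omega
      · intro z hz
        rw [htok, if_neg (by rintro rfl; exact hz hx), h4 z hz]
  · rintro s' ⟨B', hB, h1, h2, h3, h4⟩ hfr he
    simp only [Exp.eval, ite_one_eq_zero, h1] at he
    have : B' = [] := List.eq_nil_of_length_eq_zero (by omega)
    subst this
    simp only [List.length_nil] at h1 h2 h3
    have := hfr.k
    exact ⟨by simpa [St.tick] using h2, by simp only [St.tick]; omega, h4⟩

/-- A block of length at least two deletes at least one node. That node absorbs the costs per block:
`4` stack entries per deletion plus `6` for the new symbol make at most `10` per deleted node, and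
`25` credits per deletion plus `34` per block at most `60`. -/
lemma wp_replaceC {s : St} {Q : List ℕ} {z e : ℕ} {ex : ℕ × ℕ} {T m : ℕ} {S : Set ℕ}
    {bl nm F : ℕ → ℕ} (h : Full (z :: (Q ++ [e])) ex T s.A) (hm : s.v .rm2 = m)
    (h0 : ∀ j < m, s.A .F 0 j 0 = F j) (h1 : ∀ j < m, s.A .F 1 j 0 = bl (F j))
    (h2 : ∀ j < m, s.A .F 2 j 0 = nm (F j)) (hS : ∀ i, i ∈ S ↔ ∃ j < m, F j = i)
    (hinj : ∀ j < m, ∀ j' < m, F j = F j' → j = j') (hSQ : ∀ i ∈ S, i ∈ Q)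
    (hb : Blocks S bl Q) (hbl : ∀ i ∈ S, 2 ≤ bl i) (hk : 60 * Q.length + 2 ≤ s.k) :
    wp replaceC (fun s' => ∃ Q' T', Rep S bl Q Q' ∧ Full (z :: (Q' ++ [e])) ex T' s'.A ∧
      T' + 10 * Q'.length ≤ T + 10 * Q.length ∧ s.k + 60 * Q'.length ≤ s'.k + 60 * Q.length + 2 ∧
      (∀ i ∈ Q', (i ∈ S → tokOf s'.A i = nm i) ∧ (i ∉ S → tokOf s'.A i = tokOf s.A i)) ∧
      (∀ i ∉ Q, tokOf s'.A i = tokOf s.A i) ∧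
      Q'.length + ∑ j ∈ Finset.range m, (bl (F j) - 1) = Q.length) s := by
  have hnd : Q.Nodup := by
    have := h.lnk.nodup
    rw [List.nodup_cons, List.nodup_append] at this
    exact this.2.1
  simp only [replaceC, wp_seq_eq, wp_set, Exp.eval, St.setv]
  refine ⟨by omega, ?_⟩
  refine wp_while (fun s' => ∃ Q' T', s'.v .rj ≤ m ∧ Rep {i | ∃ j < s'.v .rj, F j = i} bl Q Q' ∧
      Full (z :: (Q' ++ [e])) ex T' s'.A ∧
      T' + 10 * Q'.length ≤ T + 10 * Q.length ∧ s.k + 60 * Q'.length ≤ s'.k + 60 * Q.length + 1 ∧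
      (∀ i ∈ Q', ((∃ j < s'.v .rj, F j = i) → tokOf s'.A i = nm i) ∧
        ((¬ ∃ j < s'.v .rj, F j = i) → tokOf s'.A i = tokOf s.A i)) ∧
      (∀ i ∉ Q, tokOf s'.A i = tokOf s.A i) ∧
      Q'.length + ∑ j ∈ Finset.range (s'.v .rj), (bl (F j) - 1) = Q.length) ?_ ?_ ?_ ?_
  · refine ⟨Q, T, by simp, by simpa using Rep.refl bl Q, h, le_rfl, by dsimp only; omega, ?_,
      fun _ _ => rfl, by simp⟩
    simp
  · rintro s' ⟨Q', T', -, -, -, -, h, -, -, -⟩ _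
    omega
  · rintro s' ⟨Q', T', g1, g2, g3, g4, g5, g6, g8, g7⟩ hfr he
    have hm2 : s'.v .rm2 = m := (hfr.v .rm2 rfl).trans (by simpa using hm)
    have hFA : s'.A .F = s.A .F := hfr.A .F rfl
    simp only [Exp.eval, ite_one_ne_zero, hm2] at he
    obtain ⟨j, hj⟩ : ∃ j, s'.v .rj = j := ⟨_, rfl⟩
    rw [hj] at he g1 g2 g6 g7
    have hjS : F j ∈ S := (hS _).2 ⟨j, he, rfl⟩
    obtain ⟨A, B, C, rfl, hB, hBS, hrep⟩ := g2.insert (S := S) (i := F j)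
      (fun i ⟨j', hj', e⟩ => (hS i).2 ⟨j', by omega, e⟩) hb hnd hjS
      (fun ⟨j', hj', e⟩ => by have := hinj _ (by omega) _ he e; omega) (hSQ _ hjS)
      (by have := hbl _ hjS; omega)
    have hbl' := hbl _ hjS
    simp only [List.length_append, List.length_cons] at g4 g5 g7
    obtain ⟨y, R, hy⟩ : ∃ y R, C ++ [e] = y :: R := by
      cases C with
      | nil => exact ⟨_, _, rfl⟩
      | cons a C => exact ⟨_, _, rfl⟩
    simp only [wp_seq_eq, wp_set, Exp.eval, St.setv, St.tick, Function.update_apply, reduceCtorEq,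
      if_false, hFA, hj, h0 j he, h1 j he, h2 j he]
    refine ⟨by omega, by omega, by omega, ?_⟩
    obtain ⟨s1, hs1⟩ : ∃ s1 : St, s1 = ⟨Function.update (Function.update (Function.update s'.v .ri (F j))
      .rl (bl (F j))) .rw (nm (F j)), s'.A, s'.k - 1 - 1 - 1 - 1⟩ := ⟨_, rfl⟩
    rw [← hs1]
    have e1 : s1.v .ri = F j := by simp [hs1]
    have e2 : s1.v .rl = bl (F j) := by simp [hs1]
    have e3 : s1.v .rw = nm (F j) := by simp [hs1]
    have e4 : s1.A = s'.A := by rw [hs1]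
    have e5 : s1.k = s'.k - 4 := by rw [hs1]; simp [Nat.sub_sub]
    have e6 : s1.v .rj = j := by simp [hs1, hj]
    clear hs1
    refine (wp_delLoop (s := s1) (L := z :: A) (B := B) (R := R) (y := y) (ex := ex) (T := T')
      (by rw [e1, e4]; simpa [← hy] using g3) (by omega) (by omega)).fr.mono ?_
    rintro s2 ⟨⟨f1, f2, f3⟩, fr2⟩
    have i2 : s2.v .ri = F j := (fr2.v _ rfl).trans e1
    have w2 : s2.v .rw = nm (F j) := (fr2.v _ rfl).trans e3
    have j2 : s2.v .rj = j := (fr2.v _ rfl).trans e6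
    rw [e1] at f1
    have hA : ∃ L' x, z :: A = L' ++ [x] := by
      obtain h | h := List.eq_nil_or_concat (z :: A)
      · simp at h
      · simpa using h
    obtain ⟨L', x, hx⟩ := hA
    refine wp_retokC (L := L') (x := x) (y := y) (R := R) (ex := ex) (T := T' + 4 * B.length)
      ?_ (by omega) ?_
    · rw [i2]
      have : L' ++ x :: F j :: y :: R = z :: A ++ F j :: y :: R := by rw [hx]; simp
      rwa [this]
    intro v' A' hv hF _ htok
    rw [i2, w2] at htok
    simp only [wp_set, Exp.eval, St.setv, Function.update_self]
    have hj' : v' .rj = j := (hv .rj (by simp) (by simp) (by simp) (by simp) (by simp)).trans j2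
    rw [hj']
    have hset : {i | ∃ j' < j + 1, F j' = i} = Insert.insert (F j) {i | ∃ j' < j, F j' = i} := by
      ext i
      simp only [Set.mem_ofPred_eq, Set.mem_insert_iff, Nat.lt_succ_iff_lt_or_eq]
      constructor
      · rintro ⟨j', h | rfl, rfl⟩
        · exact .inr ⟨j', h, rfl⟩
        · exact .inl rfl
      · rintro (rfl | ⟨j', h, rfl⟩)
        · exact ⟨j, .inr rfl, rfl⟩
        · exact ⟨j', .inl h, rfl⟩
    refine ⟨by omega, A ++ F j :: C, T' + 4 * B.length + 6, by omega, ?_, ?_, ?_, ?_, ?_, ?_, ?_⟩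
    · rw [hset]; exact hrep
    · rw [i2] at hF
      have : z :: (A ++ F j :: C ++ [e]) = L' ++ x :: F j :: y :: R := by
        have : L' ++ x :: F j :: y :: R = z :: A ++ F j :: y :: R := by rw [hx]; simp
        rw [this, ← hy]; simp
      rwa [this]
    · simp only [List.length_append, List.length_cons]; omega
    · simp only [List.length_append, List.length_cons]; omega
    · have hnd' := g3.lnk.nodup
      rw [List.nodup_cons, List.nodup_append, List.nodup_append] at hnd'
      have hnd'' := hnd'.2.1.2.1
      intro i hi
      have hi' : i ∈ A ++ F j :: (B ++ C) := by
        simp only [List.mem_append, List.mem_cons] at hi ⊢; tauto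
      have hiB : i ∉ B := by
        intro hiB
        rw [List.nodup_cons, List.nodup_append] at hnd''
        simp only [List.mem_append, List.mem_cons] at hi
        rcases hi with hi | rfl | hi
        · exact hnd'.2.1.2.2 i hi i (by simp [hiB]) rfl
        · exact hnd''.1 (by simp [hiB])
        · exact hnd''.2.2.2 i hiB i hi rfl
      have hij : (∃ j' < j + 1, F j' = i) ↔ i = F j ∨ ∃ j' < j, F j' = i := by
        have := Set.ext_iff.1 hset i
        simpa using this
      rw [htok, hij, f3 i hiB, e4]
      by_cases hie : i = F j
      · subst hie; simp
      · simpa [hie] using g6 i hi'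
    · intro i hi
      rw [htok, if_neg (by rintro rfl; exact hi (hSQ _ hjS)), f3 i, e4, g8 i hi]
      exact fun hiB => hi (g2.subset (by simp [hiB]))
    · rw [Finset.sum_range_succ]
      simp only [List.length_append, List.length_cons]; omega
  · rintro s' ⟨Q', T', g1, g2, g3, g4, g5, g6, g8, g7⟩ hfr he
    have hm2 : s'.v .rm2 = m := (hfr.v .rm2 rfl).trans (by simpa using hm)
    simp only [Exp.eval, ite_one_eq_zero, hm2] at he
    have hj : s'.v .rj = m := by omega
    rw [hj] at g2 g6 g7
    simp only [← hS] at g2 g6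
    exact ⟨Q', T', by simpa using g2, g3, g4, by simp only [St.tick]; omega, g6, g8, g7⟩

/-! ### Collecting the occurrences of a pair -/

lemma tot_pop {A : Arrays} {x y l T : ℕ} (h : ∀ F : Finset (ℕ × ℕ), ∑ p ∈ F, A .slen p.1 p.2 0 ≤ T)
    (hl : A .slen x y 0 = l + 1) : 1 ≤ T ∧
    ∀ F : Finset (ℕ × ℕ), ∑ p ∈ F, A.upd .slen x y 0 l .slen p.1 p.2 0 ≤ T - 1 := by
  have key : ∀ F : Finset (ℕ × ℕ), ∑ p ∈ F, A.upd .slen x y 0 l .slen p.1 p.2 0 + 1 ≤ T := by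
    intro F
    -- Adjoining `(x, y)` makes the removed entry count even when `F` misses its stack.
    refine le_trans ?_ (h (insert (x, y) F))
    have e : ∑ p ∈ insert (x, y) F, A .slen p.1 p.2 0 =
        ∑ p ∈ insert (x, y) F, A.upd .slen x y 0 l .slen p.1 p.2 0 + 1 := by
      have e' : ∀ z : ℕ × ℕ, A .slen z.1 z.2 0 =
          A.upd .slen x y 0 l .slen z.1 z.2 0 + if z = (x, y) then 1 else 0 := by
        intro z
        by_cases hz : z = (x, y)
        · subst hz; simp [Arrays.upd, hl]
        · have : ¬ (z.1 = x ∧ z.2 = y) := fun h => hz (Prod.ext h.1 h.2)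
          simp [Arrays.upd, hz, this]
      rw [Finset.sum_congr rfl fun z _ => e' z, Finset.sum_add_distrib, Finset.sum_ite_eq']
      simp
    rw [e]
    exact Nat.add_le_add_right (Finset.sum_le_sum_of_subset (Finset.subset_insert _ _)) 1
  have := key ∅
  simp at this
  exact ⟨this, fun F => by have := key F; omega⟩

lemma Has.pop {A : Arrays} {x y l p q x' y' : ℕ} (h : Has A x' y' p q) (hl : A .slen x y 0 = l + 1)
    (hne : ¬ (x' = x ∧ y' = y ∧ A .st1 x y l = p ∧ A .st2 x y l = q)) :
    Has (A.upd .slen x y 0 l) x' y' p q := by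
  obtain ⟨j, h1, h2, h3⟩ := h
  refine ⟨j, ?_, by simpa [Arrays.upd] using h2, by simpa [Arrays.upd] using h3⟩
  by_cases e : x' = x ∧ y' = y
  · obtain ⟨rfl, rfl⟩ := e
    have : j ≠ l := by rintro rfl; exact hne ⟨rfl, rfl, h2, h3⟩
    simp [Arrays.upd]; omega
  · simpa [Arrays.upd, e] using h1

/-- The occurrences of the exceptional pair need not stay recorded, so its stack may be popped
freely. -/
lemma Bag.pop_occ {M : List (ℕ × ℕ × ℕ)} {a b T l : ℕ} {A : Arrays} (h : Bag M (a, b) T A)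
    (hl : A .slen (a + 1) b 0 = l + 1) :
    1 ≤ T ∧ Bag M (a, b) (T - 1) (A.upd .slen (a + 1) b 0 l) := by
  obtain ⟨h1, h2⟩ := tot_pop h.tot hl
  refine ⟨h1, ⟨h.cnt, fun t ht h0 hx => (h.occ t ht h0 hx).pop hl ?_, fun a' b' hc =>
    (h.bucket a' b' hc).pop hl (by simp), h2⟩⟩
  rintro ⟨e1, e2, -⟩
  exact hx (Prod.ext (by simpa using e1) e2)

/-- An entry whose pair has another frequency by now is outdated and may be dropped. -/
lemma Bag.pop_bucket {M : List (ℕ × ℕ × ℕ)} {ex : ℕ × ℕ} {T l f : ℕ} {A : Arrays} (h : Bag M ex T A)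
    (hl : A .slen 0 f 0 = l + 1) (hne : A .cnt (A .st1 0 f l) (A .st2 0 f l) 0 ≠ f) :
    1 ≤ T ∧ Bag M ex (T - 1) (A.upd .slen 0 f 0 l) := by
  obtain ⟨h1, h2⟩ := tot_pop h.tot hl
  refine ⟨h1, ⟨h.cnt, fun t ht h0 hx => (h.occ t ht h0 hx).pop hl (by simp), fun a' b' hc =>
    (h.bucket a' b' hc).pop hl ?_, h2⟩⟩
  rintro ⟨-, e1, e2, e3⟩
  rw [e2, e3] at hne
  exact hne e1

lemma Lnk.congr {P : List ℕ} {A A' : Arrays} (h : Lnk P A) (h1 : A' .nb = A .nb)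
    (h2 : A' .tok = A .tok) : Lnk P A' :=
  ⟨h.nodup, by rw [h1]; exact h.chain, by rw [h2]; exact h.dead⟩

lemma Full.congr {P : List ℕ} {ex : ℕ × ℕ} {T : ℕ} {A A' : Arrays} (h : Full P ex T A)
    (h1 : A' .cnt = A .cnt) (h2 : A' .slen = A .slen) (h3 : A' .st1 = A .st1)
    (h4 : A' .st2 = A .st2) (h5 : A' .nb = A .nb) (h6 : A' .tok = A .tok) : Full P ex T A' := by
  have : tokOf A' = tokOf A := by funext i; rw [tokOf, h6, tokOf]
  exact ⟨h.lnk.congr h5 h6, by rw [this]; exact h.bag.congr h1 h2 h3 h4⟩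

/-- The exception `(0, 0)` is void, since occurrences of pairs starting with `0` are not tracked
anyway. -/
lemma Full.except {P : List ℕ} {T : ℕ} {A : Arrays} (h : Full P (0, 0) T A) (ex : ℕ × ℕ) :
    Full P ex T A :=
  ⟨h.lnk, h.bag.cnt, fun t ht h0 _ => h.bag.occ t ht h0 fun e => h0 (by rw [e]), h.bag.bucket,
    h.bag.tot⟩

/-- The occurrences of a pair that does not occur need not be known. -/
lemma Full.unexcept {P : List ℕ} {T a b : ℕ} {A : Arrays} (h : Full P (a, b) T A)
    (h0 : occ (P.map (tokOf A)) [a, b] = 0) : Full P (0, 0) T A := by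
  refine ⟨h.lnk, h.bag.cnt, fun t ht h1 _ => h.bag.occ t ht h1 fun e => ?_, h.bag.bucket,
    h.bag.tot⟩
  rw [← countP_bg, List.countP_eq_zero] at h0
  exact h0 t ht (by simpa using e)

/-- The constant-time test of a stack entry: two symbols decide, because deleted nodes and the last
node carry `0 ≠ a`. -/
lemma Lnk.mem_bg {P : List ℕ} {A : Arrays} (h : Lnk P A) {a b i : ℕ} (ha : a ≠ 0)
    (hlast : ∀ i, P.getLast? = some i → tokOf A i = 0) :
    (i, a, b) ∈ bg (tokOf A) P ↔ tokOf A i = a ∧ tokOf A (A .nb 0 i 0) = b := by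
  rw [RLMRRePair.mem_bg]
  constructor
  · rintro ⟨p, i', j, h1, h2, e⟩
    simp only [Prod.mk.injEq] at e
    obtain ⟨rfl, rfl, rfl⟩ := e
    exact ⟨rfl, by rw [(h.next h1 h2).1]⟩
  · rintro ⟨rfl, rfl⟩
    have hi : i ∈ P := by
      by_contra hi
      exact ha (h.dead i hi)
    obtain ⟨p, hp, rfl⟩ := List.mem_iff_getElem.1 hi
    have hp1 : p + 1 < P.length := by
      by_contra hc
      refine ha (hlast _ ?_)
      rw [List.getLast?_eq_getElem?, List.getElem?_eq_getElem (by omega)]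
      congr 2; omega
    have h1 : P[p]? = some P[p] := List.getElem?_eq_getElem hp
    have h2 : P[p + 1]? = some P[p + 1] := List.getElem?_eq_getElem hp1
    exact ⟨p, _, _, h1, h2, by rw [(h.next h1 h2).1]⟩

/-- Collect the occurrences of `(a, b)`: the `m` pairs of nodes `E 1 j`, `E 0 j`. -/
def collectC : Cmd :=
  .seq (.set .rm (.lit 0)) <|
  .loop (.get .slen (.inc (.var .ra)) (.var .rb) (.lit 0)) <|
    .seq (.put .slen (.inc (.var .ra)) (.var .rb) (.lit 0)
      (.pred (.get .slen (.inc (.var .ra)) (.var .rb) (.lit 0)))) <|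
    .seq (.set .ri (.get .st1 (.inc (.var .ra)) (.var .rb)
      (.get .slen (.inc (.var .ra)) (.var .rb) (.lit 0)))) <|
    .ite (.eq (tokE (.var .ri)) (.var .ra))
      (.ite (.eq (tokE (nextE (.var .ri))) (.var .rb))
        (.ite (.eq (.get .mark (.var .ri) (.lit 0) (.lit 0)) (.var .rnv)) .skip
          (.seq (.put .mark (.var .ri) (.lit 0) (.lit 0) (.var .rnv)) <|
           .seq (.put .E (.lit 1) (.var .rm) (.lit 0) (.var .ri)) <|
           .seq (.put .E (.lit 0) (.var .rm) (.lit 0) (nextE (.var .ri))) <|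
           .set .rm (.inc (.var .rm)))) .skip) .skip

/-- A node may be on the stack several times. The next fresh variable serves as a stamp of the
round, so duplicates are recognized and marks need no clearing. Each iteration pops an entry and is
paid for by the decrease of `T`. -/
lemma wp_collectC {s : St} {P : List ℕ} {T a b : ℕ} (h : Full P (0, 0) T s.A) (ha : s.v .ra = a)
    (hb : s.v .rb = b) (ha0 : a ≠ 0) (hlast : ∀ i, P.getLast? = some i → tokOf s.A i = 0)
    (hmark : ∀ i, s.A .mark i 0 0 < s.v .rnv)
    (hk : 10 * T + 2 ≤ s.k) :
    wp collectC (fun s' => ∃ T', Full P (a, b) T' s'.A ∧ s.k + 10 * T' ≤ s'.k + 10 * T + 2 ∧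
      (∀ i, (i, a, b) ∈ bg (tokOf s.A) P ↔ ∃ j < s'.v .rm, s'.A .E 1 j 0 = i) ∧
      (∀ j < s'.v .rm, ∀ j' < s'.v .rm, s'.A .E 1 j 0 = s'.A .E 1 j' 0 → j = j') ∧
      (∀ j < s'.v .rm, s'.A .E 0 j 0 = s.A .nb 0 (s'.A .E 1 j 0) 0) ∧
      (∀ i, s'.A .mark i 0 0 ≤ s.v .rnv)) s := by
  simp only [collectC, wp_seq_eq, wp_set, Exp.eval, St.setv]
  refine ⟨by omega, ?_⟩
  -- Every occurrence is still on the stack or already noted, and exactly the noted nodes bear the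
  -- current stamp.
  obtain ⟨I, hI⟩ : ∃ I : St → Prop, I = fun s' => ∃ T', Full P (a, b) T' s'.A ∧ s.k + 10 * T' ≤ s'.k + 10 * T + 1 ∧
        (∀ i, (i, a, b) ∈ bg (tokOf s.A) P → Has s'.A (a + 1) b i 0 ∨
          ∃ j < s'.v .rm, s'.A .E 1 j 0 = i) ∧
        (∀ j < s'.v .rm, (s'.A .E 1 j 0, a, b) ∈ bg (tokOf s.A) P) ∧
        (∀ j < s'.v .rm, ∀ j' < s'.v .rm, s'.A .E 1 j 0 = s'.A .E 1 j' 0 → j = j') ∧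
        (∀ j < s'.v .rm, s'.A .E 0 j 0 = s.A .nb 0 (s'.A .E 1 j 0) 0) ∧
        (∀ i, s'.A .mark i 0 0 ≤ s.v .rnv) ∧
        (∀ i, s'.A .mark i 0 0 = s.v .rnv ↔ ∃ j < s'.v .rm, s'.A .E 1 j 0 = i) := ⟨_, rfl⟩
  refine wp_while I ?_ ?_ ?_ ?_
  · rw [hI]
    refine ⟨T, h.except _, by dsimp only; omega, fun i hi => .inl ?_, by simp, by simp, by simp,
      fun i => (hmark i).le, fun i => ?_⟩
    · exact h.bag.occ _ hi ha0 fun e => ha0 (by simpa using congrArg Prod.fst e)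
    · have := hmark i
      simp; omega
  · intro s' hs' _
    rw [hI] at hs'
    obtain ⟨T', h1, h2, -⟩ := hs'
    omega
  · intro s' hs' hfr he
    rw [hI] at hs'
    obtain ⟨T', h1, h2, h3, h4, h5, h6, h7, h8⟩ := hs'
    have ea : s'.v .ra = a := (hfr.v .ra rfl).trans (by simpa using ha)
    have eb : s'.v .rb = b := (hfr.v .rb rfl).trans (by simpa using hb)
    have env : s'.v .rnv = s.v .rnv := (hfr.v .rnv rfl).trans (by simp)
    have etok : s'.A .tok = s.A .tok := hfr.A .tok rfl
    have enb : s'.A .nb = s.A .nb := hfr.A .nb rfl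
    simp only [Exp.eval, ea, eb] at he
    obtain ⟨l, hl⟩ : ∃ l, s'.A .slen (a + 1) b 0 = l + 1 := ⟨_, (Nat.succ_pred he).symm⟩
    obtain ⟨hT, hbag⟩ := h1.bag.pop_occ hl
    obtain ⟨i, hi⟩ : ∃ i, s'.A .st1 (a + 1) b l = i := ⟨_, rfl⟩
    have hF : ∀ A' : Arrays, A' .cnt = s'.A .cnt → A' .slen = (s'.A.upd .slen (a + 1) b 0 l) .slen →
        A' .st1 = s'.A .st1 → A' .st2 = s'.A .st2 → A' .nb = s'.A .nb → A' .tok = s'.A .tok →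
        Full P (a, b) (T' - 1) A' := fun A' e1 e2 e3 e4 e5 e6 =>
      Full.congr (A := s'.A.upd .slen (a + 1) b 0 l) ⟨h1.lnk.congr (by simp [Arrays.upd_of_ne])
        (by simp [Arrays.upd_of_ne]), hbag⟩ e1 e2 e3 e4 e5 e6
    have hHas : ∀ {A' : Arrays} {i' : ℕ}, Has s'.A (a + 1) b i' 0 → i' ≠ i →
        A' .slen = (s'.A.upd .slen (a + 1) b 0 l) .slen →
        A' .st1 = s'.A .st1 → A' .st2 = s'.A .st2 → Has A' (a + 1) b i' 0 := by
      intro A' i' hH hne e1 e2 e3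
      obtain ⟨j, hj⟩ := hH.pop hl (fun h => hne (h.2.2.1.symm.trans hi))
      exact ⟨j, by rwa [e1, e2, e3]⟩
    have hv : (i, a, b) ∈ bg (tokOf s.A) P ↔ tokOf s.A i = a ∧ tokOf s.A (s.A .nb 0 i 0) = b :=
      h.lnk.mem_bg ha0 hlast
    -- An outdated or already noted entry is simply dropped.
    have hskip : ¬ (tokOf s.A i = a ∧ tokOf s.A (s.A .nb 0 i 0) = b) ∨ s'.A .mark i 0 0 = s.v .rnv →
        ∀ k', s.k + 10 * (T' - 1) ≤ k' + 10 * T + 1 →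
          I ⟨Function.update s'.v .ri i, s'.A.upd .slen (a + 1) b 0 l, k'⟩ := by
      intro hor k' hk'
      rw [hI]
      refine ⟨T' - 1, hF _ (by simp [Arrays.upd_of_ne]) rfl (by simp [Arrays.upd_of_ne])
        (by simp [Arrays.upd_of_ne]) (by simp [Arrays.upd_of_ne]) (by simp [Arrays.upd_of_ne]), hk',
        fun i' hi' => ?_, ?_, ?_, ?_, ?_, ?_⟩
      · by_cases hii : i' = i
        · subst hii
          right
          rcases hor with hor | hor
          · exact absurd (hv.1 hi') hor
          · simpa [Arrays.upd_of_ne] using (h8 i').1 hor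
        · rcases h3 i' hi' with h | h
          · exact .inl (hHas h hii rfl (by simp [Arrays.upd_of_ne]) (by simp [Arrays.upd_of_ne]))
          · right; simpa [Arrays.upd_of_ne] using h
      all_goals simp only [Arrays.upd_of_ne, ne_eq, reduceCtorEq, not_false_eq_true,
        Function.update_of_ne]
      exacts [h4, h5, h6, h7, h8]
    simp only [wp_seq_eq, wp_put, wp_set, wp_ite, wp_skip, Exp.eval, St.putA, St.setv, St.tick, ea, eb,
      hl, Nat.add_sub_cancel, tokE, nextE, not_not, ite_one_eq_zero, Function.update_of_ne,
      Function.update_self, ne_eq, reduceCtorEq, not_false_eq_true, Arrays.upd_of_ne, env]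
    have hself : s'.A.upd .slen (a + 1) b 0 l .slen (a + 1) b 0 = l := by simp [Arrays.upd]
    simp only [hself, hi, etok, enb]
    refine ⟨by omega, by omega, by omega, fun c1 => ⟨by omega, fun c2 => ⟨by omega,
      fun c3 => ⟨by omega, hskip (.inr c3) _ (by omega)⟩, fun c3 => ?_⟩,
      fun c2 => ⟨by omega, hskip (.inl fun h => c2 h.2) _ (by omega)⟩⟩,
      fun c1 => ⟨by omega, hskip (.inl fun h => c1 h.1) _ (by omega)⟩⟩
    refine ⟨by omega, by omega, by omega, by omega, ?_⟩
    rw [hI]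
    obtain ⟨m, hm⟩ : ∃ m, s'.v .rm = m := ⟨_, rfl⟩
    simp only [hm] at h3 h4 h5 h6 h7 h8 ⊢
    have c3' : ∀ j < m, s'.A .E 1 j 0 ≠ i := fun j hj e => c3 ((h8 i).2 ⟨j, hj, e⟩)
    simp only [Function.update_self]
    have eE1 : ∀ (A : Arrays) (x y : ℕ) (j : ℕ), ((A.upd .E 1 m 0 x).upd .E 0 m 0 y) .E 1 j 0 =
        if j = m then x else A .E 1 j 0 := by intro A x y j; simp [Arrays.upd]
    have eE0 : ∀ (A : Arrays) (x y : ℕ) (j : ℕ), ((A.upd .E 1 m 0 x).upd .E 0 m 0 y) .E 0 j 0 =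
        if j = m then y else A .E 0 j 0 := by intro A x y j; simp [Arrays.upd]
    simp only [eE1, eE0]
    refine ⟨T' - 1, hF _ (by simp [Arrays.upd_of_ne]) (by simp [Arrays.upd_of_ne])
      (by simp [Arrays.upd_of_ne]) (by simp [Arrays.upd_of_ne]) (by simp [Arrays.upd_of_ne])
      (by simp [Arrays.upd_of_ne]), by omega, fun i' hi' => ?_, ?_, ?_, ?_, ?_, ?_⟩
    all_goals simp only [Arrays.upd_of_ne, ne_eq, reduceCtorEq, not_false_eq_true]
    · by_cases hii : i' = i
      · subst hii
        exact .inr ⟨m, by omega, by simp⟩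
      · rcases h3 i' hi' with h | ⟨j, hj, e⟩
        · exact .inl (hHas h hii (by simp [Arrays.upd_of_ne]) (by simp [Arrays.upd_of_ne])
            (by simp [Arrays.upd_of_ne]))
        · exact .inr ⟨j, by omega, by rw [if_neg (by omega), e]⟩
    · intro j hj
      split
      · exact hv.2 ⟨c1, c2⟩
      · exact h4 j (by omega)
    · intro j hj j' hj' e
      split_ifs at e with e1 e2 e2
      · omega
      · exact absurd e.symm (c3' j' (by omega))
      · exact absurd e (c3' j (by omega))
      · exact h5 j (by omega) j' (by omega) e
    · intro j hj
      split
      · rfl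
      · exact h6 j (by omega)
    · intro i'
      simp only [Arrays.upd]
      split
      · exact le_rfl
      · simpa using h7 i'
    · intro i'
      have e9 : ((s'.A.upd .slen (a + 1) b 0 l).upd .mark i 0 0 (s.v .rnv)) .mark i' 0 0 =
        if i' = i then s.v .rnv else s'.A .mark i' 0 0 := by simp [Arrays.upd]
      rw [e9]
      constructor
      · split
        · rename_i e; intro _; exact ⟨m, by omega, by simp [e]⟩
        · intro h
          obtain ⟨j, hj, e⟩ := (h8 i').1 h
          exact ⟨j, by omega, by rw [if_neg (by omega), e]⟩
      · rintro ⟨j, hj, e⟩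
        split
        · rfl
        · rename_i hii
          split_ifs at e with e1
          · exact absurd e.symm hii
          · exact (h8 i').2 ⟨j, by omega, e⟩
  · intro s' hs' hfr he
    rw [hI] at hs'
    obtain ⟨T', h1, h2, h3, h4, h5, h6, h7, h8⟩ := hs'
    have ea : s'.v .ra = a := (hfr.v .ra rfl).trans (by simpa using ha)
    have eb : s'.v .rb = b := (hfr.v .rb rfl).trans (by simpa using hb)
    simp only [Exp.eval, ea, eb] at he
    refine ⟨T', h1, by simp only [St.tick]; omega, fun i => ⟨fun hi => ?_, ?_⟩, h5, h6, h7⟩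
    · refine (h3 i hi).resolve_left ?_
      rintro ⟨j, hj, -⟩
      omega
    · rintro ⟨j, hj, rfl⟩
      exact h4 j hj

/-! ### Extending the occurrences in one direction -/

def endE (d : ℕ) (j : Exp) : Exp := .get .E (.lit d) j (.lit 0)

/-- The neighbour in direction `d` of the `j`-th occurrence. -/
def beyondE (d : ℕ) (j : Exp) : Exp := .get .nb (.lit d) (endE d j) (.lit 0)

/-- Clear `go` if the symbols beyond the occurrences are not all equal to `c`. -/
def checkC (d : ℕ) : Cmd :=
  .loop (.lt (.var .rj) (.var .rm)) <|
    .seq (.ite (.eq (tokE (beyondE d (.var .rj))) (.var .rc)) .skip (.set .rgo (.lit 0))) <|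
    .set .rj (.inc (.var .rj))

def shiftC (d : ℕ) : Cmd :=
  .loop (.lt (.var .rj) (.var .rm)) <|
    .seq (.put .E (.lit d) (.var .rj) (.lit 0) (beyondE d (.var .rj))) <|
    .set .rj (.inc (.var .rj))

/-- Extend the occurrences in direction `d` as long as the next symbols agree. -/
def extC (d : ℕ) : Cmd :=
  .seq (.set .rgo (.lit 1)) <|
  .loop (.var .rgo) <|
    .seq (.set .rc (tokE (beyondE d (.lit 0)))) <|
    .seq (.set .rj (.lit 0)) <|
    .seq (checkC d) <|
    .ite (.var .rgo)
      (.seq (.set .rj (.lit 0)) <| .seq (shiftC d) <| .set .rlen (.inc (.var .rlen))) .skip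

lemma wp_checkC {s : St} {d m c : ℕ} {e : ℕ → ℕ} (hm : s.v .rm = m) (hj : s.v .rj = 0)
    (hc : s.v .rc = c) (hgo : s.v .rgo = 1) (he : ∀ j < m, s.A .E d j 0 = e j)
    (hk : 4 * m + 1 ≤ s.k) :
    wp (checkC d) (fun s' => s.k ≤ s'.k + 4 * m + 1 ∧
      ((s'.v .rgo = 1 ∧ ∀ j < m, tokOf s.A (s.A .nb d (e j) 0) = c) ∨
       (s'.v .rgo = 0 ∧ ¬ ∀ j < m, tokOf s.A (s.A .nb d (e j) 0) = c))) s := by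
  refine wp_while (fun s' => s'.v .rj ≤ m ∧ s.k + 4 * s'.v .rj ≤ s'.k + 8 * s'.v .rj ∧
      ((s'.v .rgo = 1 ∧ ∀ j < s'.v .rj, tokOf s.A (s.A .nb d (e j) 0) = c) ∨
       (s'.v .rgo = 0 ∧ ¬ ∀ j < s'.v .rj, tokOf s.A (s.A .nb d (e j) 0) = c))) ?_ ?_ ?_ ?_
  · simp [hj, hgo]
  · rintro s' ⟨h1, h2, -⟩ _; omega
  · rintro s' ⟨h1, h2, h3⟩ hfr hlt
    have em : s'.v .rm = m := (hfr.v .rm rfl).trans hm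
    have ec : s'.v .rc = c := (hfr.v .rc rfl).trans hc
    have eA : s'.A = s.A := by funext id; exact hfr.A id rfl
    simp only [Exp.eval, ite_one_ne_zero, em] at hlt
    obtain ⟨j, hj'⟩ : ∃ j, s'.v .rj = j := ⟨_, rfl⟩
    simp only [hj'] at h1 h2 h3 hlt
    simp only [wp_seq_eq, wp_ite, wp_skip, wp_set, Exp.eval, tokE, beyondE, endE, St.tick, St.setv,
      eA, hj', ec, he j hlt, ite_one_ne_zero, ite_one_eq_zero]
    have hsucc : ∀ p : ℕ → Prop, (∀ i < j + 1, p i) ↔ (∀ i < j, p i) ∧ p j := fun p =>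
      ⟨fun h => ⟨fun i hi => h i (by omega), h j (by omega)⟩, fun h i hi => by
        rcases Nat.lt_succ_iff_lt_or_eq.1 hi with hi | rfl
        exacts [h.1 i hi, h.2]⟩
    refine ⟨by omega, fun ht => ⟨by omega, by omega, ?_⟩, fun ht => ⟨by omega, by omega, ?_⟩⟩
    · simp only [Function.update_self, Function.update_of_ne, ne_eq, reduceCtorEq, not_false_eq_true]
      refine ⟨by omega, by omega, ?_⟩
      rw [hsucc]
      rcases h3 with h3 | h3
      · exact .inl ⟨h3.1, h3.2, ht⟩
      · exact .inr ⟨h3.1, fun h => h3.2 h.1⟩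
    · simp only [Function.update_self, Function.update_of_ne, ne_eq, reduceCtorEq, not_false_eq_true]
      refine ⟨by omega, by omega, ?_⟩
      rw [hj', hsucc]
      exact .inr ⟨trivial, fun h => ht h.2⟩
  · rintro s' ⟨h1, h2, h3⟩ hfr hlt
    have em : s'.v .rm = m := (hfr.v .rm rfl).trans hm
    simp only [Exp.eval, ite_one_eq_zero, em] at hlt
    have : s'.v .rj = m := by omega
    rw [this] at h2 h3
    exact ⟨by simp only [St.tick]; omega, h3⟩

lemma wp_shiftC {s : St} {d m : ℕ} {e : ℕ → ℕ} (hm : s.v .rm = m) (hj : s.v .rj = 0)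
    (he : ∀ j < m, s.A .E d j 0 = e j) (hk : 3 * m + 1 ≤ s.k) :
    wp (shiftC d) (fun s' => s.k ≤ s'.k + 3 * m + 1 ∧
      (∀ j < m, s'.A .E d j 0 = s.A .nb d (e j) 0) ∧ ∀ d' ≠ d, s'.A .E d' = s.A .E d') s := by
  refine wp_while (fun s' => s'.v .rj ≤ m ∧ s.k ≤ s'.k + 3 * s'.v .rj ∧
      (∀ j < m, s'.A .E d j 0 = if j < s'.v .rj then s.A .nb d (e j) 0 else e j) ∧
      ∀ d' ≠ d, s'.A .E d' = s.A .E d') ?_ ?_ ?_ ?_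
  · refine ⟨by omega, by omega, fun j hj' => by simp [hj, he j hj'], fun _ _ => rfl⟩
  · rintro s' ⟨h1, h2, -⟩ _; omega
  · rintro s' ⟨h1, h2, h3, h4⟩ hfr hlt
    have em : s'.v .rm = m := (hfr.v .rm rfl).trans hm
    have eA : s'.A .nb = s.A .nb := hfr.A .nb rfl
    simp only [Exp.eval, ite_one_ne_zero, em] at hlt
    obtain ⟨j, hj'⟩ : ∃ j, s'.v .rj = j := ⟨_, rfl⟩
    simp only [hj'] at h1 h2 h3 hlt
    have h3j := h3 j hlt
    rw [if_neg (lt_irrefl j)] at h3j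
    simp only [wp_seq_eq, wp_put, wp_set, Exp.eval, beyondE, endE, St.tick, St.setv, St.putA,
      eA, hj', h3j]
    refine ⟨by omega, by omega, ?_⟩
    simp only [Function.update_self]
    refine ⟨by omega, by omega, fun i hi => ?_, fun d' hd => ?_⟩
    · simp only [Arrays.upd, true_and, and_true]
      by_cases hij : i = j
      · simp [hij]
      · rw [if_neg hij, h3 i hi]
        split_ifs <;> first | rfl | omega
    · rw [← h4 d' hd]; funext a b; simp [Arrays.upd, hd]
  · rintro s' ⟨h1, h2, h3, h4⟩ hfr hlt
    have em : s'.v .rm = m := (hfr.v .rm rfl).trans hm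
    simp only [Exp.eval, ite_one_eq_zero, em] at hlt
    have : s'.v .rj = m := by omega
    rw [this] at h2 h3
    exact ⟨by simp only [St.tick]; omega, fun j hj' => by simp [St.tick, h3 j hj', hj'], h4⟩

/-- `L i e` abstracts the meaning of having the ends `e` after `i` extensions, so that both
directions share the proof. A pass costs at most `15 * m` credits; the bound `m * i ≤ B` makes the
loop stop, and one more pass detects disagreement. -/
lemma wp_extC {s : St} {d m B : ℕ} (hm : s.v .rm = m) (hm1 : 1 ≤ m) (L : ℕ → (ℕ → ℕ) → Prop)
    (h0 : L 0 (fun j => s.A .E d j 0))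
    (hstep : ∀ i e c, L i e → (∀ j < m, tokOf s.A (s.A .nb d (e j) 0) = c) →
      L (i + 1) (fun j => s.A .nb d (e j) 0))
    (hB : ∀ i e, L i e → m * i ≤ B) (hk : 15 * B + 15 * m + 2 ≤ s.k) :
    wp (extC d) (fun s' => ∃ i e, L i e ∧ s'.v .rlen = s.v .rlen + i ∧
      (∀ j < m, s'.A .E d j 0 = e j) ∧ (∀ c, ¬ ∀ j < m, tokOf s.A (s.A .nb d (e j) 0) = c) ∧
      (∀ d' ≠ d, s'.A .E d' = s.A .E d') ∧ s.k ≤ s'.k + 15 * (m * i) + 15 * m + 2) s := by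
  simp only [extC, wp_seq_eq, wp_set, Exp.eval, St.setv]
  refine ⟨by omega, ?_⟩
  refine wp_while (fun s' => ∃ i e, L i e ∧ s'.v .rlen = s.v .rlen + i ∧
      (∀ j < m, s'.A .E d j 0 = e j) ∧ (∀ d' ≠ d, s'.A .E d' = s.A .E d') ∧
      ((s'.v .rgo = 1 ∧ s.k ≤ s'.k + 15 * (m * i) + 1) ∨
       (s'.v .rgo = 0 ∧ s.k ≤ s'.k + 15 * (m * i) + 15 * m + 1 ∧
        ∀ c, ¬ ∀ j < m, tokOf s.A (s.A .nb d (e j) 0) = c))) ?_ ?_ ?_ ?_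
  · exact ⟨0, _, h0, by simp, fun _ _ => rfl, fun _ _ => rfl, .inl (by simp; omega)⟩
  · rintro s' ⟨i, e, h1, -, -, -, h⟩ _
    have := hB _ _ h1
    omega
  · rintro s' ⟨i, e, h1, h2, h3, h4, h5⟩ hfr hgo
    have em : s'.v .rm = m := (hfr.v .rm rfl).trans (by simpa using hm)
    have enb : s'.A .nb = s.A .nb := hfr.A .nb rfl
    have etok : s'.A .tok = s.A .tok := hfr.A .tok rfl
    have hBi := hB _ _ h1
    have h5' := h5.resolve_right fun h => hgo h.1
    simp only [wp_seq_eq, wp_set, Exp.eval, St.setv, St.tick, tokE, beyondE, endE,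
      h3 0 hm1, enb, etok]
    refine ⟨by omega, by omega, ?_⟩
    obtain ⟨s1, hs1⟩ : ∃ s1 : St, s1 = ⟨Function.update (Function.update s'.v .rc
      (s.A .tok (s.A .nb d (e 0) 0) 0 0)) .rj 0, s'.A, s'.k - 1 - 1 - 1⟩ := ⟨_, rfl⟩
    rw [← hs1]
    have a1 : s1.v .rm = m := by simp [hs1, em]
    have a2 : s1.v .rj = 0 := by simp [hs1]
    have a3 : s1.v .rc = tokOf s.A (s.A .nb d (e 0) 0) := by simp [hs1, tokOf]
    have a4 : s1.v .rgo = 1 := by simp [hs1, h5'.1]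
    have a5 : s1.A = s'.A := by rw [hs1]
    have a6 : s1.k + 3 = s'.k := by rw [hs1]; simp; omega
    have a7 : s1.v .rlen = s.v .rlen + i := by simp [hs1, h2]
    clear hs1
    refine (wp_checkC (s := s1) (m := m) (e := e) a1 a2 a3 a4 (by rw [a5]; exact h3)
      (by omega)).fr.mono ?_
    rintro s2 ⟨⟨b1, b2⟩, hfr2⟩
    have c1 : s2.v .rm = m := (hfr2.v .rm rfl).trans a1
    have c2 : s2.v .rlen = s.v .rlen + i := (hfr2.v .rlen rfl).trans a7
    have c3 : s2.A = s'.A := by rw [← a5]; funext id; exact hfr2.A id rfl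
    have c4 : tokOf s1.A = tokOf s.A := by funext z; rw [a5, tokOf, etok, tokOf]
    rw [c4, a5, enb] at b2
    rw [wp_ite]
    refine ⟨by omega, fun hg => ?_, fun hg => ?_⟩
    · simp only [Exp.eval] at hg
      have b3 := (b2.resolve_right fun h => hg h.1)
      simp only [wp_seq_eq, wp_set, Exp.eval, St.setv, St.tick]
      refine ⟨by omega, ?_⟩
      obtain ⟨s3, hs3⟩ : ∃ s3 : St, s3 = ⟨Function.update s2.v .rj 0, s2.A, s2.k - 1 - 1⟩ := ⟨_, rfl⟩
      rw [← hs3]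
      have f1 : s3.v .rm = m := by simp [hs3, c1]
      have f2 : s3.v .rj = 0 := by simp [hs3]
      have f3 : s3.v .rgo = 1 := by simp [hs3, b3.1]
      have f5 : s3.A = s'.A := by rw [hs3, c3]
      have f6 : s3.k + 2 = s2.k := by rw [hs3]; simp; omega
      have f7 : s3.v .rlen = s.v .rlen + i := by simp [hs3, c2]
      clear hs3
      refine (wp_shiftC (s := s3) (m := m) (e := e) (d := d) f1 f2 (by rw [f5]; exact h3)
        (by omega)).fr.mono ?_
      rintro s4 ⟨⟨g1, g2, g3⟩, hfr4⟩
      have i1 : s4.v .rlen = s.v .rlen + i := (hfr4.v .rlen rfl).trans f7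
      have i2 : s4.v .rgo = 1 := (hfr4.v .rgo rfl).trans f3
      rw [wp_set]
      simp only [Exp.eval, St.setv]
      refine ⟨by omega, i + 1, _, hstep i e _ h1 b3.2, ?_, ?_, ?_, .inl ⟨?_, ?_⟩⟩
      · simp [i1]; omega
      · intro j hj; rw [g2 j hj, f5, enb]
      · intro d' hd; rw [g3 d' hd, f5, h4 d' hd]
      · simp [i2]
      · rw [Nat.mul_add]; omega
    · simp only [Exp.eval] at hg
      have b3 := b2.resolve_left fun h => by omega
      rw [wp_skip]
      simp only [St.tick]
      refine ⟨by omega, i, e, h1, c2, by rw [c3]; exact h3, by rw [c3]; exact h4,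
        .inr ⟨hg, by omega, fun c hc => b3.2 fun j hj => ?_⟩⟩
      rw [hc j hj, hc 0 hm1]
  · rintro s' ⟨i, e, h1, h2, h3, h4, h5⟩ hfr hgo
    have hBi := hB _ _ h1
    simp only [Exp.eval] at hgo
    have h5' := h5.resolve_left fun h => by omega
    exact ⟨i, e, h1, h2, h3, h5'.2.2, h4, by simp only [St.tick]; omega⟩

/-! ### The occurrences of a repeat, given by their first and last nodes -/

/-- The nodes `e₁ j` and `e₀ j`, `j < m`, are the first and the last nodes of the occurrences of `r` in
the text `X` with list of nodes `P`. -/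
def Win (X P r : List ℕ) (m : ℕ) (e₀ e₁ : ℕ → ℕ) : Prop :=
  ∃ p : ℕ → ℕ, (∀ j < m, At X r (p j) ∧ P[p j]? = some (e₁ j) ∧
      P[p j + r.length - 1]? = some (e₀ j)) ∧
    (∀ j < m, ∀ j' < m, p j = p j' → j = j') ∧ ∀ q, At X r q → ∃ j < m, p j = q

lemma pos_eq_image {X r : List ℕ} {m : ℕ} {p : ℕ → ℕ} (hr : r ≠ []) (h : ∀ j < m, At X r (p j))
    (hs : ∀ q, At X r q → ∃ j < m, p j = q) : pos X r = (Finset.range m).image p := by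
  ext q
  rw [mem_pos hr]
  simp only [Finset.mem_image, Finset.mem_range]
  exact ⟨hs q, by rintro ⟨j, hj, rfl⟩; exact h j hj⟩

lemma Win.occ_eq {X P r : List ℕ} {m : ℕ} {e₀ e₁ : ℕ → ℕ} (h : Win X P r m e₀ e₁) (hr : r ≠ []) :
    occ X r = m := by
  obtain ⟨p, h1, h2, h3⟩ := h
  rw [occ_eq_card hr, pos_eq_image hr (fun j hj => (h1 j hj).1) h3, Finset.card_image_of_injOn,
    Finset.card_range]
  intro j hj j' hj' e
  exact h2 j (by simpa using hj) j' (by simpa using hj') e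

lemma Win.congr {X P r : List ℕ} {m : ℕ} {e₀ e₁ e₀' e₁' : ℕ → ℕ} (h : Win X P r m e₀ e₁)
    (h0 : ∀ j < m, e₀' j = e₀ j) (h1 : ∀ j < m, e₁' j = e₁ j) : Win X P r m e₀' e₁' := by
  obtain ⟨p, g1, g2, g3⟩ := h
  exact ⟨p, fun j hj => by rw [h0 j hj, h1 j hj]; exact g1 j hj, g2, g3⟩

lemma at_concat {X r : List ℕ} {c p : ℕ} :
    At X (r ++ [c]) p ↔ At X r p ∧ X[p + r.length]? = some c := by
  constructor
  · intro h
    exact ⟨h.of_append_left, by simpa using h r.length (by simp)⟩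
  · rintro ⟨h1, h2⟩ o ho
    rcases Nat.lt_succ_iff_lt_or_eq.1 (by simpa using ho : o < r.length + 1) with ho | rfl
    · rw [h1 o ho, List.getElem?_append_left ho]
    · simpa using h2

lemma at_cons {X r : List ℕ} {c p : ℕ} :
    At X (c :: r) p ↔ X[p]? = some c ∧ At X r (p + 1) := by
  constructor
  · intro h
    exact ⟨by simpa using h 0 (by simp), by simpa using h.of_append_right (a := [c])⟩
  · rintro ⟨h1, h2⟩ o ho
    obtain - | o := o
    · simpa using h1
    · have := h2 o (by simpa using ho)
      rw [show p + 1 + o = p + (o + 1) by omega] at this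
      simpa using this

/-! ### Extending all occurrences by one symbol. -/

section
variable {P L r : List ℕ} {A : Arrays} {m : ℕ} {e₀ e₁ : ℕ → ℕ}

/-- An occurrence without `0` cannot end at the right sentinel, so there is a next node. -/
lemma right_node (hP : Lnk P A) (hX : P.map (tokOf A) = pad L) {p e : ℕ} (hr : r ≠ [])
    (h0 : 0 ∉ r) (hp : At (pad L) r p) (he : P[p + r.length - 1]? = some e) :
    P[p + r.length]? = some (A .nb 0 e 0) ∧ (pad L)[p + r.length]? = some (tokOf A (A .nb 0 e 0)) := by
  have hlen : P.length = (pad L).length := by rw [← hX, List.length_map]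
  have hr1 := List.length_pos_of_ne_nil hr
  have hlt := hp.lt (o := r.length - 1) (by omega)
  have hne : p + r.length < P.length := by
    by_contra hc
    have h1 := hp (r.length - 1) (by omega)
    rw [List.getElem?_eq_getElem (by omega : r.length - 1 < r.length)] at h1
    have : p + (r.length - 1) = L.length + 1 := by simp [pad] at hlen hlt ⊢; omega
    rw [this] at h1
    simp only [pad, List.cons_append, List.getElem?_cons_succ] at h1
    rw [List.getElem?_append_right le_rfl] at h1
    simp at h1
    exact h0 (h1 ▸ List.getElem_mem _)
  have h1 : P[p + r.length - 1 + 1]? = some P[p + r.length] := by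
    rw [show p + r.length - 1 + 1 = p + r.length by omega, List.getElem?_eq_getElem hne]
  have h2 := (hP.next he h1).1
  rw [h2]
  have h3 : P[p + r.length]? = some P[p + r.length] := List.getElem?_eq_getElem hne
  exact ⟨h3, by rw [← hX, List.getElem?_map, h3]; rfl⟩

lemma left_node (hP : Lnk P A) (hX : P.map (tokOf A) = pad L) {p e : ℕ} (hr : r ≠ [])
    (h0 : 0 ∉ r) (hp : At (pad L) r p) (he : P[p]? = some e) :
    ∃ q, p = q + 1 ∧ P[q]? = some (A .nb 1 e 0) ∧ (pad L)[q]? = some (tokOf A (A .nb 1 e 0)) := by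
  have hr1 := List.length_pos_of_ne_nil hr
  obtain - | q := p
  · have h1 := hp 0 hr1
    rw [List.getElem?_eq_getElem hr1] at h1
    simp [pad] at h1
    exact absurd (h1 ▸ List.getElem_mem _) h0
  have hq : q < P.length := by
    obtain ⟨h, -⟩ := List.getElem?_eq_some_iff.1 he; omega
  have h3 : P[q]? = some P[q] := List.getElem?_eq_getElem hq
  have h2 := (hP.next h3 he).2
  rw [h2]
  exact ⟨q, rfl, h3, by rw [← hX, List.getElem?_map, h3]; rfl⟩

lemma Win.right (hP : Lnk P A) (hX : P.map (tokOf A) = pad L) (hr : r ≠ []) (h0 : 0 ∉ r)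
    (h : Win (pad L) P r m e₀ e₁) {c : ℕ} (hc : ∀ j < m, tokOf A (A .nb 0 (e₀ j) 0) = c) :
    Win (pad L) P (r ++ [c]) m (fun j => A .nb 0 (e₀ j) 0) e₁ := by
  obtain ⟨p, h1, h2, h3⟩ := h
  refine ⟨p, fun j hj => ?_, h2, fun q hq => h3 q hq.of_append_left⟩
  obtain ⟨g1, g2, g3⟩ := h1 j hj
  have hn := right_node hP hX hr h0 g1 g3
  rw [hc j hj] at hn
  exact ⟨at_concat.2 ⟨g1, hn.2⟩, g2, by simpa using hn.1⟩

/-- If the extension were as frequent as `r`, every occurrence of `r` would be followed by `c`. -/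
lemma Win.right_count_lt (hP : Lnk P A) (hX : P.map (tokOf A) = pad L) (hr : r ≠ []) (h0 : 0 ∉ r)
    (h : Win (pad L) P r m e₀ e₁) (hc : ∀ c, ¬ ∀ j < m, tokOf A (A .nb 0 (e₀ j) 0) = c) (c : ℕ) :
    occ (pad L) (r ++ [c]) < m := by
  have hle := occ_append_le_left (T := pad L) hr [c]
  rw [h.occ_eq hr] at hle
  refine lt_of_le_of_ne hle fun he => hc c fun j hj => ?_
  have hs : pos (pad L) (r ++ [c]) ⊆ pos (pad L) r := by
    intro q hq
    rw [mem_pos (by simp)] at hq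
    exact (mem_pos hr).2 hq.of_append_left
  have heq := Finset.eq_of_subset_of_card_le hs (by
    rw [← occ_eq_card hr, ← occ_eq_card (by simp), he, h.occ_eq hr])
  obtain ⟨p, h1, h2, h3⟩ := h
  obtain ⟨g1, g2, g3⟩ := h1 j hj
  have hn := right_node hP hX hr h0 g1 g3
  have hm : p j ∈ pos (pad L) (r ++ [c]) := by rw [heq, mem_pos hr]; exact g1
  rw [mem_pos (by simp), at_concat, hn.2] at hm
  simpa using hm.2

lemma Win.left (hP : Lnk P A) (hX : P.map (tokOf A) = pad L) (hr : r ≠ []) (h0 : 0 ∉ r)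
    (h : Win (pad L) P r m e₀ e₁) {c : ℕ} (hc : ∀ j < m, tokOf A (A .nb 1 (e₁ j) 0) = c) :
    Win (pad L) P (c :: r) m e₀ (fun j => A .nb 1 (e₁ j) 0) := by
  obtain ⟨p, h1, h2, h3⟩ := h
  refine ⟨fun j => p j - 1, fun j hj => ?_, fun j hj j' hj' e => h2 j hj j' hj' ?_, fun q hq => ?_⟩
  · obtain ⟨g1, g2, g3⟩ := h1 j hj
    obtain ⟨q, hq, k1, k2⟩ := left_node hP hX hr h0 g1 g2
    rw [hc j hj] at k2
    simp only [hq, Nat.add_sub_cancel] at g1 g3 ⊢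
    refine ⟨at_cons.2 ⟨k2, g1⟩, k1, ?_⟩
    rw [← g3]
    congr 1
    rw [List.length_cons]; omega
  · obtain ⟨q, hq, -⟩ := left_node hP hX hr h0 (h1 j hj).1 (h1 j hj).2.1
    obtain ⟨q', hq', -⟩ := left_node hP hX hr h0 (h1 j' hj').1 (h1 j' hj').2.1
    simp only at e
    omega
  · obtain ⟨j, hj, e⟩ := h3 _ (at_cons.1 hq).2
    exact ⟨j, hj, by simp [e]⟩

/-- As on the right, with positions shifted by one. -/
lemma Win.left_count_lt (hP : Lnk P A) (hX : P.map (tokOf A) = pad L) (hr : r ≠ []) (h0 : 0 ∉ r)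
    (h : Win (pad L) P r m e₀ e₁) (hc : ∀ c, ¬ ∀ j < m, tokOf A (A .nb 1 (e₁ j) 0) = c) (c : ℕ) :
    occ (pad L) (c :: r) < m := by
  have hle := occ_append_le_right (T := pad L) hr [c]
  rw [h.occ_eq hr] at hle
  refine lt_of_le_of_ne hle fun he => hc c fun j hj => ?_
  have hs : (pos (pad L) ([c] ++ r)).image (· + 1) ⊆ pos (pad L) r := by
    intro q hq
    obtain ⟨q', hq', rfl⟩ := Finset.mem_image.1 hq
    rw [mem_pos (by simp)] at hq'
    exact (mem_pos hr).2 hq'.of_append_right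
  have heq := Finset.eq_of_subset_of_card_le hs (by
    rw [Finset.card_image_of_injective _ (add_left_injective 1), ← occ_eq_card hr,
      ← occ_eq_card (by simp), h.occ_eq hr]
    exact he.ge)
  obtain ⟨p, h1, h2, h3⟩ := h
  obtain ⟨g1, g2, g3⟩ := h1 j hj
  obtain ⟨q, hq, k1, k2⟩ := left_node hP hX hr h0 g1 g2
  have hm : p j ∈ (pos (pad L) ([c] ++ r)).image (· + 1) := by rw [heq, mem_pos hr]; exact g1
  obtain ⟨q', hq', e⟩ := Finset.mem_image.1 hm
  have : q' = q := by omega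
  subst this
  rw [mem_pos (by simp), List.singleton_append, at_cons, k2] at hq'
  simpa using hq'.1

end

/-- From the occurrences of a pair to those of a repeat that cannot be extended. -/
def extendC : Cmd := .seq (.set .rlen (.lit 2)) <| .seq (extC 0) (extC 1)

/-- After the right extension has stopped, extending to the left cannot make it possible again. The
`m * (|r| - 1)` pair positions are distinct, so both loops are bounded by the length of the text. -/
lemma wp_extendC {s : St} {P L : List ℕ} {m a b : ℕ} (hP : Lnk P s.A)
    (hX : P.map (tokOf s.A) = pad L) (hL : 0 ∉ L) (hm : s.v .rm = m) (hm2 : 2 ≤ m)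
    (hmax : ∀ a b, occ (pad L) [a, b] ≤ m)
    (h : Win (pad L) P [a, b] m (fun j => s.A .E 0 j 0) (fun j => s.A .E 1 j 0))
    (hk : 60 * P.length + 5 ≤ s.k) :
    wp extendC (fun s' => ∃ r : List ℕ, s'.v .rlen = r.length ∧ 2 ≤ r.length ∧
      Win (pad L) P r m (fun j => s'.A .E 0 j 0) (fun j => s'.A .E 1 j 0) ∧
      (∀ c, occ (pad L) (c :: r) ≠ m) ∧ (∀ c, occ (pad L) (r ++ [c]) ≠ m) ∧
      (r.length = 2 → r = [a, b]) ∧ [a, b] <:+: r ∧ s.k ≤ s'.k + 60 * (m * (r.length - 1)) + 5) s := by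
  have hlen : P.length = (pad L).length := by rw [← hX, List.length_map]
  have nz : ∀ {r e₀ e₁}, 2 ≤ r.length → Win (pad L) P r m e₀ e₁ → 0 ∉ r := fun hr hw =>
    zero_notMem_of_two_le_occ hL hr (by
      rw [hw.occ_eq (by rintro rfl; simp at hr)]; exact hm2)
  have hbound : ∀ {r e₀ e₁}, 2 ≤ r.length → Win (pad L) P r m e₀ e₁ →
      m * (r.length - 1) ≤ P.length := fun hr hw => by
    rw [hlen]; exact mul_length_le hmax hr (hw.occ_eq (by rintro rfl; simp at hr))
  have h1 := hbound (by simp) h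
  simp only [List.length_cons, List.length_nil, Nat.add_sub_cancel, zero_add, mul_one] at h1
  have hm1 : 1 ≤ m := by omega
  simp only [extendC, wp_seq_eq, wp_set, Exp.eval, St.setv]
  refine ⟨by omega, ?_⟩
  obtain ⟨s1, hs1⟩ : ∃ s1 : St, s1 = ⟨Function.update s.v .rlen 2, s.A, s.k - 1⟩ := ⟨_, rfl⟩
  rw [← hs1]
  have a1 : s1.v .rm = m := by simp [hs1, hm]
  have a2 : s1.v .rlen = 2 := by simp [hs1]
  have a3 : s1.A = s.A := by rw [hs1]
  have a4 : s1.k + 1 = s.k := by rw [hs1]; simp; omega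
  clear hs1
  refine (wp_extC (s := s1) (d := 0) (m := m) (B := P.length) a1 hm1 (fun i e => ∃ r : List ℕ,
    r.length = 2 + i ∧ ((r.length = 2 → r = [a, b]) ∧ [a, b] <:+: r) ∧
      Win (pad L) P r m e (fun j => s.A .E 1 j 0)) ?_ ?_ ?_ (by omega)).fr.mono ?_
  · exact ⟨[a, b], rfl, ⟨fun _ => rfl, List.infix_refl _⟩, by rw [a3]; exact h⟩
  · rintro i e c ⟨r, hr, ⟨-, hin⟩, hw⟩ hc
    rw [a3] at hc
    refine ⟨r ++ [c], by simp [hr]; omega, ⟨fun h => by simp at h; omega,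
      hin.trans (List.prefix_append _ _).isInfix⟩, ?_⟩
    rw [a3]
    exact hw.right hP hX (by rintro rfl; simp at hr; omega) (nz (by omega) hw) hc
  · rintro i e ⟨r, hr, -, hw⟩
    exact (Nat.mul_le_mul_left m (by omega)).trans (hbound (by omega) hw)
  rintro s2 ⟨⟨i, e, ⟨r, hr, hr2, hw⟩, b1, b2, b3, b4, b5⟩, hfr⟩
  have b6 := b4 1 (by simp)
  have b7 := (Nat.mul_le_mul_left m (show i ≤ r.length - 1 by omega)).trans (hbound (by omega) hw)
  rw [a3] at b6
  have c1 : s2.v .rm = m := (hfr.v .rm rfl).trans a1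
  have c2 : s2.A .nb = s.A .nb := by rw [← a3]; exact hfr.A .nb rfl
  have c3 : tokOf s2.A = tokOf s.A := by funext z; rw [tokOf, hfr.A .tok rfl, a3, tokOf]
  have hends := fun c => hw.right_count_lt hP hX (by rintro rfl; simp at hr; omega)
    (nz (by omega) hw) (fun c => by rw [← a3]; exact b3 c) c
  have hw' : Win (pad L) P r m (fun j => s2.A .E 0 j 0) (fun j => s2.A .E 1 j 0) :=
    hw.congr b2 fun j hj => by rw [b6]
  refine (wp_extC (s := s2) (d := 1) (m := m) (B := P.length) c1 hm1 (fun i' e => ∃ r' : List ℕ,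
    r'.length = 2 + i + i' ∧ ((r'.length = 2 → r' = [a, b]) ∧ [a, b] <:+: r') ∧
      (∀ c, occ (pad L) (r' ++ [c]) < m) ∧
      Win (pad L) P r' m (fun j => s2.A .E 0 j 0) e) ?_ ?_ ?_ (by omega)).mono ?_
  · exact ⟨r, by omega, hr2, hends, hw'⟩
  · rintro i' e' c ⟨r', hr', ⟨-, hin⟩, hst, hw1⟩ hc
    rw [c3, c2] at hc
    refine ⟨c :: r', by simp [hr']; omega, ⟨fun h => by simp at h; omega,
      hin.trans (List.suffix_cons _ _).isInfix⟩, fun d => ?_, ?_⟩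
    -- Prefixing a symbol cannot increase the frequency of `r' ++ [d]`, so maximality on the right
    -- persists.
    · exact (occ_append_le_right (a := [c]) (u := r' ++ [d]) (by simp)).trans_lt (hst d)
    · rw [c2]
      exact hw1.left hP hX (by rintro rfl; simp at hr'; omega) (nz (by omega) hw1) hc
  · rintro i' e' ⟨r', hr', -, -, hw1⟩
    exact (Nat.mul_le_mul_left m (by omega)).trans (hbound (by omega) hw1)
  rintro s3 ⟨i', e', ⟨r', hr', hr2', hst, hw1⟩, d1, d2, d3, d4, d5⟩
  have hends' := fun c => hw1.left_count_lt hP hX (by rintro rfl; simp at hr'; omega)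
    (nz (by omega) hw1) (fun c => by rw [← c3, ← c2]; exact d3 c) c
  refine ⟨r', by omega, by omega, hw1.congr (fun j hj => by rw [d4 0 (by simp)]) d2,
    fun c => (hends' c).ne, fun c => (hst c).ne, hr2'.1, hr2'.2, ?_⟩
  have : m * (r'.length - 1) = m * i + m * i' + m := by
    rw [hr', show 2 + i + i' - 1 = i + i' + 1 by omega]; ring
  omega

/-! ### From blocks of nodes to the text -/

lemma Rep.replaceAll {S : Set ℕ} {bl g g' : ℕ → ℕ} {Q Q' r : List ℕ} {v : ℕ} (h : Rep S bl Q Q')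
    (hS : ∀ C i R, Q = C ++ i :: R → (i ∈ S ↔ r <+: (i :: R).map g))
    (hbl : ∀ i ∈ S, bl i = r.length)
    (hg : ∀ i ∈ Q', (i ∈ S → g' i = v) ∧ (i ∉ S → g' i = g i)) :
    ReplaceAll r v (Q.map g) (Q'.map g') := by
  induction h with
  | nil => exact .nil
  | @keep i A A' hi h ih =>
    rw [List.map_cons, List.map_cons, (hg i (by simp)).2 hi]
    exact .miss (fun hp => hi ((hS [] i A rfl).2 hp))
      (ih (fun C j R e => hS (i :: C) j R (by rw [e]; rfl)) fun j hj => hg j (by simp [hj]))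
  | @hit i B A A' hi hB h ih =>
    rw [hbl i hi] at hB
    have h1 := (hS [] i (B ++ A) rfl).1 hi
    have h2 : r = (i :: B).map g := by
      rw [List.prefix_iff_eq_take] at h1
      rw [h1, ← hB, ← List.map_take, List.take_succ_cons, List.take_left' rfl]
    have h3 := ih (fun C j R e => hS (i :: (B ++ C)) j R (by rw [e]; simp))
      fun j hj => hg j (by simp [hj])
    have := ReplaceAll.hit h3
    rw [List.map_cons, List.map_cons, (hg i (by simp)).1 hi]
    convert this using 1
    rw [h2]; simp

/-- `S` is the set of the nodes where the runs of `x` in `Q` start, and `bl` their lengths. -/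
structure Runs (g : ℕ → ℕ) (x : ℕ) (S : Set ℕ) (bl : ℕ → ℕ) (Q : List ℕ) : Prop where
  mem : ∀ C i R, Q = C ++ i :: R →
    (i ∈ S ↔ g i = x ∧ R.head?.map g = some x ∧ C.getLast?.map g ≠ some x)
  two_le : ∀ i ∈ S, 2 ≤ bl i
  take : ∀ C i R, Q = C ++ i :: R → i ∈ S →
    (R.take (bl i - 1)).map g = List.replicate (bl i - 1) x
  drop : ∀ C i R, Q = C ++ i :: R → i ∈ S → (R.drop (bl i - 1)).head?.map g ≠ some x

/-- The cut must not pass through a run, as the rest of a cut run would look like a run of its own.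
-/
lemma Runs.of_append {g : ℕ → ℕ} {x : ℕ} {S : Set ℕ} {bl : ℕ → ℕ} {D Q : List ℕ}
    (h : Runs g x S bl (D ++ Q)) (hD : D.getLast?.map g = some x → Q.head?.map g ≠ some x) :
    Runs g x S bl Q where
  mem C i R e := by
    rw [h.mem (D ++ C) i R (by rw [e]; simp)]
    refine and_congr_right fun hi => and_congr_right fun _ => not_congr ?_
    rw [List.getLast?_append]
    rcases List.eq_nil_or_concat C with rfl | ⟨C, y, rfl⟩
    · simp only [List.getLast?_nil, Option.map_none, Option.none_or]
      exact ⟨fun hd => absurd (by simp [e, hi]) (hD hd), by simp⟩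
    · simp
  two_le := h.two_le
  take C i R e := h.take (D ++ C) i R (by rw [e]; simp)
  drop C i R e := h.drop (D ++ C) i R (by rw [e]; simp)

lemma Rep.replaceRuns {S : Set ℕ} {bl g g' v : ℕ → ℕ} {Q Q' : List ℕ} {x : ℕ} (h : Rep S bl Q Q')
    (hr : Runs g x S bl Q)
    (hg : ∀ i ∈ Q', (i ∈ S → g' i = v (bl i)) ∧ (i ∉ S → g' i = g i)) :
    ReplaceRuns x v (Q.map g) (Q'.map g') := by
  induction h with
  | nil => exact .nil
  | @keep i A A' hi h ih =>
    rw [List.map_cons, List.map_cons, (hg i (by simp)).2 hi]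
    have h1 := (not_congr (hr.mem [] i A rfl)).1 hi
    have h2 : g i = x → A.head?.map g ≠ some x := fun e hA => h1 ⟨e, hA, by simp⟩
    have h3 := ih (hr.of_append (D := [i]) fun e => h2 (by simpa using e))
      fun j hj => hg j (by simp [hj])
    by_cases e : g i = x
    · rw [e]
      exact .single (by simpa using h2 e) h3
    · exact .other e h3
  | @hit i B A A' hi hB h ih =>
    have h1 := (hr.mem [] i (B ++ A) rfl).1 hi
    have h2 := hr.take [] i (B ++ A) rfl hi
    have h3 := hr.drop [] i (B ++ A) rfl hi
    rw [show bl i - 1 = B.length by omega, List.take_left' rfl] at h2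
    rw [show bl i - 1 = B.length by omega, List.drop_left' rfl] at h3
    have h4 := ih (Runs.of_append (D := i :: B) (by simpa using hr) fun _ => h3)
      fun j hj => hg j (by simp [hj])
    rw [List.map_cons, List.map_cons, (hg i (by simp)).1 hi]
    have := ReplaceRuns.run (v := v) (hr.two_le i hi) (by simpa using h3) h4
    convert this using 1
    rw [List.map_append, h2, h1.1, ← List.cons_append, ← List.replicate_succ,
      show B.length + 1 = bl i by omega]

/-- A node inside a run is preceded by the symbol `x`, hence is not the start of a run. -/
lemma Runs.blocks {g : ℕ → ℕ} {x : ℕ} {S : Set ℕ} {bl : ℕ → ℕ} {Q : List ℕ}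
    (h : Runs g x S bl Q) : Blocks S bl Q := by
  refine Blocks.intro fun A i R e hi => ?_
  have h2 := h.take A i R e hi
  have h1 := (h.mem A i R e).1 hi
  have hlen := congrArg List.length h2
  simp only [List.length_map, List.length_take, List.length_replicate] at hlen
  refine ⟨by omega, fun b hb hbS => ?_⟩
  obtain ⟨o, ho, rfl⟩ := List.mem_iff_getElem.1 hb
  rw [List.length_take] at ho
  rw [List.getElem_take] at hbS
  have h3 := (h.mem (A ++ i :: R.take o) R[o] (R.drop (o + 1)) (by
    rw [e, List.append_assoc, List.cons_append, List.getElem_cons_drop, List.take_append_drop])).1 hbS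
  refine h3.2.2 ?_
  obtain - | o := o
  · simp [h1.1]
  · rw [← List.take_concat_get' R o (by omega), ← List.cons_append, ← List.append_assoc,
      List.getLast?_concat]
    have : ((R.take (bl i - 1)).map g)[o]? = some x := by
      rw [h2, List.getElem?_replicate, if_pos (by omega)]
    rw [List.getElem?_map, List.getElem?_take_of_lt (by omega), List.getElem?_eq_getElem (by omega)] at this
    simpa using this

/-- The node at which the list of nodes `Q`, with a node added at both ends, is split. -/
lemma getElem?_of_split {Q C R : List ℕ} {z e i : ℕ} (h : Q = C ++ i :: R) :
    (z :: (Q ++ [e]))[C.length + 1]? = some i := by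
  subst h; simp

lemma at_pad_iff {Q C R : List ℕ} {g : ℕ → ℕ} {i : ℕ} (h : Q = C ++ i :: R) {r : List ℕ} (h0 : 0 ∉ r) :
    At (pad (Q.map g)) r (C.length + 1) ↔ r <+: (i :: R).map g := by
  rw [← prefix_drop_iff, h, pad]
  have : (0 :: (C ++ i :: R).map g ++ [0]).drop (C.length + 1) = (i :: R).map g ++ [0] := by
    rw [List.cons_append, List.drop_succ_cons, List.map_append, List.append_assoc, List.drop_left' (by simp)]
  rw [this]
  refine ⟨fun hp => ?_, fun hp => hp.trans (List.prefix_append _ _)⟩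
  rcases List.prefix_concat_iff.1 hp with rfl | hp
  · simp at h0
  · exact hp

lemma blocks_of_sep {Q : List ℕ} {S : Set ℕ} {bl g : ℕ → ℕ} {r : List ℕ}
    (hS : ∀ C i R, Q = C ++ i :: R → (i ∈ S ↔ r <+: (i :: R).map g)) (h0 : 0 ∉ r)
    (hbl : ∀ i ∈ S, bl i = r.length)
    (hsep : ∀ p q, At (pad (Q.map g)) r p → At (pad (Q.map g)) r q → p < q → p + r.length ≤ q) :
    Blocks S bl Q := by
  refine Blocks.intro fun A i R e hi => ?_
  have h1 := (hS A i R e).1 hi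
  have h2 := h1.length_le
  rw [hbl i hi]
  simp only [List.length_map, List.length_cons] at h2
  refine ⟨by omega, fun b hb hbS => ?_⟩
  obtain ⟨o, ho, rfl⟩ := List.mem_iff_getElem.1 hb
  rw [List.length_take] at ho
  rw [List.getElem_take] at hbS
  have e' : Q = (A ++ i :: R.take o) ++ R[o] :: (R.drop (o + 1)) := by
    rw [e, List.append_assoc, List.cons_append, List.getElem_cons_drop, List.take_append_drop]
  have h3 := hsep _ _ ((at_pad_iff e h0).2 h1) ((at_pad_iff e' h0).2 ((hS _ _ _ e').1 hbS))
  simp only [List.length_append, List.length_cons, List.length_take] at h3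
  omega

/-! ### Writing rules -/

/-- The output array holds `l`, after a first cell that is not used yet. -/
def Outp (l : List ℕ) (n : ℕ) (A : Arrays) : Prop :=
  n = l.length + 1 ∧ ∀ i, i < l.length → l[i]? = some (A .out 0 0 (i + 1))

lemma Outp.congr {l : List ℕ} {n : ℕ} {A A' : Arrays} (h : Outp l n A) (hA : A' .out = A .out) :
    Outp l n A' := ⟨h.1, by rw [hA]; exact h.2⟩

def emitC (e : Exp) : Cmd :=
  .seq (.put .out (.lit 0) (.lit 0) (.var .rolen) e) (.set .rolen (.inc (.var .rolen)))

lemma wp_emitC {e : Exp} {Q : St → Prop} {s : St} {l : List ℕ} (h : Outp l (s.v .rolen) s.A)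
    (hk : 2 ≤ s.k)
    (hQ : ∀ A', (∀ id, id ≠ .out → A' id = s.A id) → Outp (l ++ [e.eval s]) (s.v .rolen + 1) A' →
      Q ⟨Function.update s.v .rolen (s.v .rolen + 1), A', s.k - 2⟩) : wp (emitC e) Q s := by
  simp only [emitC, wp_seq_eq, wp_put, wp_set, Exp.eval, St.putA, St.setv]
  refine ⟨by omega, by omega, ?_⟩
  rw [show s.k - 1 - 1 = s.k - 2 by omega]
  refine hQ _ (fun id hid => Arrays.upd_of_ne hid) ⟨by simp [h.1], fun i hi => ?_⟩
  simp only [List.length_append, List.length_singleton] at hi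
  rw [h.1]
  by_cases e : i = l.length
  · subst e; simp [Arrays.upd]
  · rw [List.getElem?_append_left (by omega), h.2 i (by omega)]
    simp [Arrays.upd, e]

/-- Write the symbols of `rl` nodes from node `ri` on. -/
def emitSeqC : Cmd :=
  .loop (.lt (.lit 0) (.var .rl)) <|
    .seq (emitC (tokE (.var .ri))) <| .seq (.set .ri (nextE (.var .ri))) <|
    .set .rl (.pred (.var .rl))

lemma wp_emitSeqC {s : St} {l P : List ℕ} {p n : ℕ} (hP : Lnk P s.A)
    (h : Outp l (s.v .rolen) s.A) (hn : s.v .rl = n) (hp : p + n ≤ P.length)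
    (hi : 0 < n → P[p]? = some (s.v .ri)) (hk : 5 * n + 1 ≤ s.k) :
    wp emitSeqC (fun s' => Outp (l ++ ((P.drop p).take n).map (tokOf s.A)) (s'.v .rolen) s'.A ∧
      s.k = s'.k + 5 * n + 1) s := by
  refine wp_while (fun s' => ∃ i ≤ n, s'.v .rl = n - i ∧
    Outp (l ++ ((P.drop p).take i).map (tokOf s.A)) (s'.v .rolen) s'.A ∧
    (i < n → P[p + i]? = some (s'.v .ri)) ∧ s.k = s'.k + 5 * i) ?_ ?_ ?_ ?_
  · exact ⟨0, Nat.zero_le _, by simpa using hn, by simpa using h, hi, by omega⟩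
  · rintro s' ⟨i, h1, -, -, -, h2⟩ _; omega
  · rintro s' ⟨i, h1, h2, h3, h4, h5⟩ hfr he
    have etok : s'.A .tok = s.A .tok := hfr.A .tok rfl
    have enb : s'.A .nb = s.A .nb := hfr.A .nb rfl
    simp only [Exp.eval, ite_one_ne_zero, h2] at he
    have hin : i < n := by omega
    have h4' := h4 hin
    rw [wp_seq]
    refine wp_emitC (l := l ++ ((P.drop p).take i).map (tokOf s.A)) h3 (by simp only [St.tick]; omega) ?_
    intro A' hA' hO
    simp only [wp_seq_eq, wp_set, Exp.eval, St.setv, St.tick, tokE, nextE] at hO ⊢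
    refine ⟨by omega, by omega, i + 1, by omega, ?_, ?_, fun hi' => ?_, by omega⟩
    · simp [h2]; omega
    · simp only [Function.update_self, Function.update_of_ne, ne_eq, reduceCtorEq, not_false_eq_true]
      convert hO using 1
      rw [List.append_assoc, ← List.take_concat_get' (P.drop p) i (by simp; omega), List.map_append]
      congr 2
      rw [List.getElem?_eq_some_iff] at h4'
      obtain ⟨hlt, h4'⟩ := h4'
      simp [h4', tokOf, etok]
    · have hlt : p + i + 1 < P.length := by omega
      have := (hP.next h4' (List.getElem?_eq_getElem hlt)).1
      simp only [Function.update_self, Function.update_of_ne, ne_eq, reduceCtorEq, not_false_eq_true]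
      rw [show s'.tick.A = s'.A from rfl] at hA'
      show _ = some (A' .nb 0 (s'.v .ri) 0)
      rw [hA' .nb (by simp), enb, this, ← List.getElem?_eq_getElem hlt]
      rfl
  · rintro s' ⟨i, h1, h2, h3, h4, h5⟩ hfr he
    simp only [Exp.eval, ite_one_eq_zero, h2] at he
    obtain rfl : i = n := by omega
    have := hfr.k
    exact ⟨h3, by simp only [St.tick]; omega⟩

/-- Note the blocks to be replaced: the `rm` occurrences, of length `rlen`, by `rw`. -/
def fillC : Cmd :=
  .seq (.set .rj (.lit 0)) <|
  .loop (.lt (.var .rj) (.var .rm)) <|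
    .seq (.put .F (.lit 0) (.var .rj) (.lit 0) (endE 1 (.var .rj))) <|
    .seq (.put .F (.lit 1) (.var .rj) (.lit 0) (.var .rlen)) <|
    .seq (.put .F (.lit 2) (.var .rj) (.lit 0) (.var .rw)) <|
    .set .rj (.inc (.var .rj))

lemma wp_fillC {s : St} {m : ℕ} (hm : s.v .rm = m) (hk : 5 * m + 2 ≤ s.k) :
    wp fillC (fun s' => (∀ j < m, s'.A .F 0 j 0 = s.A .E 1 j 0 ∧ s'.A .F 1 j 0 = s.v .rlen ∧
      s'.A .F 2 j 0 = s.v .rw) ∧ s.k = s'.k + 5 * m + 2) s := by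
  simp only [fillC, wp_seq_eq, wp_set, Exp.eval, St.setv]
  refine ⟨by omega, ?_⟩
  refine wp_while (fun s' => s'.v .rj ≤ m ∧ (∀ j < s'.v .rj, s'.A .F 0 j 0 = s.A .E 1 j 0 ∧
    s'.A .F 1 j 0 = s.v .rlen ∧ s'.A .F 2 j 0 = s.v .rw) ∧ s.k = s'.k + 5 * s'.v .rj + 1) ?_ ?_ ?_ ?_
  · simp; omega
  · rintro s' ⟨h1, h2, h3⟩ _; omega
  · rintro s' ⟨h1, h2, h3⟩ hfr he
    have em : s'.v .rm = m := (hfr.v .rm rfl).trans (by simpa using hm)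
    have el : s'.v .rlen = s.v .rlen := (hfr.v .rlen rfl).trans (by simp)
    have ew : s'.v .rw = s.v .rw := (hfr.v .rw rfl).trans (by simp)
    have eE : s'.A .E = s.A .E := hfr.A .E rfl
    simp only [Exp.eval, ite_one_ne_zero, em] at he
    obtain ⟨j, hj⟩ : ∃ j, s'.v .rj = j := ⟨_, rfl⟩
    simp only [hj] at h1 h2 h3 he
    simp only [wp_seq_eq, wp_put, wp_set, Exp.eval, St.setv, St.putA, St.tick, endE, hj, el, ew]
    refine ⟨by omega, by omega, by omega, by omega, ?_⟩
    simp only [Function.update_self]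
    refine ⟨by omega, fun i hi => ?_, by omega⟩
    by_cases hij : i = j
    · subst hij; simp [Arrays.upd, eE]
    · simpa [Arrays.upd, hij] using h2 i (by omega)
  · rintro s' ⟨h1, h2, h3⟩ hfr he
    have em : s'.v .rm = m := (hfr.v .rm rfl).trans (by simpa using hm)
    simp only [Exp.eval, ite_one_eq_zero, em] at he
    have : s'.v .rj = m := by omega
    rw [this] at h2 h3
    exact ⟨h2, by simp only [St.tick]; omega⟩

/-- Prepare the replacement of a repeat that is not a square of a variable. -/
def plainPrepC : Cmd :=
  .seq (.ite (.lt (.lit 2) (.var .rlen))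
    (.ite (.eq (tokE (endE 1 (.lit 0))) (tokE (endE 0 (.lit 0)))) (.set .rlen (.pred (.var .rlen))) .skip)
    .skip) <|
  .seq (.set .rw (.var .rnv)) <| .seq (.set .rnv (.inc (.var .rnv))) <|
  .seq (emitC (.var .rw)) <| .seq (emitC (.lit 1)) <| .seq (emitC (.var .rlen)) <|
  .seq (.set .ri (endE 1 (.lit 0))) <| .seq (.set .rl (.var .rlen)) <| .seq emitSeqC <|
  .seq fillC <| .set .rm2 (.var .rm)

/-- The first and the last symbol of `r` are read off at the end nodes of its first listed
occurrence. -/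
lemma wp_trim {s : St} {X P r : List ℕ} {m : ℕ} {Q : St → Prop} (hX : P.map (tokOf s.A) = X)
    (hr : s.v .rlen = r.length) (hr2 : 2 ≤ r.length) (hm : 1 ≤ m)
    (h : Win X P r m (fun j => s.A .E 0 j 0) (fun j => s.A .E 1 j 0)) (hk : 3 ≤ s.k)
    (hQ : ∀ k', s.k ≤ k' + 3 → Q ⟨Function.update s.v .rlen (trim r).length, s.A, k'⟩) :
    wp (.ite (.lt (.lit 2) (.var .rlen))
      (.ite (.eq (tokE (endE 1 (.lit 0))) (tokE (endE 0 (.lit 0)))) (.set .rlen (.pred (.var .rlen)))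
        .skip) .skip) Q s := by
  obtain ⟨p, h1, -⟩ := h
  obtain ⟨g1, g2, g3⟩ := h1 0 hm
  have hh : r.head? = some (s.A .tok (s.A .E 1 0 0) 0 0) := by
    have := g1 0 (by omega)
    rw [← hX, List.getElem?_map, Nat.add_zero, g2] at this
    rw [List.head?_eq_getElem?, ← this]; rfl
  have hl : r.getLast? = some (s.A .tok (s.A .E 0 0 0) 0 0) := by
    have := g1 (r.length - 1) (by omega)
    rw [← hX, List.getElem?_map, ← Nat.add_sub_assoc (by omega), g3] at this
    rw [List.getLast?_eq_getElem?, ← this]; rfl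
  have hid : trim r = r → ∀ k', (⟨s.v, s.A, k'⟩ : St) = ⟨Function.update s.v .rlen (trim r).length, s.A, k'⟩ := by
    intro e k'; rw [e, ← hr, Function.update_eq_self]
  simp only [wp_ite, wp_skip, wp_set, Exp.eval, St.tick, St.setv, tokE, endE, hr, ne_eq, not_not,
    ite_one_eq_zero]
  refine ⟨by omega, fun c1 => ⟨by omega, fun c2 => ⟨by omega, ?_⟩, fun c2 => ⟨by omega, ?_⟩⟩,
    fun c1 => ⟨by omega, ?_⟩⟩
  · replace c2 := ite_one_ne_zero.1 c2
    have : (trim r).length = r.length - 1 := by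
      rw [trim, if_pos ⟨c1, by rw [hh, hl, c2]⟩, List.length_dropLast]
    rw [← this]
    exact hQ _ (by omega)
  · rw [hid]
    · exact hQ _ (by omega)
    · replace c2 := ite_one_eq_zero.1 c2
      rw [trim, if_neg fun hc => c2 (by have := hc.2; rw [hh, hl] at this; simpa using this)]
  · rw [hid]
    · exact hQ _ (by omega)
    · rw [trim, if_neg fun hc => c1 hc.1]

lemma wp_plainPrepC {s : St} {L P r l : List ℕ} {m : ℕ} (hP : Lnk P s.A)
    (hX : P.map (tokOf s.A) = pad L) (hm : s.v .rm = m) (hm1 : 1 ≤ m)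
    (hr : s.v .rlen = r.length) (hr2 : 2 ≤ r.length)
    (h : Win (pad L) P r m (fun j => s.A .E 0 j 0) (fun j => s.A .E 1 j 0))
    (hO : Outp l (s.v .rolen) s.A) (hk : 5 * (trim r).length + 5 * m + 20 ≤ s.k) :
    wp plainPrepC (fun s' => s'.v .rnv = s.v .rnv + 1 ∧ s'.v .rm2 = m ∧
      (∀ j < m, s'.A .F 0 j 0 = s.A .E 1 j 0 ∧ s'.A .F 1 j 0 = (trim r).length ∧
        s'.A .F 2 j 0 = s.v .rnv) ∧
      Outp (l ++ encodeRule (s.v .rnv, .seq (trim r))) (s'.v .rolen) s'.A ∧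
      s.k ≤ s'.k + 5 * (trim r).length + 5 * m + 20) s := by
  have h' := h
  obtain ⟨p, h1, -⟩ := h
  obtain ⟨g1, g2, g3⟩ := h1 0 hm1
  obtain ⟨tb, htb⟩ := trim_prefix r
  have htl : (trim r).length ≤ r.length := by
    have := congrArg List.length htb; simp at this; omega
  simp only [plainPrepC, wp_seq_eq]
  refine wp_trim (m := m) hX hr hr2 hm1 h' (by omega) fun k1 hk1 => ?_
  simp only [wp_set, Exp.eval, St.setv]
  refine ⟨by omega, by omega, ?_⟩
  refine wp_emitC (l := l) (by simpa using hO) (by simp only; omega) fun A1 hA1 hO1 => ?_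
  refine wp_emitC hO1 (by simp only; omega) fun A2 hA2 hO2 => ?_
  refine wp_emitC hO2 (by simp only; omega) fun A3 hA3 hO3 => ?_
  have eA : ∀ id, id ≠ .out → A3 id = s.A id := fun id hid =>
    (hA3 id hid).trans ((hA2 id hid).trans (hA1 id hid))
  simp only [Exp.eval, Function.update_self, Function.update_of_ne, ne_eq, reduceCtorEq,
    not_false_eq_true] at hO3
  simp only [wp_set, Exp.eval, St.setv, endE, eA .E (by simp)]
  refine ⟨by omega, by omega, ?_⟩
  obtain ⟨s1, hs1⟩ : ∃ s1 : St, s1 = ⟨Function.update (Function.update (Function.update (Function.update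
    (Function.update (Function.update (Function.update (Function.update s.v .rlen (trim r).length) .rw (s.v .rnv))
    .rnv (s.v .rnv + 1)) .rolen (s.v .rolen + 1)) .rolen (s.v .rolen + 1 + 1)) .rolen
    (s.v .rolen + 1 + 1 + 1)) .ri (s.A .E 1 0 0)) .rl (trim r).length, A3, k1 - 10⟩ := ⟨_, rfl⟩
  simp only [Function.update_self, Function.update_of_ne, ne_eq, reduceCtorEq, not_false_eq_true]
  rw [show k1 - 1 - 1 - 2 - 2 - 2 - 1 - 1 = k1 - 10 by omega]
  rw [← hs1]
  have a1 : s1.v .rlen = (trim r).length := by simp [hs1]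
  have a2 : s1.v .rw = s.v .rnv := by simp [hs1]
  have a3 : s1.v .rnv = s.v .rnv + 1 := by simp [hs1]
  have a4 : s1.v .rolen = s.v .rolen + 1 + 1 + 1 := by simp [hs1]
  have a5 : s1.v .ri = s.A .E 1 0 0 := by simp [hs1]
  have a6 : s1.v .rl = (trim r).length := by simp [hs1]
  have a7 : s1.A = A3 := by simp [hs1]
  have a8 : s1.k = k1 - 10 := by simp [hs1]
  have a9 : s1.v .rm = m := by simp [hs1, hm]
  clear hs1
  have hlen : p 0 + (trim r).length ≤ P.length := by
    have := g1.lt (o := r.length - 1) (by omega)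
    rw [← hX, List.length_map] at this
    omega
  refine (wp_emitSeqC (s := s1) (P := P) (p := p 0) (n := (trim r).length)
    (hP.congr (by rw [a7, eA .nb (by simp)]) (by rw [a7, eA .tok (by simp)]))
    (by rw [a4, a7]; exact hO3) a6 hlen (fun _ => by rw [a5]; exact g2) (by omega)).fr.mono ?_
  rintro s2 ⟨⟨b1, b2⟩, hfr2⟩
  refine (wp_fillC (s := s2) (m := m) ((hfr2.v .rm rfl).trans a9) (by omega)).fr.mono ?_
  rintro s3 ⟨⟨c1, c2⟩, hfr3⟩
  have hfr : ∀ z, z ≠ .rolen → z ≠ .ri → z ≠ .rl → z ≠ .rj → s3.v z = s1.v z := fun z z1 z2 z3 z4 => by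
    rw [hfr3.v z, hfr2.v z]
    · simp [emitSeqC, emitC, Cmd.wv, z1, z2, z3]
    · simp [fillC, Cmd.wv, z4]
  rw [wp_set]
  simp only [Exp.eval, St.setv, Function.update_self, Function.update_of_ne, ne_eq, reduceCtorEq,
    not_false_eq_true]
  have d1 : s2.A .E = s.A .E := by rw [hfr2.A .E rfl, a7, eA .E (by simp)]
  have d2 : s2.v .rlen = (trim r).length := (hfr2.v .rlen rfl).trans a1
  have d3 : s2.v .rw = s.v .rnv := (hfr2.v .rw rfl).trans a2
  refine ⟨by omega, ?_, ?_, ?_, ?_, by omega⟩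
  · rw [hfr .rnv (by simp) (by simp) (by simp) (by simp), a3]
  · rw [hfr .rm (by simp) (by simp) (by simp) (by simp), a9]
  · rw [d1, d2, d3] at c1; exact c1
  · rw [hfr3.v .rolen rfl]
    refine Outp.congr ?_ (hfr3.A .out rfl)
    have e : ((P.drop (p 0)).take (trim r).length).map (tokOf s1.A) = trim r := by
      have e1 : tokOf s1.A = tokOf s.A := by
        funext z; rw [tokOf, a7, eA .tok (by simp), tokOf]
      rw [e1, List.map_take, List.map_drop, hX]
      have e2 : At (pad L) (trim r) (p 0) := by
        rw [htb] at g1; exact g1.of_append_left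
      rw [← prefix_drop_iff, List.prefix_iff_eq_take] at e2
      exact e2.symm
    rw [e] at b1
    simpa [encodeRule] using b1

/-! ### Runs -/

lemma split_unique {C C' R R' : List ℕ} {i : ℕ} (hnd : (C ++ i :: R).Nodup)
    (h : C ++ i :: R = C' ++ i :: R') : C = C' ∧ R = R' := by
  have hC : i ∉ C := by
    rw [List.nodup_append] at hnd
    exact fun hi => hnd.2.2 i hi i (by simp) rfl
  have hC' : i ∉ C' := by
    rw [h, List.nodup_append] at hnd
    exact fun hi => hnd.2.2 i hi i (by simp) rfl
  have h1 := congrArg (List.idxOf i) h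
  rw [List.idxOf_append_of_notMem hC, List.idxOf_append_of_notMem hC'] at h1
  simp only [List.idxOf_cons_self, add_zero] at h1
  obtain ⟨rfl, h2⟩ := List.append_inj h h1
  exact ⟨rfl, by simpa using h2⟩

/-- A node determines its place in a duplicate-free list, so the length of a run is a function of
its first node. -/
lemma exists_runs {Q : List ℕ} (hnd : Q.Nodup) (g : ℕ → ℕ) (x : ℕ) :
    ∃ S bl, Runs g x S bl Q ∧ ∀ i ∈ S, i ∈ Q := by
  have key : ∀ i, ∃ l, ∀ C R, Q = C ++ i :: R → l = (R.takeWhile fun j => decide (g j = x)).length + 1 := by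
    intro i
    by_cases h : ∃ C R, Q = C ++ i :: R
    · obtain ⟨C, R, e⟩ := h
      refine ⟨(R.takeWhile fun j => decide (g j = x)).length + 1, fun C' R' e' => ?_⟩
      rw [(split_unique (e ▸ hnd) (e.symm.trans e')).2]
    · exact ⟨0, fun C R e => absurd ⟨C, R, e⟩ h⟩
  choose bl hbl using key
  refine ⟨{i | ∃ C R, Q = C ++ i :: R ∧ g i = x ∧ R.head?.map g = some x ∧ C.getLast?.map g ≠ some x},
    bl, ⟨fun C i R e => ?_, ?_, fun C i R e _ => ?_, fun C i R e _ => ?_⟩, ?_⟩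
  · constructor
    · rintro ⟨C', R', e', h⟩
      obtain ⟨rfl, rfl⟩ := split_unique (e ▸ hnd) (e.symm.trans e')
      exact h
    · exact fun h => ⟨C, R, e, h⟩
  · rintro i ⟨C, R, e, h1, h2, -⟩
    rw [hbl i C R e]
    obtain - | ⟨j, R⟩ := R
    · simp at h2
    · simp only [List.head?_cons, Option.map_some, Option.some.injEq] at h2
      simp [h2]
  · rw [hbl i C R e, Nat.add_sub_cancel, ← List.prefix_iff_eq_take.1 (List.takeWhile_prefix _), List.eq_replicate_iff]
    refine ⟨by simp, fun b hb => ?_⟩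
    obtain ⟨j, hj, rfl⟩ := List.mem_map.1 hb
    simpa using List.mem_takeWhile_imp hj
  · rw [hbl i C R e, Nat.add_sub_cancel]
    have hd : R.drop (R.takeWhile fun j => decide (g j = x)).length =
        R.dropWhile fun j => decide (g j = x) := by
      have := congrArg (List.drop (R.takeWhile fun j => decide (g j = x)).length)
        (List.takeWhile_append_dropWhile (p := fun j => decide (g j = x)) (l := R)).symm
      rwa [List.drop_left' rfl] at this
    rw [hd]
    intro hc
    obtain ⟨j, hj, hj'⟩ := Option.map_eq_some_iff.1 hc
    have := List.head?_dropWhile_not (fun j => decide (g j = x)) R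
    rw [hj] at this
    simp [hj'] at this
  · rintro i ⟨C, R, e, -⟩
    simp [e]

lemma replicate_append_inj {x a b : ℕ} {t t' : List ℕ} (ht : t.head? ≠ some x)
    (ht' : t'.head? ≠ some x) (h : List.replicate a x ++ t = List.replicate b x ++ t') : a = b := by
  induction a generalizing b with
  | zero =>
    obtain - | b := b
    · rfl
    · rw [List.replicate_zero, List.nil_append] at h
      simp [h, List.replicate_succ] at ht
  | succ a ih =>
    obtain - | b := b
    · rw [List.replicate_zero, List.nil_append] at h
      simp [← h, List.replicate_succ] at ht'
    · simp only [List.replicate_succ, List.cons_append, List.cons.injEq, true_and] at h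
      rw [ih h]

lemma Runs.map_eq {g : ℕ → ℕ} {x : ℕ} {S : Set ℕ} {bl : ℕ → ℕ} {Q C R : List ℕ} {i : ℕ}
    (h : Runs g x S bl Q) (e : Q = C ++ i :: R) (hi : i ∈ S) :
    R.map g = List.replicate (bl i - 1) x ++ (R.drop (bl i - 1)).map g := by
  rw [← h.take C i R e hi, ← List.map_append, List.take_append_drop]

/-- Identifies the lengths found at the nodes with the set `K` that `Round.runs` asks for. -/
lemma Runs.isRun_iff {g : ℕ → ℕ} {x : ℕ} {S : Set ℕ} {bl : ℕ → ℕ} {Q : List ℕ}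
    (h : Runs g x S bl Q) (hSQ : ∀ i ∈ S, i ∈ Q) (k : ℕ) :
    (∃ i ∈ S, bl i = k) ↔ 2 ≤ k ∧ IsRun (Q.map g) x k := by
  constructor
  · rintro ⟨i, hi, rfl⟩
    refine ⟨h.two_le i hi, ?_⟩
    obtain ⟨C, R, e⟩ := List.append_of_mem (hSQ i hi)
    have h1 := (h.mem C i R e).1 hi
    refine ⟨C.map g, (R.drop (bl i - 1)).map g, ?_, by rw [List.getLast?_map]; exact h1.2.2,
      by rw [List.head?_map]; exact h.drop C i R e hi⟩
    have h2 := h.two_le i hi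
    rw [e, List.map_append, List.map_cons, h.map_eq e hi, h1.1, List.append_assoc, ← List.cons_append,
      ← List.replicate_succ, show bl i - 1 + 1 = bl i by omega]
  · rintro ⟨hk, u, t, hT, hu, ht⟩
    rw [List.append_assoc, List.map_eq_append_iff] at hT
    obtain ⟨C, D, e, rfl, hD⟩ := hT
    rw [show k = k - 1 + 1 by omega, List.replicate_succ, List.cons_append, List.map_eq_cons_iff] at hD
    obtain ⟨i, R, rfl, hi, hR⟩ := hD
    have hiS : i ∈ S := by
      rw [h.mem C i R e]
      refine ⟨hi, ?_, by rwa [List.getLast?_map] at hu⟩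
      rw [← List.head?_map, hR, show k - 1 = k - 2 + 1 by omega, List.replicate_succ]
      rfl
    refine ⟨i, hiS, ?_⟩
    have h2 := h.map_eq e hiS
    have h3 := h.drop C i R e hiS
    rw [← List.head?_map] at h3
    have := replicate_append_inj h3 ht (h2.symm.trans hR)
    have := h.two_le i hiS
    omega

/-- Shrinking the blocks one after another removes `bl i - 1` nodes each time, and no more nodes
than there are. -/
lemma Blocks.sum_le {S : Set ℕ} {bl : ℕ → ℕ} {Q : List ℕ} (h : Blocks S bl Q) (hnd : Q.Nodup)
    (hSQ : ∀ i ∈ S, i ∈ Q) (hbl : ∀ i ∈ S, 1 ≤ bl i) (D : Finset ℕ) (hD : ∀ i ∈ D, i ∈ S) :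
    ∑ i ∈ D, (bl i - 1) ≤ Q.length := by
  suffices ∃ Q', Rep D bl Q Q' ∧ Q'.length + ∑ i ∈ D, (bl i - 1) = Q.length by
    obtain ⟨Q', -, h'⟩ := this; omega
  induction D using Finset.induction_on with
  | empty => exact ⟨Q, by simpa using Rep.refl bl Q, by simp⟩
  | insert i D hi ih =>
    obtain ⟨Q', h1, h2⟩ := ih fun j hj => hD j (by simp [hj])
    have hiS := hD i (by simp)
    obtain ⟨A, B, C, rfl, h3, -, h4⟩ := h1.insert (fun j hj => hD j (by simp at hj; simp [hj])) h hnd hiS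
      (by simpa using hi) (hSQ i hiS) (hbl i hiS)
    refine ⟨_, by rw [Finset.coe_insert]; exact h4, ?_⟩
    rw [Finset.sum_insert hi]
    simp only [List.length_append, List.length_cons] at h2 ⊢
    omega

lemma Blocks.sum_range_le {S : Set ℕ} {bl : ℕ → ℕ} {Q : List ℕ} (h : Blocks S bl Q) (hnd : Q.Nodup)
    (hSQ : ∀ i ∈ S, i ∈ Q) (hbl : ∀ i ∈ S, 1 ≤ bl i) {n : ℕ} {F : ℕ → ℕ} (hF : ∀ j < n, F j ∈ S)
    (hinj : ∀ j < n, ∀ j' < n, F j = F j' → j = j') :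
    ∑ j ∈ Finset.range n, (bl (F j) - 1) ≤ Q.length := by
  rw [← Finset.sum_image (f := fun i => bl i - 1) (g := F) (s := Finset.range n)]
  · refine h.sum_le hnd hSQ hbl _ fun i hi => ?_
    obtain ⟨j, hj, rfl⟩ := Finset.mem_image.1 hi
    exact hF j (by simpa using hj)
  · intro j hj j' hj' e
    exact hinj j (by simpa using hj) j' (by simpa using hj') e

/-- A walk from the start of a run leaves the symbol `x` exactly after `bl i` nodes; if the run is
last, the sentinel `e` stops it. -/
lemma Runs.next_iff {g : ℕ → ℕ} {x : ℕ} {S : Set ℕ} {bl : ℕ → ℕ} {Q C R : List ℕ} {z e i t : ℕ}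
    (h : Runs g x S bl Q) (hQ : Q = C ++ i :: R) (hi : i ∈ S) (he : g e ≠ x) (ht : 1 ≤ t)
    (htb : t ≤ bl i) :
    ∃ y, (z :: (Q ++ [e]))[C.length + 1 + t]? = some y ∧ (g y = x ↔ t < bl i) := by
  obtain ⟨t, rfl⟩ : ∃ t', t = t' + 1 := ⟨t - 1, by omega⟩
  have e1 : (z :: (Q ++ [e]))[C.length + 1 + (t + 1)]? = (R ++ [e])[t]? := by
    rw [show z :: (Q ++ [e]) = (z :: C ++ [i]) ++ (R ++ [e]) by simp [hQ],
      List.getElem?_append_right (by simp)]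
    congr 1
    simp; omega
  rw [e1]
  have h1 := h.take C i R hQ hi
  have h2 := h.drop C i R hQ hi
  have hlen := congrArg List.length h1
  simp only [List.length_map, List.length_take, List.length_replicate] at hlen
  by_cases hc : t + 1 < bl i
  · have h3 : ((R.take (bl i - 1)).map g)[t]? = some x := by
      rw [h1, List.getElem?_replicate, if_pos (by omega)]
    rw [List.getElem?_map, List.getElem?_take_of_lt (by omega)] at h3
    obtain ⟨y, hy, hy'⟩ := Option.map_eq_some_iff.1 h3
    exact ⟨y, by rw [List.getElem?_append_left (by omega), hy], by simp [hy', hc]⟩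
  · have ht' : t = bl i - 1 := by omega
    rw [← ht'] at h2
    rw [List.head?_drop] at h2
    by_cases hR : t < R.length
    · rw [List.getElem?_append_left hR]
      rw [List.getElem?_eq_getElem hR] at h2 ⊢
      exact ⟨_, rfl, by simp [hc]; simpa using h2⟩
    · have : t = R.length := by omega
      rw [this]
      exact ⟨e, by simp, by simp [he]; omega⟩

/-- Increase `rl` by the number of symbols `ra` from node `rx` on. -/
def walkC : Cmd :=
  .loop (.eq (tokE (.var .rx)) (.var .ra)) <|
    .seq (.set .rl (.inc (.var .rl))) (.set .rx (nextE (.var .rx)))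

lemma wp_walkC {s : St} {a z e i : ℕ} {Q C R : List ℕ} {S : Set ℕ} {bl : ℕ → ℕ}
    (hP : Lnk (z :: (Q ++ [e])) s.A) (h : Runs (tokOf s.A) a S bl Q) (hQ : Q = C ++ i :: R)
    (hi : i ∈ S) (he : tokOf s.A e ≠ a) (ha : s.v .ra = a) (hl : s.v .rl = 1)
    (hx : s.v .rx = s.A .nb 0 i 0) (hk : 3 * bl i + 1 ≤ s.k) :
    wp walkC (fun s' => s'.v .rl = bl i ∧ s.k = s'.k + 3 * (bl i - 1) + 1) s := by
  have h2 := h.two_le i hi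
  have hlast := fun t (ht : 1 ≤ t) (htb : t ≤ bl i) => h.next_iff (z := z) hQ hi he ht htb
  have hi0 : (z :: (Q ++ [e]))[C.length + 1]? = some i := getElem?_of_split hQ
  refine wp_while (fun s' => 1 ≤ s'.v .rl ∧ s'.v .rl ≤ bl i ∧
    (z :: (Q ++ [e]))[C.length + 1 + s'.v .rl]? = some (s'.v .rx) ∧
    s.k = s'.k + 3 * (s'.v .rl - 1)) ?_ ?_ ?_ ?_
  · refine ⟨hl.ge, by omega, ?_, by omega⟩
    obtain ⟨y, hy, -⟩ := hlast 1 le_rfl (by omega)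
    rw [hl, hx, (hP.next hi0 hy).1, hy]
  · rintro s' ⟨g1, g2, g3, g4⟩ _; omega
  · rintro s' ⟨g1, g2, g3, g4⟩ hfr hne
    have etok : s'.A .tok = s.A .tok := hfr.A .tok rfl
    have enb : s'.A .nb = s.A .nb := hfr.A .nb rfl
    have era : s'.v .ra = a := (hfr.v .ra rfl).trans ha
    simp only [Exp.eval, tokE, ite_one_ne_zero, era, etok] at hne
    obtain ⟨y, hy, hy'⟩ := hlast _ g1 g2
    rw [g3] at hy
    obtain rfl := Option.some.inj hy
    have hlt := hy'.1 hne
    obtain ⟨y', hy1, -⟩ := hlast (s'.v .rl + 1) (by omega) (by omega)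
    simp only [wp_seq_eq, wp_set, Exp.eval, St.setv, St.tick, nextE]
    refine ⟨by omega, by omega, ?_⟩
    simp only [Function.update_self, Function.update_of_ne, ne_eq, reduceCtorEq, not_false_eq_true]
    refine ⟨by omega, by omega, ?_, by omega⟩
    rw [hy1, enb, (hP.next g3 hy1).1]
  · rintro s' ⟨g1, g2, g3, g4⟩ hfr hne
    have etok : s'.A .tok = s.A .tok := hfr.A .tok rfl
    have era : s'.v .ra = a := (hfr.v .ra rfl).trans ha
    simp only [Exp.eval, tokE, ite_one_eq_zero, era, etok] at hne
    obtain ⟨y, hy, hy'⟩ := hlast _ g1 g2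
    rw [g3] at hy
    obtain rfl := Option.some.inj hy
    have hlt : s'.v .rl = bl i := by
      have := (not_congr hy').1 hne; omega
    rw [hlt] at g4
    have := hfr.k
    exact ⟨hlt, by simp only [St.tick]; omega⟩

/-- The rules for the runs of `a` with the lengths `Ks`, for variables from `st` on. -/
def runRules (st a : ℕ) (Ks : List ℕ) : List Rule := Ks.map fun k => (st + Ks.idxOf k, Rhs.run a k)

lemma runRules_concat {st a k : ℕ} {Ks : List ℕ} (hk : k ∉ Ks) :
    runRules st a (Ks ++ [k]) = runRules st a Ks ++ [(st + Ks.length, Rhs.run a k)] := by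
  rw [runRules, List.map_append, runRules]
  congr 1
  · refine List.map_congr_left fun x hx => ?_
    rw [List.idxOf_append_of_mem hx]
  · simp [List.idxOf_append_of_notMem hk]

/-- `Ks` lists the run lengths in the order of first appearance. The row `st` of `rv`, named after
the first fresh variable of the round, is new in each round; `0` there means that the length has no
variable yet. -/
structure Names (st a : ℕ) (l Ks : List ℕ) (rv₀ : ℕ → ℕ → ℕ → ℕ) (A : Arrays) (nv ol : ℕ) : Prop where
  nodup : Ks.Nodup
  nv : nv = st + Ks.length
  rv : ∀ k, A .rv st k 0 = if k ∈ Ks then st + Ks.idxOf k else 0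
  rest : ∀ s, s ≠ st → A .rv s = rv₀ s
  out : Outp (l ++ (runRules st a Ks).flatMap encodeRule) ol A

lemma Names.congr {st a nv ol : ℕ} {l Ks : List ℕ} {rv₀ : ℕ → ℕ → ℕ → ℕ} {A A' : Arrays}
    (h : Names st a l Ks rv₀ A nv ol) (h1 : A' .rv = A .rv) (h2 : A' .out = A .out) :
    Names st a l Ks rv₀ A' nv ol :=
  ⟨h.nodup, h.nv, by rw [h1]; exact h.rv, by rw [h1]; exact h.rest, h.out.congr h2⟩

/-- Find or create the variable for the runs of length `rl`. -/
def nameC : Cmd :=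
  .ite (.get .rv (.var .rst) (.var .rl) (.lit 0)) .skip <|
    .seq (.put .rv (.var .rst) (.var .rl) (.lit 0) (.var .rnv)) <|
    .seq (emitC (.var .rnv)) <| .seq (emitC (.lit 2)) <| .seq (emitC (.var .ra)) <|
    .seq (emitC (.var .rl)) <| .set .rnv (.inc (.var .rnv))

lemma wp_nameC {s : St} {st a k : ℕ} {l Ks : List ℕ} {rv₀ : ℕ → ℕ → ℕ → ℕ}
    (h : Names st a l Ks rv₀ s.A (s.v .rnv) (s.v .rolen)) (hst : 1 ≤ st) (h1 : s.v .rst = st)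
    (h2 : s.v .ra = a) (h3 : s.v .rl = k) (hk : 11 ≤ s.k) :
    wp nameC (fun s' => ∃ Ks', Names st a l Ks' rv₀ s'.A (s'.v .rnv) (s'.v .rolen) ∧ Ks <+: Ks' ∧
      k ∈ Ks' ∧ (∀ x ∈ Ks', x ∈ Ks ∨ x = k) ∧ s.k ≤ s'.k + 11) s := by
  rw [nameC, wp_ite]
  simp only [Exp.eval, h1, h3, h.rv]
  refine ⟨by omega, fun hne => ?_, fun hne => ?_⟩
  · have hk : k ∈ Ks := by by_contra hc; simp [hc] at hne
    rw [wp_skip]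
    simp only [St.tick]
    exact ⟨by omega, Ks, h, List.prefix_refl _, hk, fun x hx => .inl hx, by omega⟩
  · have hk : k ∉ Ks := by intro hc; simp [hc] at hne; omega
    simp only [wp_seq_eq, wp_put, Exp.eval, St.putA, St.tick, h1, h3]
    refine ⟨by omega, ?_⟩
    refine wp_emitC (h.out.congr (by simp [Arrays.upd_of_ne])) (by simp only; omega)
      fun A1 hA1 hO1 => ?_
    refine wp_emitC hO1 (by simp only; omega) fun A2 hA2 hO2 => ?_
    refine wp_emitC hO2 (by simp only; omega) fun A3 hA3 hO3 => ?_
    refine wp_emitC hO3 (by simp only; omega) fun A4 hA4 hO4 => ?_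
    simp only [Exp.eval, Function.update_self, Function.update_of_ne, ne_eq, reduceCtorEq,
      not_false_eq_true, h2, h3] at hO4
    have erv : A4 .rv = (s.A.upd .rv st k 0 (s.v .rnv)) .rv :=
      (hA4 .rv (by simp)).trans ((hA3 .rv (by simp)).trans ((hA2 .rv (by simp)).trans (hA1 .rv (by simp))))
    simp only [wp_set, Exp.eval, St.setv, Function.update_self, Function.update_of_ne, ne_eq,
      reduceCtorEq, not_false_eq_true]
    refine ⟨by omega, Ks ++ [k], ⟨?_, ?_, ?_, ?_, ?_⟩, List.prefix_append _ _, by simp, by simp, by omega⟩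
    · simpa [List.nodup_append, h.nodup] using fun b hb (e : b = k) => hk (by rwa [← e])
    · simp [h.nv]; omega
    · intro k'
      rw [erv]
      by_cases e : k' = k
      · subst e
        simp [Arrays.upd, h.nv, List.idxOf_append_of_notMem hk]
      · by_cases hm : k' ∈ Ks
        · simp [Arrays.upd, e, h.rv, hm, List.idxOf_append_of_mem]
        · simp [Arrays.upd, e, h.rv, hm]
    · intro s' hs'
      rw [erv, ← h.rest s' hs']
      funext x y
      simp [Arrays.upd, hs']
    · rw [runRules_concat hk, List.flatMap_append, ← h.nv]
      simpa [encodeRule] using hO4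

/-- Prepare the replacement of the runs of `ra`. -/
def runsPrepC : Cmd :=
  .seq (.set .rst (.var .rnv)) <| .seq (.set .rm2 (.lit 0)) <| .seq (.set .rj (.lit 0)) <|
  .loop (.lt (.var .rj) (.var .rm)) <|
    .seq (.set .ri (endE 1 (.var .rj))) <|
    .seq (.ite (.eq (tokE (prevE (.var .ri))) (.var .ra)) .skip <|
      .seq (.set .rl (.lit 1)) <| .seq (.set .rx (nextE (.var .ri))) <|
      .seq walkC <| .seq nameC <|
      .seq (.put .F (.lit 0) (.var .rm2) (.lit 0) (.var .ri)) <|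
      .seq (.put .F (.lit 1) (.var .rm2) (.lit 0) (.var .rl)) <|
      .seq (.put .F (.lit 2) (.var .rm2) (.lit 0) (.get .rv (.var .rst) (.var .rl) (.lit 0))) <|
      .set .rm2 (.inc (.var .rm2))) <|
    .set .rj (.inc (.var .rj))

/-- The first `n` entries of `F` are the nodes in `S` among the `E 1 i`, `i < j`. -/
structure RunList (S : Set ℕ) (bl : ℕ → ℕ) (st : ℕ) (Ks : List ℕ) (E : ℕ → ℕ) (F : ℕ → ℕ → ℕ → ℕ)
    (j n : ℕ) : Prop where
  mem : ∀ t < n, F 0 t 0 ∈ S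
  len : ∀ t < n, F 1 t 0 = bl (F 0 t 0)
  name : ∀ t < n, F 2 t 0 = st + Ks.idxOf (bl (F 0 t 0))
  known : ∀ t < n, bl (F 0 t 0) ∈ Ks
  sub : ∀ k ∈ Ks, ∃ t < n, bl (F 0 t 0) = k
  inj : ∀ t < n, ∀ t' < n, F 0 t 0 = F 0 t' 0 → t = t'
  src : ∀ t < n, ∃ i < j, E i = F 0 t 0
  all : ∀ i < j, E i ∈ S → ∃ t < n, F 0 t 0 = E i

lemma RunList.push {S : Set ℕ} {bl : ℕ → ℕ} {st j n : ℕ} {Ks Ks' : List ℕ} {E : ℕ → ℕ}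
    {F F' : ℕ → ℕ → ℕ → ℕ} (h : RunList S bl st Ks E F j n)
    (hE : ∀ i ≤ j, ∀ i' ≤ j, E i = E i' → i = i') (hj : E j ∈ S) (hK : Ks <+: Ks')
    (hk : bl (E j) ∈ Ks') (hK' : ∀ k ∈ Ks', k ∈ Ks ∨ k = bl (E j))
    (h0 : ∀ t, F' 0 t 0 = if t = n then E j else F 0 t 0)
    (h1 : ∀ t, F' 1 t 0 = if t = n then bl (E j) else F 1 t 0)
    (h2 : ∀ t, F' 2 t 0 = if t = n then st + Ks'.idxOf (bl (E j)) else F 2 t 0) :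
    RunList S bl st Ks' E F' (j + 1) (n + 1) := by
  have hlt : ∀ {t}, t < n + 1 → t ≠ n → t < n := by intro t h h'; omega
  have hidx : ∀ k ∈ Ks, Ks'.idxOf k = Ks.idxOf k := by
    intro k hk'
    obtain ⟨D, rfl⟩ := hK
    exact List.idxOf_append_of_mem hk'
  have hnew : ∀ t < n, F 0 t 0 ≠ E j := fun t ht e => by
    obtain ⟨i, hi, e'⟩ := h.src t ht
    have := hE i hi.le j le_rfl (e'.trans e)
    omega
  constructor
  · intro t ht; rw [h0]; split
    exacts [hj, h.mem t (hlt ht (by assumption))]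
  · intro t ht; rw [h0, h1]; split
    exacts [rfl, h.len t (hlt ht (by assumption))]
  · intro t ht; rw [h0, h2]; split
    · rfl
    · have := hlt ht (by assumption)
      rw [h.name t this, hidx _ (h.known t this)]
  · intro t ht; rw [h0]; split
    exacts [hk, hK.subset (h.known t (hlt ht (by assumption)))]
  · intro k hk
    rcases hK' k hk with hk | rfl
    · obtain ⟨t, ht, e⟩ := h.sub k hk
      exact ⟨t, by omega, by rw [h0, if_neg (by omega), e]⟩
    · exact ⟨n, by omega, by rw [h0, if_pos rfl]⟩
  · intro t ht t' ht' e
    rw [h0, h0] at e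
    split_ifs at e with e1 e2 e2
    · omega
    · exact absurd e.symm (hnew t' (by omega))
    · exact absurd e (hnew t (by omega))
    · exact h.inj t (by omega) t' (by omega) e
  · intro t ht; rw [h0]; split
    · exact ⟨j, by omega, rfl⟩
    · obtain ⟨i, hi, e⟩ := h.src t (hlt ht (by assumption))
      exact ⟨i, by omega, e⟩
  · intro i hi hiS
    by_cases e : i = j
    · subst e; exact ⟨n, by omega, by rw [h0, if_pos rfl]⟩
    · obtain ⟨t, ht, e⟩ := h.all i (by omega) hiS
      exact ⟨t, by omega, by rw [h0, if_neg (by omega), e]⟩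

lemma RunList.skip {S : Set ℕ} {bl : ℕ → ℕ} {st j n : ℕ} {Ks : List ℕ} {E : ℕ → ℕ}
    {F : ℕ → ℕ → ℕ → ℕ} (h : RunList S bl st Ks E F j n) (hj : E j ∉ S) :
    RunList S bl st Ks E F (j + 1) n :=
  ⟨h.mem, h.len, h.name, h.known, h.sub, h.inj, fun t ht => by
    obtain ⟨i, hi, e⟩ := h.src t ht; exact ⟨i, by omega, e⟩, fun i hi hiS => by
    by_cases e : i = j
    · subst e; exact absurd hiS hj
    · exact h.all i (by omega) hiS⟩

/-- An occurrence of the square starts a run iff the symbol before it differs. Only from these nodes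
is a run walked through, so the walks are bounded by the total length of the runs. -/
lemma wp_runsPrepC {s : St} {a z e m : ℕ} {Q l : List ℕ} {S : Set ℕ} {bl : ℕ → ℕ}
    (hP : Lnk (z :: (Q ++ [e])) s.A) (h : Runs (tokOf s.A) a S bl Q) (hSQ : ∀ i ∈ S, i ∈ Q)
    (he : tokOf s.A e ≠ a) (ha : s.v .ra = a) (hm : s.v .rm = m)
    (hE : ∀ j < m, (s.A .E 1 j 0 ∈ S ↔ tokOf s.A (s.A .nb 1 (s.A .E 1 j 0) 0) ≠ a))
    (hinj : ∀ j < m, ∀ j' < m, s.A .E 1 j 0 = s.A .E 1 j' 0 → j = j')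
    (hnv : 1 ≤ s.v .rnv) (hrv : ∀ k, s.A .rv (s.v .rnv) k 0 = 0)
    (hO : Outp l (s.v .rolen) s.A) (hk : 22 * m + 7 * Q.length + 30 ≤ s.k) :
    wp runsPrepC (fun s' => ∃ Ks, Names (s.v .rnv) a l Ks (s.A .rv) s'.A (s'.v .rnv) (s'.v .rolen) ∧
      RunList S bl (s.v .rnv) Ks (fun j => s.A .E 1 j 0) (s'.A .F) m (s'.v .rm2) ∧
      s.k ≤ s'.k + 22 * m + 3 * ∑ t ∈ Finset.range (s'.v .rm2), (bl (s'.A .F 0 t 0) - 1) + 4) s := by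
  have hnd : Q.Nodup := by
    have := hP.nodup
    rw [List.nodup_cons, List.nodup_append] at this
    exact this.2.1
  have hsum := fun {n} {F} hF hinj => h.blocks.sum_range_le hnd hSQ
    (fun i hi => by have := h.two_le i hi; omega) (n := n) (F := F) hF hinj
  obtain ⟨E, hEdef⟩ : ∃ E : ℕ → ℕ, E = fun j => s.A .E 1 j 0 := ⟨_, rfl⟩
  obtain ⟨st, hst⟩ : ∃ st, s.v .rnv = st := ⟨_, rfl⟩
  rw [← hEdef]
  have hE' : ∀ j, s.A .E 1 j 0 = E j := fun j => by rw [hEdef]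
  simp only [hE', hst] at hE hinj hnv hrv ⊢
  simp only [runsPrepC, wp_seq_eq, wp_set, Exp.eval, St.setv]
  refine ⟨by omega, by omega, by omega, ?_⟩
  simp only [hst]
  obtain ⟨I, hI⟩ : ∃ I : St → Prop, I = fun s' => ∃ Ks j, s'.v .rj = j ∧ j ≤ m ∧
    Names st a l Ks (s.A .rv) s'.A (s'.v .rnv) (s'.v .rolen) ∧
    RunList S bl st Ks E (s'.A .F) j (s'.v .rm2) ∧
    s.k ≤ s'.k + 22 * j + 3 * ∑ t ∈ Finset.range (s'.v .rm2), (bl (s'.A .F 0 t 0) - 1) + 3 := ⟨_, rfl⟩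
  refine wp_while I ?_ ?_ ?_ ?_
  · rw [hI]
    refine ⟨[], 0, by simp, Nat.zero_le _, ⟨List.nodup_nil, by simp [hst], by simpa using hrv, fun _ _ => rfl,
      by simpa [runRules] using hO⟩, ?_, by simp only; omega⟩
    simp only [Function.update_self, Function.update_of_ne, ne_eq, reduceCtorEq, not_false_eq_true]
    constructor <;> simp
  · intro s' hs' _
    rw [hI] at hs'
    obtain ⟨Ks, j, h1, h2, h3, h4, h5⟩ := hs'
    have := hsum h4.mem h4.inj
    omega
  · intro s' hs' hfr hlt
    rw [hI] at hs'
    obtain ⟨Ks, j, h1, h2, h3, h4, h5⟩ := hs'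
    have hb := hsum h4.mem h4.inj
    have em : s'.v .rm = m := (hfr.v .rm rfl).trans (by simpa using hm)
    have era : s'.v .ra = a := (hfr.v .ra rfl).trans (by simpa using ha)
    have est : s'.v .rst = st := (hfr.v .rst rfl).trans (by simp)
    have eE : s'.A .E = s.A .E := hfr.A .E rfl
    have etok : s'.A .tok = s.A .tok := hfr.A .tok rfl
    have enb : s'.A .nb = s.A .nb := hfr.A .nb rfl
    have etok' : tokOf s'.A = tokOf s.A := by funext z; rw [tokOf, etok, tokOf]
    simp only [Exp.eval, ite_one_ne_zero, em, h1] at hlt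
    have hjS := hE j hlt
    simp only [wp_seq_eq, wp_set, Exp.eval, St.setv, St.tick, endE, h1, eE, hE', Nat.sub_sub]
    refine ⟨by omega, ?_⟩
    rw [wp_ite]
    have ht : Exp.eval ⟨Function.update s'.v .ri (E j), s'.A, s'.k - (1 + 1)⟩
        (.eq (tokE (prevE (.var .ri))) (.var .ra)) =
        if tokOf s.A (s.A .nb 1 (E j) 0) = a then 1 else 0 := by
      simp only [Exp.eval, tokE, prevE, Function.update_self, Function.update_of_ne, ne_eq, reduceCtorEq,
        not_false_eq_true, era, etok, enb]
      rfl
    rw [ht]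
    refine ⟨by simp only; omega, fun hc => ?_, fun hc => ?_⟩
    · replace hc := ite_one_ne_zero.1 hc
      simp only [wp_skip, wp_set, Exp.eval, St.setv, St.tick, Function.update_of_ne,
        ne_eq, reduceCtorEq, not_false_eq_true, h1]
      refine ⟨by omega, by omega, ?_⟩
      rw [hI]
      simp only [Function.update_self, Function.update_of_ne, ne_eq, reduceCtorEq, not_false_eq_true]
      exact ⟨Ks, j + 1, rfl, hlt, h3, h4.skip fun hm => hjS.1 hm hc, by omega⟩
    · replace hc := ite_one_eq_zero.1 hc
      have hS := hjS.2 hc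
      obtain ⟨C, R, hQ⟩ := List.append_of_mem (hSQ _ hS)
      have h2b := h.two_le _ hS
      have hblQ : bl (E j) ≤ Q.length := by
        have := hsum (n := 1) (F := fun _ => E j) (by simpa using hS) (by omega)
        have h3 := congrArg List.length (h.take C _ R hQ hS)
        have h4 := congrArg List.length hQ
        simp at h3 h4
        omega
      simp only [wp_seq_eq, wp_set, Exp.eval, St.setv, St.tick, nextE, Nat.sub_sub]
      refine ⟨by omega, by omega, ?_⟩
      simp only [Function.update_self, Function.update_of_ne, ne_eq, reduceCtorEq, not_false_eq_true, enb]
      obtain ⟨s1, hs1⟩ : ∃ s1 : St, s1 = ⟨Function.update (Function.update (Function.update s'.v .ri (E j)) .rl 1)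
        .rx (s.A .nb 0 (E j) 0), s'.A, s'.k - 5⟩ := ⟨_, rfl⟩
      rw [← hs1]
      have a1 : s1.v .ra = a := by simp [hs1, era]
      have a2 : s1.v .rl = 1 := by simp [hs1]
      have a3 : s1.v .rx = s.A .nb 0 (E j) 0 := by simp [hs1]
      have a4 : s1.v .ri = E j := by simp [hs1]
      have a5 : s1.v .rst = st := by simp [hs1, est]
      have a6 : s1.v .rnv = s'.v .rnv := by simp [hs1]
      have a7 : s1.v .rolen = s'.v .rolen := by simp [hs1]
      have a8 : s1.v .rm2 = s'.v .rm2 := by simp [hs1]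
      have a9 : s1.v .rj = j := by simp [hs1, h1]
      have a10 : s1.A = s'.A := by simp [hs1]
      have a11 : s1.k = s'.k - 5 := by simp [hs1]
      clear hs1
      refine (wp_walkC (s := s1) (a := a) (z := z) (e := e) (i := E j) (Q := Q) (C := C) (R := R) (S := S)
        (bl := bl) (hP.congr (by rw [a10, enb]) (by rw [a10, etok])) (by rw [a10, etok']; exact h) hQ hS
        (by rw [a10, etok']; exact he) a1 a2 (by rw [a3, a10, enb]) (by omega)).fr.mono ?_
      rintro s2 ⟨⟨b1, b2⟩, hfr2⟩
      have c1 : s2.v .ra = a := (hfr2.v .ra rfl).trans a1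
      have c2 : s2.v .rst = st := (hfr2.v .rst rfl).trans a5
      have c3 : s2.v .ri = E j := (hfr2.v .ri rfl).trans a4
      have c4 : s2.v .rnv = s'.v .rnv := (hfr2.v .rnv rfl).trans a6
      have c5 : s2.v .rolen = s'.v .rolen := (hfr2.v .rolen rfl).trans a7
      have c6 : s2.v .rm2 = s'.v .rm2 := (hfr2.v .rm2 rfl).trans a8
      have c7 : s2.v .rj = j := (hfr2.v .rj rfl).trans a9
      have c8 : s2.A = s'.A := by rw [← a10]; funext id; exact hfr2.A id (by cases id <;> rfl)
      refine (wp_nameC (s := s2) (st := st) (a := a) (l := l) (Ks := Ks) (k := bl (E j)) (rv₀ := s.A .rv)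
        (by rw [c8, c4, c5]; exact h3) hnv c2 c1 b1 (by omega)).fr.mono ?_
      rintro s3 ⟨⟨Ks', d1, d2, d3, d4, d5⟩, hfr3⟩
      have f1 : s3.v .rst = st := (hfr3.v .rst rfl).trans c2
      have f2 : s3.v .ri = E j := (hfr3.v .ri rfl).trans c3
      have f3 : s3.v .rl = bl (E j) := (hfr3.v .rl rfl).trans b1
      obtain ⟨n, hn⟩ : ∃ n, s'.v .rm2 = n := ⟨_, rfl⟩
      have f4 : s3.v .rm2 = n := ((hfr3.v .rm2 rfl).trans c6).trans hn
      have f5 : s3.v .rj = j := (hfr3.v .rj rfl).trans c7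
      have f6 : s3.A .F = s'.A .F := (hfr3.A .F rfl).trans (by rw [c8])
      rw [hn] at h4 h5 hb
      have f7 := d1.rv (bl (E j))
      rw [if_pos d3] at f7
      simp only [wp_put, wp_set, Exp.eval, St.setv, St.putA, f1, f2, f3, f4,
        Function.update_of_ne, ne_eq, reduceCtorEq, not_false_eq_true, Arrays.upd_of_ne, f7, f5]
      refine ⟨by omega, by omega, by omega, by omega, by omega, ?_⟩
      rw [hI]
      simp only [Function.update_self, Function.update_of_ne, ne_eq, reduceCtorEq, not_false_eq_true]
      have hF0 : ∀ t, (((s3.A.upd .F 0 n 0 (E j)).upd .F 1 n 0 (bl (E j))).upd .F 2 n 0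
          (st + Ks'.idxOf (bl (E j)))) .F 0 t 0 = if t = n then E j else s'.A .F 0 t 0 := by
        intro t; rw [← f6]; simp [Arrays.upd]
      refine ⟨Ks', j + 1, rfl, hlt, d1.congr (by simp [Arrays.upd_of_ne]) (by simp [Arrays.upd_of_ne]),
        h4.push (fun i hi i' hi' => hinj i (by omega) i' (by omega)) hS d2 d3 d4 hF0 ?_ ?_, ?_⟩
      · intro t; rw [← f6]; simp [Arrays.upd]
      · intro t; rw [← f6]; simp [Arrays.upd]
      · rw [Finset.sum_range_succ, hF0 n, if_pos rfl,
          Finset.sum_congr rfl fun t ht => by rw [hF0 t, if_neg (by simp at ht; omega)]]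
        omega
  · intro s' hs' hfr hlt
    rw [hI] at hs'
    obtain ⟨Ks, j, h1, h2, h3, h4, h5⟩ := hs'
    have em : s'.v .rm = m := (hfr.v .rm rfl).trans (by simpa using hm)
    simp only [Exp.eval, ite_one_eq_zero, em, h1] at hlt
    obtain rfl : j = m := by omega
    have hb := hsum h4.mem h4.inj
    exact ⟨Ks, h3, h4, by simp only [St.tick]; omega⟩

/-! ### The replaced pair does not occur any more -/

/-- Each replacement destroys an occurrence of the pair that starts inside the replaced block. Its
second symbol may lie just behind the block, as happens when `trim` has dropped the last symbol. -/
lemma ReplaceAll.occ_pair_add_count_le {t : List ℕ} {v a b : ℕ} {T T' : List ℕ}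
    (h : ReplaceAll t v T T') (hv : v ∉ T) (ha : a ≠ v) (hb : b ≠ v)
    (ht : ∀ p, At T t p → ∃ o < t.length, At T [a, b] (p + o)) :
    occ T' [a, b] + T'.count v ≤ occ T [a, b] := by
  have head : ∀ {T T'}, ReplaceAll t v T T' → T'.head? = some b → T.head? = some b := by
    intro T T' h hb'
    cases h with
    | nil => simp at hb'
    | hit => simp at hb'; exact absurd hb'.symm hb
    | miss => simpa using hb'
  induction h with
  | nil => simp
  | @hit T T' h ih =>
    simp only [List.mem_append, not_or] at hv
    have h1 := ih hv.2 fun p hp => by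
      obtain ⟨o, ho, h2⟩ := ht (t.length + p) (fun i hi => by
        rw [List.getElem?_append_right (by omega), ← hp i hi]; congr 1; omega)
      refine ⟨o, ho, fun i hi => ?_⟩
      have := h2 i hi
      rwa [List.getElem?_append_right (by omega),
        show t.length + p + o + i - t.length = p + o + i by omega] at this
    -- The occurrence at offset `o` within `t` comes on top of those that start in `T`.
    have h2 : 1 + occ T [a, b] ≤ occ (t ++ T) [a, b] := by
      obtain ⟨o, ho, h2⟩ := ht 0 fun i hi => by rw [zero_add, List.getElem?_append_left hi]
      rw [zero_add, ← prefix_drop_iff] at h2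
      rw [← List.take_append_drop (o + 1) (t ++ T)]
      have e : (t ++ T).drop o = (t ++ T)[o]'(by simp; omega) :: (t ++ T).drop (o + 1) := by simp
      calc 1 + occ T [a, b] ≤ 1 + occ ((t ++ T).drop (o + 1)) [a, b] := by
            rw [List.drop_append_of_le_length (by omega)]
            exact Nat.add_le_add_left (occ_le_append _ _ _) 1
        _ = occ ((t ++ T).drop o) [a, b] := by
            rw [e] at h2 ⊢
            rw [occ_cons, if_pos h2]
        _ ≤ occ ((t ++ T).take o ++ (t ++ T).drop o) [a, b] := occ_le_append _ _ _
        _ = _ := by rw [List.take_append_drop, List.take_append_drop]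
    rw [occ_pair_cons, if_neg fun h => ha h.1.symm, List.count_cons_self]
    omega
  | @miss x T T' hx h ih =>
    simp only [List.mem_cons, not_or] at hv
    have h1 := ih hv.2 fun p hp => by
      obtain ⟨o, ho, h2⟩ := ht (p + 1) (at_cons_succ.2 hp)
      rw [show p + 1 + o = p + o + 1 by omega, at_cons_succ] at h2
      exact ⟨o, ho, h2⟩
    rw [occ_pair_cons, occ_pair_cons, List.count_cons_of_ne (Ne.symm hv.1)]
    by_cases e : x = a ∧ T'.head? = some b
    · rw [if_pos e, if_pos ⟨e.1, head h e.2⟩]; omega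
    · rw [if_neg e]; omega

lemma ReplaceAll.length_eq {t : List ℕ} {v : ℕ} {T T' : List ℕ} (h : ReplaceAll t v T T')
    (hv : v ∉ T) : T.length + T'.count v = T'.length + T'.count v * t.length := by
  induction h with
  | nil => simp
  | hit h ih =>
    simp only [List.mem_append, not_or] at hv
    have := ih hv.2
    rw [List.count_cons_self, Nat.add_mul]
    simp only [List.length_append, List.length_cons]
    omega
  | miss hx h ih =>
    simp only [List.mem_cons, not_or] at hv
    have := ih hv.2
    rw [List.count_cons_of_ne (Ne.symm hv.1)]
    simp only [List.length_cons]
    omega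

/-- Only isolated copies of `x` are kept. -/
lemma ReplaceRuns.occ_self {x : ℕ} {v : ℕ → ℕ} {T T' : List ℕ} (h : ReplaceRuns x v T T')
    (hv : ∀ k, v k ≠ x) : occ T' [x, x] = 0 := by
  have head : ∀ {T T'}, ReplaceRuns x v T T' → T.head? ≠ some x → T'.head? ≠ some x := by
    intro T T' h hT
    cases h with
    | nil => simp
    | other hx => simpa using hx
    | single => simp at hT
    | run => simpa using hv _
  induction h with
  | nil => exact occ_nil (by simp)
  | other hx h ih => rw [occ_pair_cons, if_neg fun h => hx h.1, ih]
  | single hT h ih => rw [occ_pair_cons, if_neg fun h' => head h hT h'.2, ih]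
  | run hk hT h ih => rw [occ_pair_cons, if_neg fun h => hv _ h.1, ih]

/-! ### The invariant of the main loop -/

/-- The arrays represent the state `G` of the algorithm: `Q` is the list of the nodes of the text,
`0` and `e` are the nodes before and after the text, `L` is the list of the rules. -/
structure Inv (ex : ℕ × ℕ) (Q : List ℕ) (e T : ℕ) (G : AlgState) (L : List Rule) (A : Arrays) (nv ol : ℕ) :
    Prop where
  full : Full (0 :: (Q ++ [e])) ex T A
  tok_zero : tokOf A 0 = 0
  tok_end : tokOf A e = 0
  tok_ne : ∀ i ∈ Q, tokOf A i ≠ 0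
  text : G.text = Q.map (tokOf A)
  text_lt : ∀ x ∈ G.text, x < nv
  vars_lt : ∀ x ∈ G.vars, x < nv
  rules_lt : ∀ ρ ∈ G.rules, ρ.1 < nv
  nodup : L.Nodup
  rules : L.toFinset = G.rules
  out : Outp (L.flatMap encodeRule) ol A
  rv : ∀ s, nv ≤ s → ∀ k, A .rv s k 0 = 0
  nv_pos : 1 ≤ nv

lemma Inv.congr {ex ex' : ℕ × ℕ} {Q : List ℕ} {e T T' : ℕ} {G : AlgState} {L : List Rule}
    {A A' : Arrays} {nv ol : ℕ} (h : Inv ex Q e T G L A nv ol)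
    (hF : Full (0 :: (Q ++ [e])) ex' T' A') (h1 : A' .tok = A .tok) (h2 : A' .out = A .out)
    (h3 : A' .rv = A .rv) : Inv ex' Q e T' G L A' nv ol := by
  have : tokOf A' = tokOf A := by funext z; rw [tokOf, h1, tokOf]
  exact ⟨hF, by rw [this]; exact h.tok_zero, by rw [this]; exact h.tok_end,
    by rw [this]; exact h.tok_ne, by rw [this]; exact h.text, h.text_lt, h.vars_lt, h.rules_lt, h.nodup,
    h.rules, h.out.congr h2, by rw [h3]; exact h.rv, h.nv_pos⟩

lemma Inv.zero_notMem {ex : ℕ × ℕ} {Q : List ℕ} {e T : ℕ} {G : AlgState} {L : List Rule}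
    {A : Arrays} {nv ol : ℕ} (h : Inv ex Q e T G L A nv ol) : 0 ∉ G.text := by
  rw [h.text]
  intro h0
  obtain ⟨i, hi, hi'⟩ := List.mem_map.1 h0
  exact h.tok_ne i hi hi'

/-- What a round achieves, apart from the time. -/
structure RoundPost (f : ℕ) (Q : List ℕ) (e T : ℕ) (G : AlgState) (Q' : List ℕ) (T' : ℕ)
    (G' : AlgState) (L' : List Rule) (s' : St) : Prop where
  round : Round G G'
  inv : Inv (0, 0) Q' e T' G' L' s'.A (s'.v .rnv) (s'.v .rolen)
  mark : ∀ i, s'.A .mark i 0 0 < s'.v .rnv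
  max : ∀ a b, occ (pad G'.text) [a, b] ≤ f
  len : Q'.length + f ≤ Q.length
  tot : T' + 10 * Q'.length ≤ T + 10 * Q.length

lemma map_sentinels {Q : List ℕ} {e : ℕ} {g : ℕ → ℕ} (h0 : g 0 = 0) (he : g e = 0) :
    (0 :: (Q ++ [e])).map g = pad (Q.map g) := by simp [pad, h0, he]

/-- Translates the collected nodes into positions, with which the extension starts. -/
lemma Win.of_pair {P : List ℕ} {g : ℕ → ℕ} {a b m : ℕ} {e₀ e₁ : ℕ → ℕ} {A : Arrays}
    (hP : Lnk P A) (h : ∀ i, (i, a, b) ∈ bg g P ↔ ∃ j < m, e₁ j = i)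
    (hinj : ∀ j < m, ∀ j' < m, e₁ j = e₁ j' → j = j') (h0 : ∀ j < m, e₀ j = A .nb 0 (e₁ j) 0) :
    Win (P.map g) P [a, b] m e₀ e₁ := by
  have key : ∀ j < m, ∃ p i', P[p]? = some (e₁ j) ∧ P[p + 1]? = some i' ∧ g (e₁ j) = a ∧ g i' = b := by
    intro j hj
    obtain ⟨p, i, i', h1, h2, h3⟩ := mem_bg.1 ((h _).2 ⟨j, hj, rfl⟩)
    simp only [Prod.mk.injEq] at h3
    obtain ⟨rfl, h4, h5⟩ := h3
    exact ⟨p, i', h1, h2, h4.symm, h5.symm⟩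
  have key' : ∀ j, ∃ p, j < m → ∃ i', P[p]? = some (e₁ j) ∧ P[p + 1]? = some i' ∧ g (e₁ j) = a ∧
      g i' = b := by
    intro j
    by_cases hj : j < m
    · obtain ⟨p, h⟩ := key j hj; exact ⟨p, fun _ => h⟩
    · exact ⟨0, fun h => absurd h hj⟩
  choose p hp using key'
  have hat : ∀ q, At (P.map g) [a, b] q ↔ ∃ i i', P[q]? = some i ∧ P[q + 1]? = some i' ∧ g i = a ∧ g i' = b := by
    intro q
    constructor
    · intro hq
      have h1 := hq 0 (by simp)
      have h2 := hq 1 (by simp)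
      rw [List.getElem?_map] at h1 h2
      obtain ⟨i, hi, hi'⟩ := Option.map_eq_some_iff.1 h1
      obtain ⟨j, hj, hj'⟩ := Option.map_eq_some_iff.1 h2
      exact ⟨i, j, hi, hj, hi', hj'⟩
    · rintro ⟨i, i', h1, h2, h3, h4⟩ o ho
      have : o = 0 ∨ o = 1 := by simp at ho; omega
      rcases this with rfl | rfl
      · simp [h1, h3]
      · simp [h2, h4]
  refine ⟨p, fun j hj => ?_, fun j hj j' hj' e => ?_, fun q hq => ?_⟩
  · obtain ⟨i', h1, h2, h3, h4⟩ := hp j hj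
    exact ⟨(hat _).2 ⟨_, _, h1, h2, h3, h4⟩, h1, by
      rw [h0 j hj, (hP.next h1 h2).1]; simpa using h2⟩
  · obtain ⟨_, h1, -⟩ := hp j hj
    obtain ⟨_, h2, -⟩ := hp j' hj'
    rw [e, h2] at h1
    exact hinj j hj j' hj' (Option.some.inj h1).symm
  · obtain ⟨i, i', h1, h2, h3, h4⟩ := (hat q).1 hq
    obtain ⟨j, hj, e⟩ := (h i).1 (mem_bg.2 ⟨q, i, i', h1, h2, by rw [h3, h4]⟩)
    refine ⟨j, hj, ?_⟩
    obtain ⟨_, h5, -⟩ := hp j hj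
    rw [e, ← h1] at h5
    have hq : q < P.length := (List.getElem?_eq_some_iff.1 h1).1
    exact ((List.getElem?_inj hq hP.nodup).1 h5.symm).symm

/-! ### The nodes where a repeat starts. -/

section
variable {Q r : List ℕ} {e m : ℕ} {g : ℕ → ℕ} {e₀ e₁ : ℕ → ℕ} {A : Arrays}

/-- The nodes where the occurrences of `r` start. -/
lemma Win.mem_iff (hP : Lnk (0 :: (Q ++ [e])) A) (h0 : 0 ∉ r)
    (h : Win (pad (Q.map g)) (0 :: (Q ++ [e])) r m e₀ e₁) {C R : List ℕ} {i : ℕ}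
    (hQ : Q = C ++ i :: R) : (∃ j < m, e₁ j = i) ↔ r <+: (i :: R).map g := by
  obtain ⟨p, h1, h2, h3⟩ := h
  rw [← at_pad_iff hQ h0]
  have hi : (0 :: (Q ++ [e]))[C.length + 1]? = some i := getElem?_of_split hQ
  have hlt : C.length + 1 < (0 :: (Q ++ [e])).length := (List.getElem?_eq_some_iff.1 hi).1
  constructor
  · rintro ⟨j, hj, rfl⟩
    obtain ⟨g1, g2, -⟩ := h1 j hj
    rw [(List.getElem?_inj hlt hP.nodup).1 (hi.trans g2.symm)]
    exact g1
  · intro hr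
    obtain ⟨j, hj, e⟩ := h3 _ hr
    have := (h1 j hj).2.1
    rw [e, hi] at this
    exact ⟨j, hj, (Option.some.inj this).symm⟩

lemma Win.inj (hP : Lnk (0 :: (Q ++ [e])) A)
    (h : Win (pad (Q.map g)) (0 :: (Q ++ [e])) r m e₀ e₁) :
    ∀ j < m, ∀ j' < m, e₁ j = e₁ j' → j = j' := by
  obtain ⟨p, h1, h2, h3⟩ := h
  intro j hj j' hj' he
  obtain ⟨-, g2, -⟩ := h1 j hj
  obtain ⟨-, g2', -⟩ := h1 j' hj'
  have hlt : p j < (0 :: (Q ++ [e])).length := (List.getElem?_eq_some_iff.1 g2).1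
  exact h2 j hj j' hj' ((List.getElem?_inj hlt hP.nodup).1 (by rw [g2, g2', he]))

lemma Win.mem (hg0 : g 0 = 0) (hge : g e = 0) (h0 : 0 ∉ r) (hr : r ≠ [])
    (h : Win (pad (Q.map g)) (0 :: (Q ++ [e])) r m e₀ e₁) : ∀ j < m, e₁ j ∈ Q := by
  obtain ⟨p, h1, h2, h3⟩ := h
  intro j hj
  obtain ⟨g1, g2, -⟩ := h1 j hj
  have hr1 := List.length_pos_of_ne_nil hr
  have h4 := g1 0 hr1
  rw [← map_sentinels hg0 hge, Nat.add_zero, List.getElem?_map, g2, List.getElem?_eq_getElem hr1] at h4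
  have h5 : g (e₁ j) ≠ 0 := by
    intro h; rw [Option.map_some, h] at h4
    exact h0 (Option.some.inj h4 ▸ List.getElem_mem _)
  have h6 := List.mem_of_getElem? g2
  simp only [List.mem_cons, List.mem_append, List.not_mem_nil, or_false] at h6
  rcases h6 with h6 | h6 | h6
  · rw [h6] at h5; exact absurd hg0 h5
  · exact h6
  · rw [h6] at h5; exact absurd hge h5

end

/-! ### A round for a repeat that is not a square of a variable -/

/-- The inequality with `f * (r.length - 1)` says that the number of deleted nodes is at least half
the work spent on extending the occurrences. -/
lemma wp_plainC {s : St} {Q r : List ℕ} {e T f a b : ℕ} {G : AlgState} {L : List Rule}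
    (h : Inv (a, b) Q e T G L s.A (s.v .rnv) (s.v .rolen)) (hm : s.v .rm = f) (hf : 2 ≤ f)
    (hmax : ∀ a b, occ (pad G.text) [a, b] ≤ f) (hr : s.v .rlen = r.length) (hr2 : 2 ≤ r.length)
    (hw : Win (pad G.text) (0 :: (Q ++ [e])) r f (fun j => s.A .E 0 j 0) (fun j => s.A .E 1 j 0))
    (h1 : ∀ c, occ (pad G.text) (c :: r) ≠ f) (h2 : ∀ c, occ (pad G.text) (r ++ [c]) ≠ f)
    (hsq : ∀ x, r ≠ [x, x]) (hin : [a, b] <:+: r) (hab : occ (pad G.text) [a, b] = f)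
    (hmark : ∀ i, s.A .mark i 0 0 ≤ s.v .rnv) (hk : 200 * Q.length + 100 ≤ s.k) :
    wp (.seq plainPrepC replaceC) (fun s' => ∃ Q' T' G' L', RoundPost f Q e T G Q' T' G' L' s' ∧
      f * (r.length - 1) + 2 * Q'.length ≤ 2 * Q.length ∧
      s.k + 90 * Q'.length ≤ s'.k + 90 * Q.length + 40) s := by
  obtain ⟨nv, hnv⟩ : ∃ nv, s.v .rnv = nv := ⟨_, rfl⟩
  obtain ⟨X, hX⟩ : ∃ X, G.text = X := ⟨_, rfl⟩
  obtain ⟨tl, htl⟩ : ∃ tl, (trim r).length = tl := ⟨_, rfl⟩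
  have hXQ : X = Q.map (tokOf s.A) := hX ▸ h.text
  rw [hX] at hmax hw h1 h2 hab
  rw [hnv] at h hmark
  have hP := h.full.lnk
  have hPX : (0 :: (Q ++ [e])).map (tokOf s.A) = pad X := by
    rw [map_sentinels h.tok_zero h.tok_end, hXQ]
  have hne : r ≠ [] := by rintro rfl; simp at hr2
  have h0X : 0 ∉ X := hX ▸ h.zero_notMem
  have hrf := hw.occ_eq hne
  have h0r : 0 ∉ r := zero_notMem_of_two_le_occ h0X hr2 (by omega)
  have h0ab : 0 ∉ [a, b] := fun h0 => h0r (hin.subset h0)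
  have htr := trim_length hr2
  rw [htl] at htr
  have h0t : 0 ∉ trim r := fun h0 => h0r (by
    obtain ⟨w, e⟩ := trim_prefix r; rw [e]; exact List.mem_append_left _ h0)
  have hmaxX : ∀ a b, occ X [a, b] ≤ f := fun a b => (occ_le_occ_pad X h0X (by simp)).trans (hmax a b)
  have hrfX : occ X r = f := by rw [← hrf, occ_pad hne h0r]
  have habX : occ X [a, b] = f := by rw [← hab, occ_pad (by simp) h0ab]
  have hltX : ∀ x ∈ X, x < nv := hX ▸ h.text_lt
  have hnvX : nv ∉ X := fun hx => lt_irrefl _ (hltX _ hx)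
  have haX : ∀ x ∈ [a, b], x ∈ X := fun x hx => by
    by_contra hc
    have := occ_eq_zero_of_notMem hx hc
    omega
  have hlenXQ : X.length = Q.length := by rw [hXQ, List.length_map]
  have hbound : f * (tl - 1) ≤ Q.length := by
    have := mul_length_le (r := trim r) hmaxX (by omega) (occ_trim hmaxX hr2 hrfX)
    rwa [htl, hlenXQ] at this
  -- The trimmed repeat has length `u + 2`, so each replacement deletes `u + 1` nodes.
  obtain ⟨u, rfl⟩ : ∃ u, tl = u + 2 := ⟨tl - 2, by omega⟩
  rw [show u + 2 - 1 = u + 1 by omega, Nat.mul_add, mul_one] at hbound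
  have hub : 2 * u ≤ f * u := Nat.mul_le_mul_right _ hf
  rw [wp_seq]
  refine (wp_plainPrepC (s := s) (L := X) (P := 0 :: (Q ++ [e])) (r := r) (m := f) hP hPX hm (by omega) hr hr2
    hw h.out (by omega)).fr.mono ?_
  rintro s1 ⟨⟨a1, a2, a3, a4, a5⟩, hfr1⟩
  rw [hnv] at a1 a3 a4
  rw [htl] at a3 a5
  have etok1 : s1.A .tok = s.A .tok := hfr1.A .tok rfl
  have etok : tokOf s1.A = tokOf s.A := by funext z; rw [tokOf, etok1, tokOf]
  obtain ⟨S, hS⟩ : ∃ S : Set ℕ, S = {i | ∃ j < f, s.A .E 1 j 0 = i} := ⟨_, rfl⟩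
  have hSmem : ∀ i, i ∈ S ↔ ∃ j < f, s.A .E 1 j 0 = i := by intro i; rw [hS]; rfl
  rw [hXQ] at hw
  have hSpre : ∀ C i R, Q = C ++ i :: R → (i ∈ S ↔ trim r <+: (i :: R).map (tokOf s.A)) := by
    intro C i R hQ
    rw [hSmem, hw.mem_iff hP h0r hQ, ← at_pad_iff hQ h0r, ← at_pad_iff hQ h0t, ← hXQ,
      at_trim hmax hr2 hrf]
  have hSQ : ∀ i ∈ S, i ∈ Q := by
    intro i hi
    obtain ⟨j, hj, rfl⟩ := (hSmem i).1 hi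
    exact hw.mem h.tok_zero h.tok_end h0r hne j hj
  have hblocks : Blocks S (fun _ => u + 2) Q := by
    refine blocks_of_sep (r := trim r) hSpre h0t (fun _ _ => htl.symm) fun p q hp hq hpq => ?_
    rw [← hXQ, at_trim hmax hr2 hrf] at hp hq
    exact At.trim_sep hmax hr2 hrf hsq hp hq hpq
  refine (wp_replaceC (s := s1) (Q := Q) (z := 0) (e := e) (ex := (a, b)) (T := T) (m := f) (S := S)
    (bl := fun _ => u + 2) (nm := fun _ => nv) (F := fun j => s.A .E 1 j 0)
    (h.full.congr (hfr1.A .cnt rfl) (hfr1.A .slen rfl) (hfr1.A .st1 rfl) (hfr1.A .st2 rfl)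
      (hfr1.A .nb rfl) etok1) a2 (fun j hj => (a3 j hj).1) (fun j hj => (a3 j hj).2.1)
    (fun j hj => (a3 j hj).2.2) hSmem (hw.inj hP) hSQ hblocks (fun _ _ => by omega) (by omega)).fr.mono ?_
  rintro s2 ⟨⟨Q', T', b1, b2, b3, b4, b5, b6, b7⟩, hfr2⟩
  rw [etok] at b5 b6
  simp only [Finset.sum_const, Finset.card_range, smul_eq_mul] at b7
  rw [show u + 2 - 1 = u + 1 by omega] at b7
  have hrep : ReplaceAll (trim r) nv X (Q'.map (tokOf s2.A)) := by
    rw [hXQ]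
    exact b1.replaceAll hSpre (fun _ _ => htl.symm) b5
  have hnd := hP.nodup
  rw [List.nodup_cons, List.nodup_append] at hnd
  have h0Q : 0 ∉ Q := fun h0 => hnd.1 (by simp [h0])
  have heQ : e ∉ Q := fun h0 => hnd.2.2.2 e h0 e (by simp) rfl
  have c0 : tokOf s2.A 0 = 0 := by rw [b6 0 h0Q, h.tok_zero]
  have ce : tokOf s2.A e = 0 := by rw [b6 e heQ, h.tok_end]
  have cne : ∀ i ∈ Q', tokOf s2.A i ≠ 0 := by
    intro i hi
    by_cases hiS : i ∈ S
    · rw [(b5 i hi).1 hiS]; have := h.nv_pos; omega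
    · rw [(b5 i hi).2 hiS]; exact h.tok_ne i (b1.subset hi)
  have clt : ∀ x ∈ Q'.map (tokOf s2.A), x < nv + 1 := by
    intro x hx
    obtain ⟨i, hi, rfl⟩ := List.mem_map.1 hx
    by_cases hiS : i ∈ S
    · rw [(b5 i hi).1 hiS]; omega
    · rw [(b5 i hi).2 hiS]
      exact (hltX _ (by rw [hXQ]; exact List.mem_map_of_mem (b1.subset hi))).trans (Nat.lt_succ_self _)
  have c0X : 0 ∉ Q'.map (tokOf s2.A) := by
    intro h0
    obtain ⟨i, hi, hi'⟩ := List.mem_map.1 h0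
    exact cne i hi hi'
  -- The loss of length is known to be `f * (u + 1)`, which determines the number of replacements.
  have hcount : (Q'.map (tokOf s2.A)).count nv = f := by
    have := hrep.length_eq hnvX
    rw [htl, hlenXQ, List.length_map] at this
    refine Nat.eq_of_mul_eq_mul_right (show 0 < u + 1 by omega) ?_
    rw [show u + 2 = u + 1 + 1 by omega, Nat.mul_add _ (u + 1)] at this
    omega
  -- The pair had `f` occurrences and each of the `f` replacements destroys one.
  have hgone : occ (Q'.map (tokOf s2.A)) [a, b] = 0 := by
    have := hrep.occ_pair_add_count_le (a := a) (b := b) hnvX (hltX a (haX a (by simp))).ne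
      (hltX b (haX b (by simp))).ne fun p hp => by
        rw [at_trim hmaxX hr2 hrfX] at hp
        obtain ⟨x, y, hxy⟩ := hin
        rw [← hxy] at hp
        have hl := congrArg List.length hxy
        simp only [List.length_append, List.length_cons, List.length_nil] at hl
        exact ⟨x.length, by omega, hp.of_append_left.of_append_right⟩
    rw [hcount, habX] at this
    omega
  have d1 : s2.v .rnv = nv + 1 := (hfr2.v .rnv rfl).trans a1
  have d2 : s2.v .rolen = s1.v .rolen := hfr2.v .rolen rfl
  have d3 : s2.A .mark = s.A .mark := (hfr2.A .mark rfl).trans (hfr1.A .mark rfl)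
  have d4 : s2.A .rv = s.A .rv := (hfr2.A .rv rfl).trans (hfr1.A .rv rfl)
  have hfresh : (nv, Rhs.seq (trim r)) ∉ G.rules := fun hm => lt_irrefl _ (h.rules_lt _ hm)
  refine ⟨Q', T', ⟨Q'.map (tokOf s2.A), insert nv G.vars, insert (nv, .seq (trim r)) G.rules⟩,
    L ++ [(nv, .seq (trim r))], ⟨?_, ⟨?_, c0, ce, cne, rfl, ?_, ?_, ?_, ?_, ?_, ?_, ?_, ?_⟩, ?_, ?_, ?_, b3⟩, ?_, ?_⟩
  · refine Round.plain r nv (by rw [hX]; exact mostFrequent_of_not_extendable h0X hf hmax hr2 hrf h1 h2)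
      hsq (fun hm => lt_irrefl _ (h.vars_lt _ hm)) (by rw [hX]; exact hrep)
  · exact b2.unexcept (by rw [map_sentinels c0 ce, occ_pad (by simp) h0ab, hgone])
  · rw [d1]; exact clt
  · rw [d1]
    intro x hx
    rcases Finset.mem_insert.1 hx with rfl | hx
    · exact Nat.lt_succ_self _
    · exact Nat.lt_succ_of_lt (h.vars_lt x hx)
  · rw [d1]
    intro x hx
    rcases Finset.mem_insert.1 hx with rfl | hx
    · simp
    · exact Nat.lt_succ_of_lt (h.rules_lt x hx)
  · rw [List.nodup_append]
    refine ⟨h.nodup, by simp, fun x hx y hy e => hfresh ?_⟩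
    simp only [List.mem_singleton] at hy
    rw [← h.rules, List.mem_toFinset, ← hy, ← e]
    exact hx
  · ext x
    simp [← h.rules, or_comm]
  · rw [d2, List.flatMap_append]
    refine Outp.congr ?_ (hfr2.A .out rfl)
    simpa using a4
  · rw [d1, d4]
    exact fun s' hs' => h.rv s' (by omega)
  · omega
  · intro i
    rw [d3, d1]
    exact Nat.lt_succ_of_le (hmark i)
  · exact occ_pair_pad_le c0X (by omega) (hrep.occ_pair_le_of (by rintro e; simp [e] at htl) hnvX
      (occ_trim hmaxX hr2 hrfX).le hmaxX)
  · rw [Nat.mul_add, mul_one] at b7; omega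
  -- `|r| - 1 ≤ u + 2 ≤ 2 * (u + 1)`.
  · have h3 : f * (r.length - 1) ≤ f * (u + 2) := Nat.mul_le_mul_left f (by omega)
    rw [Nat.mul_add] at h3 b7
    omega
  · rw [Nat.mul_add, mul_one] at b7
    omega

/-! ### A round for a square of a variable -/

/-- The names of the runs as a function of all numbers. -/
def runName (st : ℕ) (Ks : List ℕ) (k : ℕ) : ℕ :=
  if k ∈ Ks then st + Ks.idxOf k else st + Ks.length + k

/-- All values are fresh, also for lengths that do not occur, as `ReplaceRuns.occ_pair_le_of`
requires. -/
lemma le_runName (st : ℕ) (Ks : List ℕ) (k : ℕ) : st ≤ runName st Ks k := by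
  unfold runName; split <;> omega

lemma runName_lt {st : ℕ} {Ks : List ℕ} {k : ℕ} (hk : k ∈ Ks) :
    runName st Ks k < st + Ks.length := by
  rw [runName, if_pos hk]
  have := List.idxOf_lt_length_iff.2 hk
  omega

lemma runName_inj {st : ℕ} {Ks : List ℕ} {k k' : ℕ} (hk : k ∈ Ks) (hk' : k' ∈ Ks)
    (h : runName st Ks k = runName st Ks k') : k = k' := by
  rw [runName, if_pos hk, runName, if_pos hk'] at h
  exact (List.idxOf_inj hk).1 (by omega)

lemma runRules_eq (st a : ℕ) (Ks : List ℕ) :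
    runRules st a Ks = Ks.map fun k => (runName st Ks k, Rhs.run a k) :=
  List.map_congr_left fun k hk => by rw [runName, if_pos hk]

/-- Replacing all runs deletes exactly `f` nodes, one per occurrence of the square, and this pays
for the round. -/
lemma wp_runsC {s : St} {Q : List ℕ} {e T f a : ℕ} {G : AlgState} {L : List Rule}
    (h : Inv (a, a) Q e T G L s.A (s.v .rnv) (s.v .rolen)) (hm : s.v .rm = f) (ha : s.v .ra = a)
    (hf : 2 ≤ f) (hmax : ∀ a b, occ (pad G.text) [a, b] ≤ f)
    (hw : Win (pad G.text) (0 :: (Q ++ [e])) [a, a] f (fun j => s.A .E 0 j 0) (fun j => s.A .E 1 j 0))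
    (h1 : ∀ c, occ (pad G.text) [c, a, a] ≠ f) (h2 : ∀ c, occ (pad G.text) [a, a, c] ≠ f)
    (hmark : ∀ i, s.A .mark i 0 0 ≤ s.v .rnv) (hk : 200 * Q.length + 100 ≤ s.k) :
    wp (.seq runsPrepC replaceC) (fun s' => ∃ Q' T' G' L', RoundPost f Q e T G Q' T' G' L' s' ∧
      s.k + 90 * Q'.length ≤ s'.k + 90 * Q.length + 40) s := by
  obtain ⟨nv, hnv⟩ : ∃ nv, s.v .rnv = nv := ⟨_, rfl⟩
  obtain ⟨X, hX⟩ : ∃ X, G.text = X := ⟨_, rfl⟩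
  have hXQ : X = Q.map (tokOf s.A) := hX ▸ h.text
  rw [hX] at hmax hw h1 h2
  rw [hnv] at h hmark
  have hP := h.full.lnk
  have hPX : (0 :: (Q ++ [e])).map (tokOf s.A) = pad X := by
    rw [map_sentinels h.tok_zero h.tok_end, hXQ]
  have h0X : 0 ∉ X := hX ▸ h.zero_notMem
  have hrf := hw.occ_eq (by simp)
  have h0r : 0 ∉ [a, a] := zero_notMem_of_two_le_occ h0X (by simp) (by omega)
  have ha0 : a ≠ 0 := by rintro rfl; simp at h0r
  have hmaxX : ∀ a b, occ X [a, b] ≤ f := fun a b => (occ_le_occ_pad X h0X (by simp)).trans (hmax a b)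
  have hrfX : occ X [a, a] = f := by rw [← hrf, occ_pad (by simp) h0r]
  have hltX : ∀ x ∈ X, x < nv := hX ▸ h.text_lt
  have haX : a ∈ X := by
    by_contra hc
    have := occ_eq_zero_of_notMem (u := [a, a]) (by simp) hc
    omega
  have hlenXQ : X.length = Q.length := by rw [hXQ, List.length_map]
  have hbound : f ≤ Q.length := by
    have := mul_length_le (r := [a, a]) hmaxX (by simp) hrfX
    simpa [hlenXQ] using this
  have hnd := hP.nodup
  rw [List.nodup_cons, List.nodup_append] at hnd
  have h0Q : 0 ∉ Q := fun h0 => hnd.1 (by simp [h0])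
  have heQ : e ∉ Q := fun h0 => hnd.2.2.2 e h0 e (by simp) rfl
  obtain ⟨S, bl, hruns, hSQ⟩ := exists_runs hnd.2.1 (tokOf s.A) a
  rw [hXQ] at hw
  have hEQ : ∀ j < f, s.A .E 1 j 0 ∈ Q := hw.mem h.tok_zero h.tok_end h0r (by simp)
  have hSE : ∀ i ∈ S, ∃ j < f, s.A .E 1 j 0 = i := by
    intro i hi
    obtain ⟨C, R, hQ⟩ := List.append_of_mem (hSQ i hi)
    obtain ⟨g1, g2, -⟩ := (hruns.mem C i R hQ).1 hi
    refine (hw.mem_iff hP h0r hQ).2 ?_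
    obtain - | ⟨y, R⟩ := R
    · simp at g2
    · simp at g2; simp [g1, g2]
  have hE : ∀ j < f, (s.A .E 1 j 0 ∈ S ↔ tokOf s.A (s.A .nb 1 (s.A .E 1 j 0) 0) ≠ a) := by
    intro j hj
    obtain ⟨i, hi⟩ : ∃ i, s.A .E 1 j 0 = i := ⟨_, rfl⟩
    obtain ⟨C, R, hQ⟩ := List.append_of_mem (hEQ j hj)
    have hp := (hw.mem_iff hP h0r hQ).1 ⟨j, hj, rfl⟩
    rw [hi] at hQ hp ⊢
    rw [hruns.mem C i R hQ]
    have hat : tokOf s.A i = a ∧ R.head?.map (tokOf s.A) = some a := by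
      obtain - | ⟨y, R⟩ := R
      · have := hp.length_le; simp at this
      · simp only [List.map_cons, List.cons_prefix_cons] at hp
        simp [← hp.1, ← hp.2.1]
    have hi1 : (0 :: (Q ++ [e]))[C.length + 1]? = some i := getElem?_of_split hQ
    rcases List.eq_nil_or_concat C with rfl | ⟨C, y, rfl⟩
    · have := (hP.next (p := 0) (i := 0) rfl hi1).2
      rw [this, h.tok_zero]
      simp [hat, ha0.symm]
    · have hy : (0 :: (Q ++ [e]))[C.length + 1]? = some y := by
        rw [hQ]; simp
      rw [List.concat_eq_append, List.length_append, List.length_singleton] at hi1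
      rw [(hP.next hy hi1).2]
      simp [hat]
  rw [wp_seq]
  refine (wp_runsPrepC (s := s) (a := a) (z := 0) (e := e) (m := f) (Q := Q) (l := L.flatMap encodeRule)
    (S := S) (bl := bl) hP hruns hSQ (by rw [h.tok_end]; exact ha0.symm) ha hm hE (hw.inj hP)
    (by rw [hnv]; exact h.nv_pos) (by rw [hnv]; exact h.rv nv le_rfl) h.out (by omega)).fr.mono ?_
  rintro s1 ⟨⟨Ks, a1, a2, a3⟩, hfr1⟩
  rw [hnv] at a1 a2
  have etok1 : s1.A .tok = s.A .tok := hfr1.A .tok rfl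
  have etok : tokOf s1.A = tokOf s.A := by funext z; rw [tokOf, etok1, tokOf]
  obtain ⟨m2, hm2⟩ : ∃ m2, s1.v .rm2 = m2 := ⟨_, rfl⟩
  rw [hm2] at a2 a3
  have hSmem : ∀ i, i ∈ S ↔ ∃ t < m2, s1.A .F 0 t 0 = i := by
    intro i
    constructor
    · intro hi
      obtain ⟨j, hj, rfl⟩ := hSE i hi
      exact a2.all j hj hi
    · rintro ⟨t, ht, rfl⟩
      exact a2.mem t ht
  have hblK : ∀ i ∈ S, bl i ∈ Ks := by
    intro i hi
    obtain ⟨t, ht, rfl⟩ := (hSmem i).1 hi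
    exact a2.known t ht
  have hbs := hruns.blocks.sum_range_le hnd.2.1 hSQ (fun i hi => by have := hruns.two_le i hi; omega)
    a2.mem a2.inj
  refine (wp_replaceC (s := s1) (Q := Q) (z := 0) (e := e) (ex := (a, a)) (T := T) (m := m2) (S := S)
    (bl := bl) (nm := fun i => runName nv Ks (bl i)) (F := fun t => s1.A .F 0 t 0)
    (h.full.congr (hfr1.A .cnt rfl) (hfr1.A .slen rfl) (hfr1.A .st1 rfl) (hfr1.A .st2 rfl)
      (hfr1.A .nb rfl) etok1) hm2 (fun _ _ => rfl) a2.len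
    (fun t ht => by rw [a2.name t ht, runName, if_pos (a2.known t ht)]) hSmem a2.inj hSQ
    hruns.blocks hruns.two_le (by omega)).fr.mono ?_
  rintro s2 ⟨⟨Q', T', b1, b2, b3, b4, b5, b6, b7⟩, hfr2⟩
  rw [etok] at b5 b6
  have hrep : ReplaceRuns a (runName nv Ks) X (Q'.map (tokOf s2.A)) := by
    rw [hXQ]
    exact b1.replaceRuns hruns b5
  have hlen : Q.length = Q'.length + f := by
    have := hrep.length_eq
    rwa [hlenXQ, List.length_map, hrfX] at this
  have hm2pos : m2 ≠ 0 := by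
    rintro rfl
    simp at b7
    omega
  have hKpos : 1 ≤ Ks.length := by
    have := a2.known 0 (by omega)
    exact List.length_pos_of_mem this
  have hnvX : ∀ k, runName nv Ks k ∉ X := fun k hx =>
    absurd (le_runName nv Ks k) (not_le.2 (hltX _ hx))
  have c0 : tokOf s2.A 0 = 0 := by rw [b6 0 h0Q, h.tok_zero]
  have ce : tokOf s2.A e = 0 := by rw [b6 e heQ, h.tok_end]
  have cne : ∀ i ∈ Q', tokOf s2.A i ≠ 0 := by
    intro i hi
    by_cases hiS : i ∈ S
    · rw [(b5 i hi).1 hiS]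
      have := h.nv_pos
      have := le_runName nv Ks (bl i)
      omega
    · rw [(b5 i hi).2 hiS]; exact h.tok_ne i (b1.subset hi)
  have clt : ∀ x ∈ Q'.map (tokOf s2.A), x < nv + Ks.length := by
    intro x hx
    obtain ⟨i, hi, rfl⟩ := List.mem_map.1 hx
    by_cases hiS : i ∈ S
    · rw [(b5 i hi).1 hiS]; exact runName_lt (hblK i hiS)
    · rw [(b5 i hi).2 hiS]
      exact Nat.lt_add_right _ (hltX _ (by rw [hXQ]; exact List.mem_map_of_mem (b1.subset hi)))
  have c0X : 0 ∉ Q'.map (tokOf s2.A) := by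
    intro h0
    obtain ⟨i, hi, hi'⟩ := List.mem_map.1 h0
    exact cne i hi hi'
  have hgone := hrep.occ_self fun k e => hnvX k (by rw [e]; exact haX)
  have d1 : s2.v .rnv = nv + Ks.length := (hfr2.v .rnv rfl).trans a1.nv
  have d2 : s2.v .rolen = s1.v .rolen := hfr2.v .rolen rfl
  have d3 : s2.A .mark = s.A .mark := (hfr2.A .mark rfl).trans (hfr1.A .mark rfl)
  have hfresh : ∀ k ρ, (runName nv Ks k, ρ) ∉ G.rules := fun k ρ hm => by
    have := h.rules_lt _ hm
    exact absurd (le_runName nv Ks k) (not_le.2 this)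
  refine ⟨Q', T', ⟨Q'.map (tokOf s2.A), G.vars ∪ Ks.toFinset.image (runName nv Ks),
    G.rules ∪ Ks.toFinset.image fun k => (runName nv Ks k, .run a k)⟩, L ++ runRules nv a Ks,
    ⟨?_, ⟨?_, c0, ce, cne, rfl, ?_, ?_, ?_, ?_, ?_, ?_, ?_, ?_⟩, ?_, ?_, ?_, b3⟩, ?_⟩
  · refine Round.runs a _ _ ?_ ?_ ?_ ?_ (by rw [hX]; exact hrep)
    · rw [hX]; exact mostFrequent_of_not_extendable h0X hf hmax (by simp) hrf h1 h2
    · intro k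
      rw [hX, hXQ, ← hruns.isRun_iff hSQ, List.mem_toFinset]
      constructor
      · intro hk
        obtain ⟨t, ht, e⟩ := a2.sub k hk
        exact ⟨_, a2.mem t ht, e⟩
      · rintro ⟨i, hi, rfl⟩
        exact hblK i hi
    · intro k hk k' hk' e
      exact runName_inj (by simpa using hk) (by simpa using hk') e
    · intro k _ hv
      exact absurd (le_runName nv Ks k) (not_le.2 (h.vars_lt _ hv))
  · exact b2.unexcept (by rw [map_sentinels c0 ce, occ_pad (by simp) h0r, hgone])
  · rw [d1]; exact clt
  · rw [d1]
    intro x hx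
    rcases Finset.mem_union.1 hx with hx | hx
    · exact Nat.lt_add_right _ (h.vars_lt x hx)
    · obtain ⟨k, hk, rfl⟩ := Finset.mem_image.1 hx
      exact runName_lt (by simpa using hk)
  · rw [d1]
    intro x hx
    rcases Finset.mem_union.1 hx with hx | hx
    · exact Nat.lt_add_right _ (h.rules_lt x hx)
    · obtain ⟨k, hk, rfl⟩ := Finset.mem_image.1 hx
      exact runName_lt (by simpa using hk)
  · rw [runRules_eq, List.nodup_append]
    refine ⟨h.nodup, a1.nodup.map fun k k' e => ?_, fun x hx y hy e => ?_⟩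
    · simp only [Prod.mk.injEq, Rhs.run.injEq, true_and] at e
      exact e.2
    · obtain ⟨k, hk, rfl⟩ := List.mem_map.1 hy
      refine hfresh k (.run a k) ?_
      rw [← h.rules, List.mem_toFinset, ← e]
      exact hx
  · rw [runRules_eq]
    ext x
    simp [← h.rules]
  · rw [d2, List.flatMap_append]
    exact a1.out.congr (hfr2.A .out rfl)
  · rw [d1]
    intro s' hs' k
    rw [hfr2.A .rv rfl, a1.rest s' (by omega)]
    exact h.rv s' (by omega) k
  · have := h.nv_pos; omega
  · intro i
    rw [d3, d1]
    have := hmark i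
    omega
  · exact occ_pair_pad_le c0X (by omega) (hrep.occ_pair_le_of hnvX hmaxX)
  · omega
  · omega

/-! ### A round -/

/-- One round for the pair in `ra`, `rb`, of maximal frequency. -/
def roundC : Cmd :=
  .seq collectC <| .seq extendC <|
    .ite (.lt (.lit 2) (.var .rlen)) (.seq plainPrepC replaceC)
      (.ite (.eq (.var .ra) (.var .rb)) (.seq runsPrepC replaceC) (.seq plainPrepC replaceC))

/-- With the potential `400 * |Q| + 10 * T` the round costs nothing and even leaves `40` credits:
each deleted node yields `400`, of which at most `120` go to the extension, `90` to preparation and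
replacement and `100` to new stack entries; at least two nodes are deleted, which covers the
constants. -/
lemma wp_roundC {s : St} {Q : List ℕ} {e T f a b : ℕ} {G : AlgState} {L : List Rule}
    (h : Inv (0, 0) Q e T G L s.A (s.v .rnv) (s.v .rolen)) (ha : s.v .ra = a) (hb : s.v .rb = b)
    (hf : 2 ≤ f) (hmax : ∀ a b, occ (pad G.text) [a, b] ≤ f) (hab : occ (pad G.text) [a, b] = f)
    (hmark : ∀ i, s.A .mark i 0 0 < s.v .rnv) (hk : 400 * Q.length + 10 * T + 400 ≤ s.k) :
    wp roundC (fun s' => ∃ Q' T' G' L', RoundPost f Q e T G Q' T' G' L' s' ∧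
      s.k + 400 * Q'.length + 10 * T' + 40 ≤ s'.k + 400 * Q.length + 10 * T) s := by
  obtain ⟨nv, hnv⟩ : ∃ nv, s.v .rnv = nv := ⟨_, rfl⟩
  obtain ⟨ol, hol⟩ : ∃ ol, s.v .rolen = ol := ⟨_, rfl⟩
  have hP := h.full.lnk
  have hPX : (0 :: (Q ++ [e])).map (tokOf s.A) = pad G.text := by
    rw [map_sentinels h.tok_zero h.tok_end, h.text]
  have hlenQ : G.text.length = Q.length := by rw [h.text, List.length_map]
  have h0X : 0 ∉ G.text := h.zero_notMem
  have h0ab : 0 ∉ [a, b] := zero_notMem_of_two_le_occ h0X (by simp) (by omega)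
  have ha0 : a ≠ 0 := by rintro rfl; simp at h0ab
  rw [roundC, wp_seq]
  refine (wp_collectC (s := s) (P := 0 :: (Q ++ [e])) (T := T) h.full ha hb ha0 (fun i hi => by
    rw [← List.cons_append, List.getLast?_concat] at hi
    rw [← Option.some.inj hi]; exact h.tok_end) hmark (by omega)).fr.mono ?_
  rintro s1 ⟨⟨T1, a1, a2, a3, a4, a5, a6⟩, hfr1⟩
  have etok1 : s1.A .tok = s.A .tok := hfr1.A .tok rfl
  have etok1' : tokOf s1.A = tokOf s.A := by funext z; rw [tokOf, etok1, tokOf]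
  have hw1 := Win.of_pair (g := tokOf s.A) hP a3 a4 a5
  rw [hPX] at hw1
  have hk1 := hfr1.k
  have hmf : s1.v .rm = f := by rw [← hw1.occ_eq (by simp), hab]
  rw [hmf] at hw1
  have hP1 := hP.congr (hfr1.A .nb rfl) etok1
  rw [wp_seq]
  refine (wp_extendC (s := s1) (P := 0 :: (Q ++ [e])) (L := G.text) (m := f) (a := a) (b := b) hP1
    (by rw [etok1', hPX]) h0X hmf hf hmax hw1 (by simp; omega)).fr.mono ?_
  rintro s2 ⟨⟨r, b1, b2, b3, b4, b5, b6, b7, b8⟩, hfr2⟩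
  have hne : r ≠ [] := by rintro rfl; simp at b2
  have hbd := mul_length_le hmax b2 (b3.occ_eq hne)
  have hpl : (pad G.text).length = Q.length + 2 := by simp [pad, hlenQ]
  rw [hpl] at hbd
  have hfr : f ≤ f * (r.length - 1) := Nat.le_mul_of_pos_right _ (by omega)
  have c1 : s2.v .rnv = nv := ((hfr2.v .rnv rfl).trans (hfr1.v .rnv rfl)).trans hnv
  have c2 : s2.v .rolen = ol := ((hfr2.v .rolen rfl).trans (hfr1.v .rolen rfl)).trans hol
  have c3 : s2.v .ra = a := ((hfr2.v .ra rfl).trans (hfr1.v .ra rfl)).trans ha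
  have c4 : s2.v .rb = b := ((hfr2.v .rb rfl).trans (hfr1.v .rb rfl)).trans hb
  have c5 : s2.v .rm = f := (hfr2.v .rm rfl).trans hmf
  have c6 : s2.A .mark = s1.A .mark := hfr2.A .mark rfl
  have hF2 : Full (0 :: (Q ++ [e])) (a, b) T1 s2.A := a1.congr (hfr2.A .cnt rfl) (hfr2.A .slen rfl)
    (hfr2.A .st1 rfl) (hfr2.A .st2 rfl) (hfr2.A .nb rfl) (hfr2.A .tok rfl)
  have hI : Inv (a, b) Q e T1 G L s2.A (s.v .rnv) (s.v .rolen) :=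
    h.congr hF2 ((hfr2.A .tok rfl).trans etok1) ((hfr2.A .out rfl).trans (hfr1.A .out rfl))
      ((hfr2.A .rv rfl).trans (hfr1.A .rv rfl))
  rw [hnv, hol] at hI
  have hmk : ∀ i, s2.A .mark i 0 0 ≤ nv := fun i => by rw [c6]; have := a6 i; rwa [hnv] at this
  have plain : (∀ x, r ≠ [x, x]) → ∀ k', s2.k ≤ k' + 2 → wp (.seq plainPrepC replaceC)
      (fun s' => ∃ Q' T' G' L', RoundPost f Q e T G Q' T' G' L' s' ∧
      s.k + 400 * Q'.length + 10 * T' + 40 ≤ s'.k + 400 * Q.length + 10 * T) ⟨s2.v, s2.A, k'⟩ := by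
    intro hsq k' hk'
    refine (wp_plainC (s := ⟨s2.v, s2.A, k'⟩) (Q := Q) (r := r) (e := e) (T := T1) (f := f) (a := a) (b := b)
      (G := G) (L := L) (by simpa only [c1, c2] using hI) c5 hf hmax b1 b2 b3 b4 b5 hsq b7 hab
      (by simpa only [c1] using hmk) (by simp only; omega)).mono ?_
    rintro s' ⟨Q', T', G', L', ⟨d1, d2, d3, d4, d5, d6⟩, d7, d8⟩
    exact ⟨Q', T', G', L', ⟨d1, d2, d3, d4, d5, by omega⟩, by simp only at d8; omega⟩
  rw [wp_ite]
  simp only [Exp.eval, St.tick, b1]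
  refine ⟨by omega, fun hc => ?_, fun hc => ?_⟩
  · replace hc := ite_one_ne_zero.1 hc
    exact plain (fun x e => by simp [e] at hc) _ (by omega)
  replace hc := ite_one_eq_zero.1 hc
  have hr := b6 (by omega)
  rw [wp_ite]
  simp only [Exp.eval, St.tick, c3, c4]
  refine ⟨by omega, fun hc' => ?_, fun hc' => ?_⟩
  · replace hc' := ite_one_ne_zero.1 hc'
    subst hc'
    subst hr
    refine (wp_runsC (s := ⟨s2.v, s2.A, s2.k - 1 - 1⟩) (Q := Q) (e := e) (T := T1) (f := f) (a := a)
      (G := G) (L := L) (by simpa only [c1, c2] using hI) c5 c3 hf hmax b3 b4 b5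
      (by simpa only [c1] using hmk) (by simp only; omega)).mono ?_
    rintro s' ⟨Q', T', G', L', ⟨d1, d2, d3, d4, d5, d6⟩, d8⟩
    simp only [List.length_cons, List.length_nil] at b8
    exact ⟨Q', T', G', L', ⟨d1, d2, d3, d4, d5, by omega⟩, by simp only at d8; omega⟩
  · replace hc' := ite_one_eq_zero.1 hc'
    refine plain (fun x e => hc' ?_) _ (by omega)
    rw [hr] at e
    simp at e
    rw [e.1, e.2]

/-! ### The main loop -/

/-- Rounds, as long as a pair occurs at least twice; no pair occurs more than `rf` times. -/
def mainC : Cmd :=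
  .loop (.lt (.lit 1) (.var .rf)) <|
    .ite (.get .slen (.lit 0) (.var .rf) (.lit 0))
      (.seq (.put .slen (.lit 0) (.var .rf) (.lit 0) (.pred (.get .slen (.lit 0) (.var .rf) (.lit 0)))) <|
       .seq (.set .ra (.get .st1 (.lit 0) (.var .rf) (.get .slen (.lit 0) (.var .rf) (.lit 0)))) <|
       .seq (.set .rb (.get .st2 (.lit 0) (.var .rf) (.get .slen (.lit 0) (.var .rf) (.lit 0)))) <|
       .ite (.eq (cntE .ra .rb) (.var .rf))
        (.seq (.put .slen (.lit 0) (.var .rf) (.lit 0) (.inc (.get .slen (.lit 0) (.var .rf) (.lit 0)))) roundC)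
        .skip)
      (.set .rf (.pred (.var .rf)))

/-- Every iteration lowers the potential `400 * |Q| + 10 * T + 10 * rf` by at least its cost: it
runs a round, pops an outdated bucket entry, or lowers `rf`. -/
lemma wp_mainC {s : St} {Q : List ℕ} {e T f : ℕ} {G : AlgState} {L : List Rule}
    (h : Inv (0, 0) Q e T G L s.A (s.v .rnv) (s.v .rolen)) (hf : s.v .rf = f)
    (hmax : ∀ a b, occ (pad G.text) [a, b] ≤ f)
    (hmark : ∀ i, s.A .mark i 0 0 < s.v .rnv) (hk : 400 * Q.length + 10 * T + 10 * f + 500 ≤ s.k) :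
    wp mainC (fun s' => ∃ Q' T' G' L', Relation.ReflTransGen Round G G' ∧
      Inv (0, 0) Q' e T' G' L' s'.A (s'.v .rnv) (s'.v .rolen) ∧ Q'.length ≤ Q.length ∧
      (∀ a b, occ (pad G'.text) [a, b] ≤ 1) ∧
      s.k ≤ s'.k + 400 * Q.length + 10 * T + 10 * f + 10) s := by
  obtain ⟨I, hI⟩ : ∃ I : St → Prop, I = fun s' => ∃ Q' T' G' L', Relation.ReflTransGen Round G G' ∧
      Inv (0, 0) Q' e T' G' L' s'.A (s'.v .rnv) (s'.v .rolen) ∧ Q'.length ≤ Q.length ∧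
      (∀ a b, occ (pad G'.text) [a, b] ≤ max 1 (s'.v .rf)) ∧
      (∀ i, s'.A .mark i 0 0 < s'.v .rnv) ∧
      s.k + 400 * Q'.length + 10 * T' + 10 * s'.v .rf ≤ s'.k + 400 * Q.length + 10 * T + 10 * f := ⟨_, rfl⟩
  refine wp_while I ?_ ?_ ?_ ?_
  · rw [hI]
    exact ⟨Q, T, G, L, .refl, h, le_rfl, fun a b => (hmax a b).trans (by rw [hf]; exact le_max_right _ _),
      hmark, by omega⟩
  · intro s' hs' _
    rw [hI] at hs'
    obtain ⟨Q', T', G', L', -, -, -, -, -, h6⟩ := hs'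
    omega
  · intro s' hs' hfr he
    rw [hI] at hs'
    obtain ⟨Q', T', G', L', h1, h2, h3, h4, h5, h6⟩ := hs'
    replace he := ite_one_ne_zero.1 he
    simp only [Exp.eval] at he
    obtain ⟨f', hf'⟩ : ∃ f', s'.v .rf = f' := ⟨_, rfl⟩
    rw [hf'] at he h6 h4
    rw [max_eq_right he.le] at h4
    have hPX : (0 :: (Q' ++ [e])).map (tokOf s'.A) = pad G'.text := by
      rw [map_sentinels h2.tok_zero h2.tok_end, h2.text]
    have hcnt : ∀ a b, s'.A .cnt a b 0 = occ (pad G'.text) [a, b] := fun a b => by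
      rw [h2.full.cnt, hPX]
    rw [wp_ite]
    simp only [Exp.eval, St.tick, hf']
    refine ⟨by omega, fun hne => ?_, fun hz => ?_⟩
    · obtain ⟨l, hl⟩ : ∃ l, s'.A .slen 0 f' 0 = l + 1 := ⟨_, (Nat.succ_pred hne).symm⟩
      have hself : s'.A.upd .slen 0 f' 0 l .slen 0 f' 0 = l := by simp [Arrays.upd]
      simp only [wp_seq_eq, wp_put, wp_set, Exp.eval, St.putA, St.setv, hf', hl,
        Nat.add_sub_cancel, Function.update_of_ne, ne_eq, reduceCtorEq, not_false_eq_true, hself,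
        Arrays.upd_of_ne, Nat.sub_sub]
      refine ⟨by omega, by omega, by omega, ?_⟩
      obtain ⟨a, ha⟩ : ∃ a, s'.A .st1 0 f' l = a := ⟨_, rfl⟩
      obtain ⟨b, hb⟩ : ∃ b, s'.A .st2 0 f' l = b := ⟨_, rfl⟩
      rw [wp_ite]
      simp only [Exp.eval, cntE, St.tick, Function.update_self, Function.update_of_ne, ne_eq, reduceCtorEq,
        not_false_eq_true, Arrays.upd_of_ne, hf', ha, hb]
      refine ⟨by omega, fun hc => ?_, fun hc => ?_⟩
      · replace hc := ite_one_ne_zero.1 hc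
        simp only [wp_seq_eq, wp_put, Exp.eval, St.putA, Function.update_of_ne, ne_eq, reduceCtorEq,
          not_false_eq_true, hf', hself]
        refine ⟨by omega, ?_⟩
        -- A valid entry is put back before the round, since the bucket invariant needs it as long
        -- as the pair has this frequency.
        have hback : (s'.A.upd .slen 0 f' 0 l).upd .slen 0 f' 0 (l + 1) = s'.A := by
          funext id i j k
          simp only [Arrays.upd]
          split
          · rename_i hx; obtain ⟨rfl, rfl, rfl, rfl⟩ := hx; exact hl.symm
          · rfl
        rw [hback]
        refine (wp_roundC (s := ⟨Function.update (Function.update s'.v .ra a) .rb b, s'.A, _⟩)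
          (Q := Q') (e := e) (T := T') (f := f') (a := a) (b := b) (G := G') (L := L') ?_ (by simp) (by simp)
          he h4 (by rw [← hcnt]; exact hc) ?_ (by simp only; omega)).fr.mono ?_
        · simpa using h2
        · simpa using h5
        rintro s2 ⟨⟨Q2, T2, G2, L2, ⟨g1, g2, g3, g4, g5, g6⟩, g7⟩, hfr2⟩
        have hf2 : s2.v .rf = f' := (hfr2.v .rf rfl).trans (by simp [hf'])
        rw [hI]
        refine ⟨Q2, T2, G2, L2, h1.tail g1, g2, by omega, ?_, g3, ?_⟩
        · rw [hf2, max_eq_right he.le]; exact g4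
        · simp only at g7
          rw [hf2]
          omega
      · replace hc := ite_one_eq_zero.1 hc
        rw [wp_skip]
        simp only [St.tick]
        refine ⟨by omega, ?_⟩
        rw [hI]
        have hpop := h2.full.bag.pop_bucket hl (by rw [ha, hb]; exact hc)
        refine ⟨Q', T' - 1, G', L', h1, ?_, h3, ?_, ?_, ?_⟩
        · simp only [Function.update_of_ne, ne_eq, reduceCtorEq, not_false_eq_true]
          exact h2.congr ⟨h2.full.lnk.congr (by simp [Arrays.upd_of_ne]) (by simp [Arrays.upd_of_ne]), hpop.2⟩
            (by simp [Arrays.upd_of_ne]) (by simp [Arrays.upd_of_ne]) (by simp [Arrays.upd_of_ne])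
        · simp only [Function.update_of_ne, ne_eq, reduceCtorEq, not_false_eq_true, hf']
          rw [max_eq_right he.le]; exact h4
        · simpa [Arrays.upd_of_ne] using h5
        · simp only [Function.update_of_ne, ne_eq, reduceCtorEq, not_false_eq_true, hf']
          have := hpop.1
          omega
    · rw [wp_set]
      simp only [Exp.eval, St.setv, hf']
      refine ⟨by omega, ?_⟩
      rw [hI]
      refine ⟨Q', T', G', L', h1, by simpa using h2, h3, ?_, by simpa using h5, ?_⟩
      · simp only [Function.update_self]
        intro a b
        have hle := h4 a b
        by_contra hc
        -- A pair of frequency `f'` would have an entry in its bucket, which is empty.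
        have hoc : s'.A .cnt a b 0 = f' := by rw [hcnt]; omega
        obtain ⟨j, hj, -⟩ := h2.full.bag.bucket a b (by omega)
        rw [hoc] at hj
        omega
      · simp only [Function.update_self]
        omega
  · intro s' hs' hfr he
    rw [hI] at hs'
    obtain ⟨Q', T', G', L', h1, h2, h3, h4, h5, h6⟩ := hs'
    replace he := ite_one_eq_zero.1 he
    simp only [Exp.eval] at he
    refine ⟨Q', T', G', L', h1, h2, h3, fun a b => (h4 a b).trans (by omega), ?_⟩
    simp only [St.tick]
    omega

/-! ### Initialization -/

/-- The rules for the terminals `As`. -/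
def termRules (As : List ℕ) : List Rule := As.map fun a => (1 + As.idxOf a, Rhs.term a)

lemma termRules_concat {a : ℕ} {As : List ℕ} (ha : a ∉ As) :
    termRules (As ++ [a]) = termRules As ++ [(1 + As.length, Rhs.term a)] := by
  rw [termRules, List.map_append, termRules]
  congr 1
  · refine List.map_congr_left fun x hx => ?_
    rw [List.idxOf_append_of_mem hx]
  · simp [List.idxOf_append_of_notMem ha]

structure Terms (As : List ℕ) (A : Arrays) (nv ol : ℕ) : Prop where
  nodup : As.Nodup
  nv : nv = 1 + As.length
  sv : ∀ a, A .sv a 0 0 = if a ∈ As then 1 + As.idxOf a else 0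
  out : Outp ((termRules As).flatMap encodeRule) ol A

lemma Terms.congr {As : List ℕ} {A A' : Arrays} {nv ol : ℕ} (h : Terms As A nv ol)
    (h1 : A' .sv = A .sv) (h2 : A' .out = A .out) : Terms As A' nv ol :=
  ⟨h.nodup, h.nv, by rw [h1]; exact h.sv, h.out.congr h2⟩

/-- Find or create the variable for the terminal `rx`. -/
def termC : Cmd :=
  .ite (.get .sv (.var .rx) (.lit 0) (.lit 0)) .skip <|
    .seq (.put .sv (.var .rx) (.lit 0) (.lit 0) (.var .rnv)) <|
    .seq (emitC (.var .rnv)) <| .seq (emitC (.lit 0)) <| .seq (emitC (.var .rx)) <|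
    .set .rnv (.inc (.var .rnv))

lemma wp_termC {s : St} {a : ℕ} {As : List ℕ} (h : Terms As s.A (s.v .rnv) (s.v .rolen))
    (h1 : s.v .rx = a) (hk : 9 ≤ s.k) :
    wp termC (fun s' => ∃ As', Terms As' s'.A (s'.v .rnv) (s'.v .rolen) ∧ As <+: As' ∧
      (∀ x, x ∈ As' ↔ x ∈ As ∨ x = a) ∧ s.k ≤ s'.k + 9) s := by
  rw [termC, wp_ite]
  simp only [Exp.eval, h1, h.sv]
  refine ⟨by omega, fun hne => ?_, fun hne => ?_⟩
  · have hk : a ∈ As := by by_contra hc; simp [hc] at hne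
    rw [wp_skip]
    simp only [St.tick]
    refine ⟨by omega, As, h, List.prefix_refl _, fun x => ⟨.inl, ?_⟩, by omega⟩
    rintro (h | rfl)
    exacts [h, hk]
  · have hk : a ∉ As := by intro hc; simp [hc] at hne
    simp only [wp_seq_eq, wp_put, Exp.eval, St.putA, St.tick, h1]
    refine ⟨by omega, ?_⟩
    refine wp_emitC (h.out.congr (by simp [Arrays.upd_of_ne])) (by simp only; omega)
      fun A1 hA1 hO1 => ?_
    refine wp_emitC hO1 (by simp only; omega) fun A2 hA2 hO2 => ?_
    refine wp_emitC hO2 (by simp only; omega) fun A3 hA3 hO3 => ?_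
    simp only [Exp.eval, Function.update_of_ne, ne_eq, reduceCtorEq,
      not_false_eq_true, h1, Function.update_self] at hO3
    have esv : A3 .sv = (s.A.upd .sv a 0 0 (s.v .rnv)) .sv :=
      (hA3 .sv (by simp)).trans ((hA2 .sv (by simp)).trans (hA1 .sv (by simp)))
    simp only [wp_set, Exp.eval, St.setv, Function.update_self, Function.update_of_ne, ne_eq,
      reduceCtorEq, not_false_eq_true]
    refine ⟨by omega, As ++ [a], ⟨?_, ?_, ?_, ?_⟩, List.prefix_append _ _, by simp, by omega⟩
    · simpa [List.nodup_append, h.nodup] using fun b hb (e : b = a) => hk (by rwa [← e])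
    · simp [h.nv]; omega
    · intro k'
      rw [esv]
      by_cases e : k' = a
      · subst e
        simp [Arrays.upd, h.nv, List.idxOf_append_of_notMem hk]
      · by_cases hm : k' ∈ As
        · simp [Arrays.upd, e, h.sv, hm, List.idxOf_append_of_mem]
        · simp [Arrays.upd, e, h.sv, hm]
    · rw [termRules_concat hk, List.flatMap_append, ← h.nv]
      simpa [encodeRule] using hO3

/-- Build the linked list of the text, from the input. -/
def readC : Cmd :=
  .loop (.lt (.var .ri) (.var .rn)) <|
    .seq (.set .rx (.get .inp (.lit 0) (.lit 0) (.var .ri))) <|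
    .seq termC <|
    .seq (.put .tok (.inc (.var .ri)) (.lit 0) (.lit 0) (.get .sv (.var .rx) (.lit 0) (.lit 0))) <|
    .seq (.put .nb (.lit 0) (.var .ri) (.lit 0) (.inc (.var .ri))) <|
    .seq (.put .nb (.lit 1) (.inc (.var .ri)) (.lit 0) (.var .ri)) <|
    .set .ri (.inc (.var .ri))

/-- Node `i + 1` is the `i`-th symbol of the text; nodes `0` and `n + 1` are sentinels, whose symbol
`0` is there without being written. -/
lemma wp_readC {s : St} {Tx : List ℕ} (hn : s.v .rn = Tx.length) (hi : s.v .ri = 0)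
    (hinp : ∀ i, s.A .inp 0 0 i = Tx.getD i 0) (htok : ∀ i, s.A .tok i 0 0 = 0)
    (h : Terms [] s.A (s.v .rnv) (s.v .rolen)) (hk : 15 * Tx.length + 1 ≤ s.k) :
    wp readC (fun s' => ∃ As, Terms As s'.A (s'.v .rnv) (s'.v .rolen) ∧ As.toFinset = Tx.toFinset ∧
      (∀ i, (hi : i < Tx.length) → s'.A .tok (i + 1) 0 0 = 1 + As.idxOf Tx[i]) ∧
      s'.A .tok 0 0 0 = 0 ∧ (∀ i, Tx.length ≤ i → s'.A .tok (i + 1) 0 0 = 0) ∧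
      (∀ i < Tx.length, s'.A .nb 0 i 0 = i + 1 ∧ s'.A .nb 1 (i + 1) 0 = i) ∧
      s'.v .ri = Tx.length ∧ s.k ≤ s'.k + 15 * Tx.length + 1) s := by
  obtain ⟨I, hI⟩ : ∃ I : St → Prop, I = fun s' => ∃ As i, s'.v .ri = i ∧ i ≤ Tx.length ∧
      Terms As s'.A (s'.v .rnv) (s'.v .rolen) ∧ (∀ x, x ∈ As ↔ x ∈ Tx.take i) ∧
      (∀ j, (hj : j < Tx.length) → j < i → s'.A .tok (j + 1) 0 0 = 1 + As.idxOf Tx[j]) ∧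
      s'.A .tok 0 0 0 = 0 ∧ (∀ j, i ≤ j → s'.A .tok (j + 1) 0 0 = 0) ∧
      (∀ j < i, s'.A .nb 0 j 0 = j + 1 ∧ s'.A .nb 1 (j + 1) 0 = j) ∧
      s.k ≤ s'.k + 15 * i := ⟨_, rfl⟩
  refine wp_while I ?_ ?_ ?_ ?_
  · rw [hI]
    exact ⟨[], 0, hi, Nat.zero_le _, h, by simp, by simp, htok 0, fun j _ => htok _, by simp, by omega⟩
  · intro s' hs' _
    rw [hI] at hs'
    obtain ⟨As, i, h1, h2, -, -, -, -, -, -, h3⟩ := hs'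
    omega
  · intro s' hs' hfr hlt
    rw [hI] at hs'
    obtain ⟨As, i, h1, h2, h3, h4, h5, h6, h7, h8, h9⟩ := hs'
    have en : s'.v .rn = Tx.length := (hfr.v .rn rfl).trans hn
    have ei : s'.A .inp = s.A .inp := hfr.A .inp rfl
    replace hlt := ite_one_ne_zero.1 hlt
    simp only [Exp.eval, h1, en] at hlt
    simp only [wp_seq_eq, wp_set, Exp.eval, St.setv, St.tick, h1, ei, hinp, Nat.sub_sub]
    refine ⟨by omega, ?_⟩
    have hget : Tx.getD i 0 = Tx[i] := List.getD_eq_getElem _ _ hlt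
    rw [hget]
    refine (wp_termC (s := ⟨Function.update s'.v .rx Tx[i], s'.A, s'.k - (1 + 1)⟩) (a := Tx[i]) (As := As)
      (by simpa using h3) (by simp) (by simp only; omega)).fr.mono ?_
    rintro s1 ⟨⟨As', a1, a2, a3, a4⟩, hfr1⟩
    have b1 : s1.v .ri = i := (hfr1.v .ri rfl).trans (by simp [h1])
    have b2 : s1.v .rx = Tx[i] := (hfr1.v .rx rfl).trans (by simp)
    have b3 : s1.A .tok = s'.A .tok := hfr1.A .tok rfl
    have b4 : s1.A .nb = s'.A .nb := hfr1.A .nb rfl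
    simp only at a4
    have hmem : Tx[i] ∈ As' := (a3 _).2 (.inr rfl)
    have b5 := a1.sv Tx[i]
    rw [if_pos hmem] at b5
    simp only [wp_put, wp_set, Exp.eval, St.setv, St.putA, b1, b2, b5]
    refine ⟨by omega, by omega, by omega, by omega, ?_⟩
    rw [hI]
    simp only [Function.update_self, Function.update_of_ne, ne_eq, reduceCtorEq, not_false_eq_true]
    have htk : ∀ j, (((s1.A.upd .tok (i + 1) 0 0 (1 + As'.idxOf Tx[i])).upd .nb 0 i 0 (i + 1)).upd .nb 1
        (i + 1) 0 i) .tok j 0 0 = if j = i + 1 then 1 + As'.idxOf Tx[i] else s'.A .tok j 0 0 := by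
      intro j; rw [← b3]; simp [Arrays.upd]
    have hn0 : ∀ j, (((s1.A.upd .tok (i + 1) 0 0 (1 + As'.idxOf Tx[i])).upd .nb 0 i 0 (i + 1)).upd .nb 1
        (i + 1) 0 i) .nb 0 j 0 = if j = i then i + 1 else s'.A .nb 0 j 0 := by
      intro j; rw [← b4]; simp [Arrays.upd]
    have hn1 : ∀ j, (((s1.A.upd .tok (i + 1) 0 0 (1 + As'.idxOf Tx[i])).upd .nb 0 i 0 (i + 1)).upd .nb 1
        (i + 1) 0 i) .nb 1 j 0 = if j = i + 1 then i else s'.A .nb 1 j 0 := by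
      intro j; rw [← b4]; simp [Arrays.upd]
    refine ⟨As', i + 1, rfl, hlt, a1.congr (by simp [Arrays.upd_of_ne]) (by simp [Arrays.upd_of_ne]), ?_, ?_,
      ?_, ?_, ?_, by omega⟩
    · intro x
      rw [a3, h4, ← List.take_concat_get' Tx i hlt, List.mem_append, List.mem_singleton]
    · intro j hj hji
      rw [htk]
      by_cases e : j = i
      · subst e; simp
      · rw [if_neg (by omega), h5 j hj (by omega)]
        obtain ⟨D, rfl⟩ := a2
        rw [List.idxOf_append_of_mem ((h4 _).2 (List.mem_take_iff_getElem.2 ⟨j, by omega, rfl⟩))]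
    · rw [htk, if_neg (by omega), h6]
    · intro j hj
      rw [htk, if_neg (by omega), h7 j (by omega)]
    · intro j hj
      rw [hn0, hn1]
      by_cases e : j = i
      · subst e; simp
      · rw [if_neg e, if_neg (by omega)]
        exact h8 j (by omega)
  · intro s' hs' hfr hlt
    rw [hI] at hs'
    obtain ⟨As, i, h1, h2, h3, h4, h5, h6, h7, h8, h9⟩ := hs'
    have en : s'.v .rn = Tx.length := (hfr.v .rn rfl).trans hn
    replace hlt := ite_one_eq_zero.1 hlt
    simp only [Exp.eval, h1, en] at hlt
    obtain rfl : i = Tx.length := by omega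
    refine ⟨As, h3, ?_, fun j hj => h5 j hj hj, h6, h7, h8, h1, by simp only [St.tick]; omega⟩
    ext x
    rw [List.mem_toFinset, h4, List.take_length, List.mem_toFinset]

/-- Register all pairs of the text. -/
def pairsC : Cmd :=
  .loop (.lt (.var .ri) (.inc (.var .rn))) <|
    .seq (.set .rp (tokE (.var .ri))) <| .seq (.set .rq (tokE (.inc (.var .ri)))) <|
    .seq (incC .ri .rp .rq) <| .set .ri (.inc (.var .ri))

lemma wp_pairsC {s : St} {n : ℕ} (hn : s.v .rn = n) (hi : s.v .ri = 0)
    (hc : ∀ a b, s.A .cnt a b 0 = 0) (hs : ∀ a b, s.A .slen a b 0 = 0) (hk : 11 * (n + 1) + 1 ≤ s.k) :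
    wp pairsC (fun s' => Bag (bg (tokOf s.A) (List.range (n + 2))) (0, 0) (2 * (n + 1)) s'.A ∧
      s.k ≤ s'.k + 11 * (n + 1) + 1) s := by
  refine wp_while (fun s' => ∃ i, s'.v .ri = i ∧ i ≤ n + 1 ∧
    Bag (bg (tokOf s.A) (List.range (i + 1))) (0, 0) (2 * i) s'.A ∧ s.k ≤ s'.k + 11 * i) ?_ ?_ ?_ ?_
  · refine ⟨0, hi, by omega, ⟨by simp [bg, hc], by simp [bg], fun a b h => ?_, fun F => ?_⟩, by omega⟩
    · rw [hc] at h; omega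
    · simp [hs]
  · rintro s' ⟨i, h1, h2, -, h3⟩ _; omega
  · rintro s' ⟨i, h1, h2, h3, h4⟩ hfr hlt
    have en : s'.v .rn = n := (hfr.v .rn rfl).trans hn
    have etok : s'.A .tok = s.A .tok := hfr.A .tok rfl
    replace hlt := ite_one_ne_zero.1 hlt
    simp only [Exp.eval, h1, en] at hlt
    simp only [wp_seq_eq, wp_set, Exp.eval, St.setv, St.tick, tokE, h1, Nat.sub_sub, etok,
      Function.update_of_ne, ne_eq, reduceCtorEq, not_false_eq_true]
    refine ⟨by omega, by omega, ?_⟩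
    refine wp_incC h3 (by simp only; omega) ?_
    intro A' hB _
    rw [wp_set]
    simp only [Exp.eval, St.setv, Function.update_self, Function.update_of_ne, ne_eq, reduceCtorEq,
      not_false_eq_true, h1] at hB ⊢
    refine ⟨by omega, i + 1, rfl, by omega, ?_, by omega⟩
    refine hB.perm ?_
    have e : bg (tokOf s.A) (List.range (i + 1 + 1)) =
        bg (tokOf s.A) (List.range (i + 1)) ++ [(i, tokOf s.A i, tokOf s.A (i + 1))] := by
      rw [List.range_succ, List.range_succ, List.append_assoc, List.singleton_append, bg_append]
      rfl
    rw [e]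
    exact (List.perm_append_singleton _ _).symm
  · rintro s' ⟨i, h1, h2, h3, h4⟩ hfr hlt
    have en : s'.v .rn = n := (hfr.v .rn rfl).trans hn
    replace hlt := ite_one_eq_zero.1 hlt
    simp only [Exp.eval, h1, en] at hlt
    obtain rfl : i = n + 1 := by omega
    exact ⟨h3, by simp only [St.tick]; omega⟩

def initC : Cmd :=
  .seq (.set .rnv (.lit 1)) <| .seq (.set .rolen (.lit 1)) <| .seq (.set .ri (.lit 0)) <|
  .seq readC <|
  .seq (.put .nb (.lit 0) (.var .ri) (.lit 0) (.inc (.var .ri))) <|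
  .seq (.put .nb (.lit 1) (.inc (.var .ri)) (.lit 0) (.var .ri)) <|
  .seq (.set .ri (.lit 0)) <| .seq pairsC <| .set .rf (.inc (.inc (.var .rn)))

/-- The `n + 1` pairs of the padded text make two stack entries each; its length `n + 2` is a
trivial first bound on pair frequencies. -/
lemma wp_initC {s : St} {Tx : List ℕ} (hn : s.v .rn = Tx.length)
    (hinp : ∀ i, s.A .inp 0 0 i = Tx.getD i 0) (hA : ∀ id, id ≠ .inp → ∀ i j k, s.A id i j k = 0)
    (hk : 26 * Tx.length + 30 ≤ s.k) :
    wp initC (fun s' => ∃ Q ν L, Q.length = Tx.length ∧ Set.InjOn ν {a | a ∈ Tx} ∧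
      Inv (0, 0) Q (Tx.length + 1) (2 * (Tx.length + 1)) (initState Tx ν) L s'.A (s'.v .rnv) (s'.v .rolen) ∧
      s'.v .rf = Tx.length + 2 ∧ (∀ a b, occ (pad (initState Tx ν).text) [a, b] ≤ Tx.length + 2) ∧
      (∀ i, s'.A .mark i 0 0 < s'.v .rnv) ∧ s.k ≤ s'.k + 26 * Tx.length + 30) s := by
  obtain ⟨n, hnn⟩ : ∃ n, Tx.length = n := ⟨_, rfl⟩
  simp only [initC, wp_seq_eq, wp_set, Exp.eval, St.setv, Nat.sub_sub]
  refine ⟨by omega, by omega, by omega, ?_⟩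
  obtain ⟨s1, hs1⟩ : ∃ s1 : St, s1 = ⟨Function.update (Function.update (Function.update s.v .rnv 1) .rolen 1)
    .ri 0, s.A, s.k - (1 + 1 + 1)⟩ := ⟨_, rfl⟩
  rw [← hs1]
  have a1 : s1.v .rn = Tx.length := by simp [hs1, hn]
  have a2 : s1.v .ri = 0 := by simp [hs1]
  have a3 : s1.v .rnv = 1 := by simp [hs1]
  have a4 : s1.v .rolen = 1 := by simp [hs1]
  have a5 : s1.A = s.A := by simp [hs1]
  have a6 : s1.k + 3 = s.k := by simp [hs1]; omega
  clear hs1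
  refine (wp_readC (s := s1) (Tx := Tx) a1 a2 (by rw [a5]; exact hinp)
    (by rw [a5]; exact fun i => hA .tok (by simp) _ _ _) ⟨List.nodup_nil, by simp [a3],
      by rw [a5]; simpa using fun a => hA .sv (by simp) _ _ _, by simp [termRules, Outp, a4]⟩ (by omega)).fr.mono ?_
  rintro s2 ⟨⟨As, b1, b2, b3, b4, b5, b6, b7, b8⟩, hfr2⟩
  simp only [wp_put, wp_set, Exp.eval, St.putA, St.setv, b7, Nat.sub_sub]
  refine ⟨by omega, by omega, by omega, ?_⟩
  obtain ⟨s3, hs3⟩ : ∃ s3 : St, s3 = ⟨Function.update s2.v .ri 0, (s2.A.upd .nb 0 Tx.length 0 (Tx.length + 1)).upd .nb 1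
    (Tx.length + 1) 0 Tx.length, s2.k - (1 + 1 + 1)⟩ := ⟨_, rfl⟩
  rw [← hs3]
  have c1 : s3.v .rn = Tx.length := by rw [hs3]; simpa using (hfr2.v .rn rfl).trans a1
  have c2 : s3.v .ri = 0 := by simp [hs3]
  have c3 : ∀ id, id ≠ .nb → s3.A id = s2.A id := by
    intro id hid; rw [hs3]; simp [Arrays.upd_of_ne, hid]
  have c4 : ∀ i < Tx.length + 1, s3.A .nb 0 i 0 = i + 1 ∧ s3.A .nb 1 (i + 1) 0 = i := by
    intro i hi
    rw [hs3]
    by_cases e : i = Tx.length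
    · subst e; simp [Arrays.upd]
    · simpa [Arrays.upd, e] using b6 i (by omega)
  have c5 : s3.k + 3 = s2.k := by simp [hs3]; omega
  have c6 : s3.v .rnv = s2.v .rnv := by simp [hs3]
  have c7 : s3.v .rolen = s2.v .rolen := by simp [hs3]
  clear hs3
  have hz : ∀ id, readC.wa id = false → id ≠ .inp → id ≠ .nb → ∀ i j k, s3.A id i j k = 0 := by
    intro id h1 h2 h3 i j k
    rw [c3 id h3, hfr2.A id h1, a5]
    exact hA id h2 i j k
  refine (wp_pairsC (s := s3) (n := Tx.length) c1 c2 (fun a b => hz .cnt rfl (by simp) (by simp) _ _ _)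
    (fun a b => hz .slen rfl (by simp) (by simp) _ _ _) (by omega)).fr.mono ?_
  rintro s4 ⟨⟨d1, d2⟩, hfr4⟩
  have e1 : s4.v .rnv = s2.v .rnv := (hfr4.v .rnv rfl).trans c6
  have e2 : s4.v .rolen = s2.v .rolen := (hfr4.v .rolen rfl).trans c7
  have e3 : s4.v .rn = Tx.length := (hfr4.v .rn rfl).trans c1
  have e4 : s4.A .tok = s2.A .tok := (hfr4.A .tok rfl).trans (c3 .tok (by simp))
  have e5 : s4.A .nb = s3.A .nb := hfr4.A .nb rfl
  have e6 : tokOf s3.A = tokOf s4.A := by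
    funext z; rw [tokOf, tokOf, e4, c3 .tok (by simp)]
  have e7 : ∀ z, tokOf s4.A z = s2.A .tok z 0 0 := fun z => by rw [tokOf, e4]
  rw [e6] at d1
  simp only [wp_set, Exp.eval, St.setv, e3, Function.update_self, Function.update_of_ne, ne_eq, reduceCtorEq,
    not_false_eq_true, e1, e2]
  have hmemT : ∀ a, a ∈ As ↔ a ∈ Tx := fun a => by
    rw [← List.mem_toFinset, b2, List.mem_toFinset]
  have hrange : (0 :: ((List.range Tx.length).map (· + 1) ++ [Tx.length + 1])) = List.range (Tx.length + 2) := by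
    rw [List.range_succ_eq_map, List.range_succ, List.map_append]; rfl
  have hLnk : Lnk (List.range (Tx.length + 2)) s4.A := by
    refine ⟨List.nodup_range, ?_, fun i hi => ?_⟩
    · rw [List.isChain_iff_getElem]
      intro i hi
      simp only [List.length_range] at hi
      simp only [List.getElem_range, e5]
      exact c4 i (by omega)
    · simp only [List.mem_range, not_lt] at hi
      rw [e4, show i = i - 1 + 1 by omega]
      exact b5 _ (by omega)
  have htext : Tx.map (fun a => 1 + As.idxOf a) = ((List.range Tx.length).map (· + 1)).map (tokOf s4.A) := by
    refine List.ext_getElem (by simp) fun i h1 h2 => ?_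
    simp only [List.length_map] at h1
    simp [e7, b3 i h1]
  refine ⟨by omega, (List.range Tx.length).map (· + 1), fun a => 1 + As.idxOf a, termRules As, by simp, ?_,
    ⟨⟨?_, ?_⟩, ?_, ?_, ?_, htext, ?_, ?_, ?_, ?_, ?_, ?_, ?_, ?_⟩, trivial, ?_, ?_, by omega⟩
  · intro a ha a' ha' e
    exact (List.idxOf_inj ((hmemT a).2 ha)).1 (by simpa using e)
  · rw [hrange]; exact hLnk
  · rw [hrange]; exact d1
  · rw [e7]; exact b4
  · rw [e7]; exact b5 _ le_rfl
  · intro i hi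
    obtain ⟨j, hj, rfl⟩ := List.mem_map.1 hi
    rw [e7, b3 j (by simpa using hj)]
    omega
  · intro x hx
    obtain ⟨a, ha, rfl⟩ := List.mem_map.1 hx
    have := List.idxOf_lt_length_iff.2 ((hmemT a).2 ha)
    rw [b1.nv]; exact Nat.add_lt_add_left this 1
  · intro x hx
    obtain ⟨a, ha, rfl⟩ := Finset.mem_image.1 hx
    have := List.idxOf_lt_length_iff.2 ((hmemT a).2 (List.mem_toFinset.1 ha))
    rw [b1.nv]; exact Nat.add_lt_add_left this 1
  · intro x hx
    obtain ⟨a, ha, rfl⟩ := Finset.mem_image.1 hx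
    have := List.idxOf_lt_length_iff.2 ((hmemT a).2 (List.mem_toFinset.1 ha))
    rw [b1.nv]; exact Nat.add_lt_add_left this 1
  · refine b1.nodup.map fun a a' e => ?_
    simp only [Prod.mk.injEq, Rhs.term.injEq] at e
    exact e.2
  · rw [initState, ← b2]
    ext x
    simp [termRules]
  · exact b1.out.congr ((hfr4.A .out rfl).trans (c3 .out (by simp)))
  · intro s' _ k
    rw [hfr4.A .rv rfl]
    exact hz .rv rfl (by simp) (by simp) _ _ _
  · rw [b1.nv]; omega
  · intro a b
    refine (occ_pair_le_count_left _ _ _).trans (List.count_le_length.trans ?_)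
    simp [pad, initState]
  · intro i
    rw [hfr4.A .mark rfl, hz .mark rfl (by simp) (by simp), b1.nv]
    omega

/-! ### The start rule -/

/-- The number of symbols of the text. -/
def lengthC : Cmd :=
  .seq (.set .rl (.lit 0)) <| .seq (.set .ri (nextE (.lit 0))) <|
  .loop (.lt (.lit 0) (tokE (.var .ri))) <|
    .seq (.set .rl (.inc (.var .rl))) <| .set .ri (nextE (.var .ri))

/-- The symbols of the text are positive, so the walk stops exactly at the right sentinel. -/
lemma wp_lengthC {ex : ℕ × ℕ} {Q : List ℕ} {e T : ℕ} {G : AlgState} {L : List Rule} {s : St} {nv ol : ℕ}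
    (h : Inv ex Q e T G L s.A nv ol) (hk : 3 * Q.length + 3 ≤ s.k) :
    wp lengthC (fun s' => s'.v .rl = Q.length ∧ s.k ≤ s'.k + 3 * Q.length + 3) s := by
  have hP := h.full.lnk
  simp only [lengthC, wp_seq_eq, wp_set, Exp.eval, St.setv, nextE]
  refine ⟨by omega, by omega, ?_⟩
  refine wp_while (fun s' => ∃ c ≤ Q.length, s'.v .rl = c ∧
    (0 :: (Q ++ [e]))[c + 1]? = some (s'.v .ri) ∧ s.k = s'.k + 2 + 3 * c) ?_ ?_ ?_ ?_
  · refine ⟨0, Nat.zero_le _, by simp, ?_, by simp only; omega⟩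
    have hlt : 1 < (0 :: (Q ++ [e])).length := by simp
    have := (hP.next (p := 0) (i := 0) (by simp) (List.getElem?_eq_getElem hlt)).1
    simp [Function.update_self, this]
  · rintro s' ⟨c, h1, -, -, h2⟩ _; omega
  · rintro s' ⟨c, h1, h2, h3, h4⟩ hfr he
    have etok : s'.A .tok = s.A .tok := hfr.A .tok rfl
    have enb : s'.A .nb = s.A .nb := hfr.A .nb rfl
    simp only [tokE, Exp.eval, ite_one_ne_zero, etok] at he
    have hc : c < Q.length := by
      by_contra hc
      obtain rfl : c = Q.length := by omega
      simp at h3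
      have := h.tok_end
      rw [tokOf, h3] at this
      omega
    simp only [wp_seq_eq, wp_set, Exp.eval, St.setv, St.tick]
    refine ⟨by omega, by omega, c + 1, hc, ?_, ?_, by omega⟩
    · simp [h2]
    · have hlt : c + 1 + 1 < (0 :: (Q ++ [e])).length := by simp; omega
      have := (hP.next h3 (List.getElem?_eq_getElem hlt)).1
      rw [List.getElem?_eq_getElem hlt]
      simp [enb, this]
  · rintro s' ⟨c, h1, h2, h3, h4⟩ hfr he
    have etok : s'.A .tok = s.A .tok := hfr.A .tok rfl
    simp only [tokE, Exp.eval, ite_one_eq_zero, etok] at he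
    have hc : c = Q.length := by
      by_contra hc
      have hc' : c < Q.length := by omega
      simp [List.getElem?_append_left hc', List.getElem?_eq_getElem hc'] at h3
      have := h.tok_ne _ (List.getElem_mem hc')
      rw [tokOf, h3] at this
      omega
    subst hc
    exact ⟨h2, by simp only [St.tick]; omega⟩

/-- Write the start rule and, in front of the rules, the start symbol. -/
def finalC : Cmd :=
  .seq lengthC <| .seq (emitC (.var .rnv)) <| .seq (emitC (.lit 1)) <| .seq (emitC (.var .rl)) <|
  .seq (.set .ri (nextE (.lit 0))) <| .seq emitSeqC <|
  .put .out (.lit 0) (.lit 0) (.lit 0) (.var .rnv)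

/-- The start symbol is known only now; the first output cell was kept free for it. -/
lemma wp_finalC {ex : ℕ × ℕ} {Q : List ℕ} {e T : ℕ} {G : AlgState} {L : List Rule} {s : St}
    (h : Inv ex Q e T G L s.A (s.v .rnv) (s.v .rolen)) (hk : 8 * Q.length + 12 ≤ s.k) :
    wp finalC (fun s' => (List.range (s'.v .rolen)).map (s'.A .out 0 0) =
      s.v .rnv :: (L ++ [(s.v .rnv, Rhs.seq G.text)]).flatMap encodeRule) s := by
  rw [finalC, wp_seq]
  refine (wp_lengthC h (by omega)).fr.mono ?_
  rintro s1 ⟨⟨a1, a2⟩, hfr1⟩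
  have eA : s1.A = s.A := by funext id; exact hfr1.A id (by cases id <;> rfl)
  have env : s1.v .rnv = s.v .rnv := hfr1.v .rnv rfl
  have eol : s1.v .rolen = s.v .rolen := hfr1.v .rolen rfl
  have h0 := h.out
  rw [← eA, ← eol] at h0
  rw [wp_seq]
  refine wp_emitC h0 (by omega) fun A2 hA2 h2 => ?_
  rw [wp_seq]
  refine wp_emitC h2 (by simp only; omega) fun A3 hA3 h3 => ?_
  rw [wp_seq]
  refine wp_emitC h3 (by simp only; omega) fun A4 hA4 h4 => ?_
  simp only [wp_seq_eq, wp_set, Exp.eval, St.setv, nextE, Function.update_self, Function.update_of_ne, ne_eq,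
    reduceCtorEq, not_false_eq_true, a1, env] at h4 ⊢
  refine ⟨by omega, ?_⟩
  have eA4 : ∀ id, id ≠ .out → A4 id = s.A id := fun id hid =>
    (hA4 id hid).trans ((hA3 id hid).trans ((hA2 id hid).trans (by rw [eA])))
  have hP : Lnk (0 :: (Q ++ [e])) A4 := h.full.lnk.congr (eA4 .nb (by simp)) (eA4 .tok (by simp))
  have etok : tokOf A4 = tokOf s.A := by
    funext z; rw [tokOf, tokOf, eA4 .tok (by simp)]
  refine (wp_emitSeqC (P := 0 :: (Q ++ [e])) (p := 1) (n := Q.length) hP (by simpa using h4) (by simpa using a1)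
    (by simp; omega) (fun hn => ?_) (by simp only; omega)).fr.mono ?_
  · have hlt : 1 < (0 :: (Q ++ [e])).length := by simp
    have := (hP.next (p := 0) (i := 0) (by simp) (List.getElem?_eq_getElem hlt)).1
    simp [this]
  rintro s5 ⟨⟨b1, b2⟩, hfr5⟩
  have e5 : s5.v .rnv = s.v .rnv := (hfr5.v .rnv rfl).trans (by simpa using env)
  simp only [wp_put, Exp.eval, St.putA, e5]
  refine ⟨by simp only at b2; omega, ?_⟩
  obtain ⟨c1, c2⟩ := b1
  have ht : ((List.drop 1 (0 :: (Q ++ [e]))).take Q.length).map (tokOf A4) = G.text := by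
    rw [etok, h.text]; simp
  simp only [ht] at c1 c2
  have hl : (L ++ [(s.v .rnv, Rhs.seq G.text)]).flatMap encodeRule =
      L.flatMap encodeRule ++ [s.v .rnv, 1, Q.length] ++ G.text := by
    simp [encodeRule, h.text]
  rw [hl, c1, List.range_succ_eq_map, List.map_cons, List.map_map]
  congr 1
  refine List.ext_getElem? fun i => ?_
  by_cases hi : i < (L.flatMap encodeRule ++ [s.v .rnv, 1, Q.length] ++ G.text).length
  · rw [c2 i hi, List.getElem?_map, List.getElem?_range hi]
    simp [Arrays.upd]
  · rw [List.getElem?_eq_none (by simpa using hi), List.getElem?_eq_none (by omega)]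

/-! ### The whole program -/

def rlmrrepairC : Cmd := .seq initC <| .seq mainC finalC

/-- At the end every pair occurs at most once, so no maximal repeat is left. The initial potential
with `|Q| = n`, `T = 2 * (n + 1)`, `rf = n + 2`, and the costs of start and end, are below `1000 *
(n + 1)`. -/
lemma wp_rlmrrepairC {Tx : List ℕ} : wp rlmrrepairC (fun s => ∃ G, Constructs Tx G ∧
    Represents ((List.range (s.v .rolen)).map (s.A .out 0 0)) G) (initSt Tx (1000 * (Tx.length + 1))) := by
  rw [rlmrrepairC, wp_seq]
  refine (wp_initC (Tx := Tx) rfl (fun i => by simp [initSt]) (fun id hid i j k => ?_) ?_).mono ?_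
  · cases id <;> simp_all [initSt]
  · simp only [initSt]; omega
  rintro s1 ⟨Q, ν, L, a1, a2, a3, a4, a5, a6, a7⟩
  simp only [initSt] at a7
  rw [wp_seq]
  refine (wp_mainC a3 a4 a5 a6 (by omega)).mono ?_
  rintro s2 ⟨Q', T', G', L', b1, b2, b3, b4, b5⟩
  refine (wp_finalC b2 (by omega)).mono fun s3 h3 => ?_
  have hr : s2.v .rnv ∉ G'.vars := fun h => Nat.lt_irrefl _ (b2.vars_lt _ h)
  refine ⟨_, ⟨ν, G', s2.v .rnv, a2, b1, not_maximalRepeat b2.zero_notMem b4, hr, rfl⟩,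
    L' ++ [(s2.v .rnv, Rhs.seq G'.text)], ?_, ?_, h3⟩
  · refine List.nodup_append.2 ⟨b2.nodup, List.nodup_singleton _, fun ρ h1 ρ' h2 h12 => ?_⟩
    rw [List.mem_singleton] at h2
    subst h12 h2
    have := b2.rules_lt _ (b2.rules ▸ List.mem_toFinset.2 h1)
    exact Nat.lt_irrefl _ this
  · ext ρ
    simp [← b2.rules, or_comm]

end RLMRRePair

theorem theorem1 :
    ∃ (P : RLMRRePair.Prog) (C c : ℕ),
      ∀ (σ : ℕ) (T : List ℕ), (∀ a ∈ T, a < σ) →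
        ∀ w : ℕ, (T.length + σ + 2) ^ c ≤ 2 ^ w →
          (∀ (ω : ℕ → Fin (2 ^ w)) (s : RLMRRePair.Store), RLMRRePair.HaltsWith P w T ω s →
            ∃ G : RLMRRePair.Grammar, RLMRRePair.Constructs T G ∧
              RLMRRePair.Represents s.output G) ∧
          RLMRRePair.expectedTime P w T ≤ (C : ENNReal) * (T.length + 1) :=
  RLMRRePair.exists_prog_of_wp RLMRRePair.rlmrrepairC 1000
    -- The size of the program is a concrete number, for which `2 ^ 100` leaves ample room.
    (by simp [RLMRRePair.rlmrrepairC, RLMRRePair.Cmd.size]; decide +kernel)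
    fun _ => RLMRRePair.wp_rlmrrepairC
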